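/- **Setting.** Fix Lipschitz functions $\sigma,\varphi:\mathbb{R}\to\mathbb{R}$ and a discount factor $\gamma\in[0,1)$. A data set consists of $n$ transitions $s_i\to s_i'$ ($i=1,\dots,n$) between states in $\mathbb{R}^d$. Let $m$ be the number of distinct states occurring in it and $\hat S\in\mathbb{R}^{d\times m}$ the matrix whose columns are these states. For a normalization $\kappa>0$ let $\hat U,\hat V\in\mathbb{R}^{m\times n}$ be the matrices whose $i$-th columns are $\kappa$ times the one-hot vectors of $s_i$ and of $s_i'$, respectively (for example $\kappa=1/\sqrt n$), let $\hat A=\hat U(\hat U-\gamma\hat V)^T$ and $H(\hat A)=\frac12(\hat A+\hat A^T)$. Let $W=\varphi(\tilde W)\in\mathbb{R}^{N\times d}$, where $\tilde W$ has independent $\mathcal{N}(0,1)$ entries and $\varphi$ acts entrywise, let $\Sigma=\sigma(W\hat S)\in\mathbb{R}^{N\times m}$ (entrywise), and for $\lambda>0$ let $$Q_m(\lambda)=\Big[\tfrac1m(\hat U-\gamma\hat V)^T\Sigma^T\Sigma\,\hat U+\lambda I_n\Big]^{-1}.$$ Let $\Phi=\mathbb{E}_w\big[\sigma(w^T\hat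 S)^T\sigma(w^T\hat S)\big]\in\mathbb{R}^{m\times m}$, where $w$ has the law of a row of $W$, i.e. $w=\varphi(\tilde w)$ with $\tilde w\sim\mathcal{N}(0,I_d)$. For $\delta\ge 0$ put $$\bar Q_m(\lambda)=\Big[\tfrac Nm\tfrac1{1+\delta}(\hat U-\gamma\hat V)^T\Phi\,\hat U+\lambda I_n\Big]^{-1}.$$ **Assumptions.** Consider a sequence of data sets, of normalizations $\kappa$ and of numbers of features $N$ such that: 1. $m\to\infty$, the ratios $N/m$ and $d/m$ are eventually bounded above and bounded away from $0$, and the operator norms $\|\hat S\|$ are eventually bounded; 2. $\|\hat U\|$ and $\|\hat V\|$ are bounded along the sequence (automatic for $\kappa=1/\sqrt n$); 3. there are $0<\xi_{\min}\le\xi_{\max}$ such that for every member of the sequence all eigenvalues of $H(\hat A)$ lie in $[\xi_{\min},\xi_{\max}]$. **Theorem.** - For each data set of the sequence, every number of features $N\geq 0$ and every $\lambda>0$, the matrix inverted in $Q_m(\lambda)$ is invertible for every $W$, and the entries of $Q_m(\lambda)$ are integrable. - For each data set of the sequence, every number of features $N\ge0$ and every $\lambda>0$, the equation $$\delta=\tfrac1m\operatorname{Tr}\Big((\hat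 U-\gamma\hat V)^T\Phi\,\hat U\Big[\tfrac Nm\tfrac1{1+\delta}(\hat U-\gamma\hat V)^T\Phi\,\hat U+\lambda I_n\Big]^{-1}\Big)$$ has exactly one solution $\delta\in[0,\infty)$; this $\delta$ is positive whenever $\Phi\ne0$, and for it the matrix inverted in $\bar Q_m(\lambda)$ is invertible. - With this $\delta$, for every $\lambda>0$, along the sequence, $$\lim_{m\to\infty}\big\|\mathbb{E}_W[Q_m(\lambda)]-\bar Q_m(\lambda)\big\|=0$$ in operator norm. - For a fixed data set of the sequence, the correction factor $\delta$ diminishes as $\lambda$ or $N$ grows: it is strictly decreasing in $\lambda\in(0,\infty)$ if $\Phi\ne0$, it tends to $0$ as $\lambda\to\infty$ with $N$ fixed, and it tends to $0$ as $N\to\infty$ with $\lambda$ fixed. -/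

import Mathlib

open Filter Topology MeasureTheory ProbabilityTheory
open scoped NNReal Matrix Matrix.Norms.L2Operator

noncomputable section

namespace RFLSTD

/-- The states of a training set of `n` transitions `s i → s' i` with states in `ℝ^d`. -/
structure TrainingData (d n : ℕ) where
  /-- current states -/
  s : Fin n → Fin d → ℝ
  /-- next states -/
  s' : Fin n → Fin d → ℝ

/-- Feature matrix `Σ_A = σ(W A)`, with `σ` applied entrywise. -/
def features (σ : ℝ → ℝ) {N d : ℕ} {ι : Type*} (W : Matrix (Fin N) (Fin d) ℝ)
    (A : Matrix (Fin d) ι ℝ) : Matrix (Fin N) ι ℝ :=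
  (W * A).map σ

/-- The standard Gaussian law on `ℝ^d` (independent `N(0,1)` coordinates). -/
def gaussianVector (d : ℕ) : Measure (Fin d → ℝ) :=
  Measure.pi fun _ => gaussianReal 0 1

/-- The law of an `N × d` matrix with independent `N(0,1)` entries. -/
def gaussianMatrix (N d : ℕ) : Measure (Fin N → Fin d → ℝ) :=
  Measure.pi fun _ => gaussianVector d

/-- The random weight matrix `W = φ(W̃)`, with `φ` applied entrywise. -/
def weights (φ : ℝ → ℝ) {N d : ℕ} (W' : Fin N → Fin d → ℝ) : Matrix (Fin N) (Fin d) ℝ :=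
  Matrix.of fun i j => φ (W' i j)

namespace TrainingData

variable {d n : ℕ} (D : TrainingData d n)

/-- The finite set of distinct states that occur in the training set. -/
def visited : Finset (Fin d → ℝ) :=
  Finset.univ.image D.s ∪ Finset.univ.image D.s'

/-- The number of distinct visited states. -/
def m : ℕ := D.visited.card

/-- The state matrix of the visited states: its columns are the visited states. -/
def stateMatrix : Matrix (Fin d) D.visited ℝ :=
  Matrix.of fun l i => i.1 l

/-- `Û`: column `j` is `κ` times the one-hot vector of the state `s j`. -/
def U (κ : ℝ) : Matrix D.visited (Fin n) ℝ :=
  Matrix.of fun i j => if D.s j = i.1 then κ else 0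

/-- `V̂`: column `j` is `κ` times the one-hot vector of the state `s' j`. -/
def V (κ : ℝ) : Matrix D.visited (Fin n) ℝ :=
  Matrix.of fun i j => if D.s' j = i.1 then κ else 0

/-- The empirical transition model matrix `Â = Û (Û - γ V̂)ᵀ`. -/
def transitionModel (κ γ : ℝ) : Matrix D.visited D.visited ℝ :=
  D.U κ * (D.U κ - γ • D.V κ)ᵀ

/-- The symmetric part `H(Â)`. -/
def symmTransitionModel (κ γ : ℝ) : Matrix D.visited D.visited ℝ :=
  (1 / 2 : ℝ) • (D.transitionModel κ γ + (D.transitionModel κ γ)ᵀ)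

/-- `(1/m) (Û - γ V̂)ᵀ Σᵀ Σ Û + lam I` for the features `Σ = σ(W Ŝ)`; its inverse is the
resolvent. -/
def resolventInv (σ : ℝ → ℝ) (κ γ lam : ℝ) {N : ℕ} (W : Matrix (Fin N) (Fin d) ℝ) :
    Matrix (Fin n) (Fin n) ℝ :=
  (1 / (D.m : ℝ)) • ((D.U κ - γ • D.V κ)ᵀ *
      ((features σ W D.stateMatrix)ᵀ * features σ W D.stateMatrix) * D.U κ) +
    lam • (1 : Matrix (Fin n) (Fin n) ℝ)

/-- The random-feature LSTD resolvent `Q(lam)`. -/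
def Q (σ : ℝ → ℝ) (κ γ lam : ℝ) {N : ℕ} (W : Matrix (Fin N) (Fin d) ℝ) :
    Matrix (Fin n) (Fin n) ℝ :=
  (D.resolventInv σ κ γ lam W)⁻¹

/-- The expected resolvent `E_W[Q(lam)]`, entrywise, for `W = φ(W̃)` with `N` rows. -/
def expectedQ (σ φ : ℝ → ℝ) (κ γ lam : ℝ) (N : ℕ) : Matrix (Fin n) (Fin n) ℝ :=
  Matrix.of fun i j => ∫ W', D.Q σ κ γ lam (weights φ W') i j ∂(gaussianMatrix N d)

/-- The deterministic Gram feature matrix `Φ = E_w[σ(wᵀ Ŝ)ᵀ σ(wᵀ Ŝ)]`, where `w = φ(w̃)` has the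
law of a row of `W`. -/
def Phi (σ φ : ℝ → ℝ) : Matrix D.visited D.visited ℝ :=
  Matrix.of fun i j => ∫ w, σ (∑ l, φ (w l) * D.stateMatrix l i) *
    σ (∑ l, φ (w l) * D.stateMatrix l j) ∂(gaussianVector d)

/-- `(Û - γ V̂)ᵀ Φ Û`. -/
def B (σ φ : ℝ → ℝ) (κ γ : ℝ) : Matrix (Fin n) (Fin n) ℝ :=
  (D.U κ - γ • D.V κ)ᵀ * D.Phi σ φ * D.U κ

/-- `(N/m) (1/(1+δ)) (Û - γ V̂)ᵀ Φ Û + lam I`. -/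
def QbarInv (σ φ : ℝ → ℝ) (κ γ lam : ℝ) (N : ℕ) (δ : ℝ) : Matrix (Fin n) (Fin n) ℝ :=
  (((N : ℝ) / (D.m : ℝ)) * (1 / (1 + δ))) • D.B σ φ κ γ +
    lam • (1 : Matrix (Fin n) (Fin n) ℝ)

/-- The deterministic resolvent, for a given value of the correction factor `δ`. -/
def Qbar (σ φ : ℝ → ℝ) (κ γ lam : ℝ) (N : ℕ) (δ : ℝ) : Matrix (Fin n) (Fin n) ℝ :=
  (D.QbarInv σ φ κ γ lam N δ)⁻¹

/-- `δ` solves the scalar fixed-point equation of the correction factor. -/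
def SolvesFixedPoint (σ φ : ℝ → ℝ) (κ γ lam : ℝ) (N : ℕ) (δ : ℝ) : Prop :=
  δ = (1 / (D.m : ℝ)) * Matrix.trace (D.B σ φ κ γ * D.Qbar σ φ κ γ lam N δ)

end TrainingData

/-- Double asymptotic regime: the number `m` of visited states tends to infinity, the ratios `N/m`
and `d/m` stay between two positive constants (so that `N, d → ∞` as well), and the operator norm
of the state matrix stays bounded. -/
structure DoubleAsymptotic (N d n : ℕ → ℕ) (D : ∀ k, TrainingData (d k) (n k)) : Prop where
  m_tendsto : Tendsto (fun k => (D k).m) atTop atTop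
  ratios : ∃ c C : ℝ, 0 < c ∧ ∀ᶠ k in atTop,
    (N k : ℝ) / ((D k).m : ℝ) ∈ Set.Icc c C ∧ (d k : ℝ) / ((D k).m : ℝ) ∈ Set.Icc c C
  states_bounded : ∃ KS : ℝ, ∀ᶠ k in atTop, ‖(D k).stateMatrix‖ ≤ KS

/-- Bounded eigenspectrum: all eigenvalues of the matrices `H(Â)` lie in one compact interval of
positive reals. -/
def BoundedSpectrum {d n : ℕ → ℕ} (D : ∀ k, TrainingData (d k) (n k)) (κ : ℕ → ℝ) (γ : ℝ) :
    Prop :=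
  ∃ ξmin ξmax : ℝ, 0 < ξmin ∧ ∀ k,
    spectrum ℝ ((D k).symmTransitionModel (κ k) γ) ⊆ Set.Icc ξmin ξmax

/-- The normalization `κ` of the one-hot columns keeps `Û` and `V̂` bounded in operator norm. For
`κ = 1/√n` both norms are at most `1`. -/
def BoundedNormalization {d n : ℕ → ℕ} (D : ∀ k, TrainingData (d k) (n k)) (κ : ℕ → ℝ) : Prop :=
  ∃ K : ℝ, ∀ k, 0 < κ k ∧ ‖(D k).U (κ k)‖ ≤ K ∧ ‖(D k).V (κ k)‖ ≤ K

end RFLSTD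

end

/-! Write C = Û - γV̂ and A = ÛCᵀ. Since H(A) ≥ ξ > 0, A is coercive, hence invertible with coercive
inverse. For every Z the inverse of CᵀZÛ + λ is an affine function of (λA⁻¹ + Z)⁻¹ (`push_through`),
with coefficients that depend only on A, C, Û and λ and are bounded. For Q the matrix Z is a Gram
matrix YᵀY whose rows are m^{-1/2} times the feature vectors; for Q̄ it is a multiple of Φ. So it
suffices to compare E[K], where K = (P + YᵀY)⁻¹ and P = λA⁻¹ is coercive but not symmetric, with a
deterministic resolvent.

Coercivity bounds K, YK, KYᵀ and YKYᵀ independently of ‖Y‖, so these are globally Lipschitz in Y, up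
to the factor Y in YK. Lipschitz functions of a Gaussian matrix have centred fourth moments of order
L⁴ (`integral_sub_integral_pow_four_le`, by rotating one Gaussian vector into an independent copy).
Hence the leverage D = 1 - yᵀKy of a row y = x/√m fluctuates at order m^{-1/2}, and the functionals
uᵀKx have bounded fourth moments.

Let K₋ be the resolvent without that row; it is independent of x. Then Kx = D K₋x and D⁻¹ = 1 +
xᵀK₋x/m. With K̄ = (P + (N/m)E[D]Φ)⁻¹, expand K - K̄ by the resolvent identity, replace D by its
mean and E[K₋] by E[K]: the main terms cancel, and ‖E[K] - K̄‖ = O(m^{-1/2})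
(`norm_expMat_res_sub_le`). Averaging D·D⁻¹ = 1 in the same way shows that E[D] solves the
fixed-point equation up to O(m^{-1/2}) (`abs_one_sub_meanLev_mul_le`).

In the variable t = 1 + δ the fixed-point equation reads 1 - 1/t = g(λt), where g(s) = m⁻¹ tr(Φ(sA⁻¹
+ (N/m)Φ)⁻¹) is antitone (`traceFun_sub`) and tends to 0. The left side increases and the right side
decreases in t. This gives existence, uniqueness, monotonicity in λ, and the stability estimate
`fixed_point_stable` that turns the approximate solution E[D] into 1/(1+δ) up to O(m^{-1/2}). The
limits of δ follow from g → 0 at infinity and from g ≤ m/N. -/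

noncomputable section

namespace RFLSTD

set_option linter.unusedSectionVars false

/-! ### Resolvents of coercive matrices plus Gram matrices -/

section LinearAlgebra

variable {ι κ ν : Type*} [Fintype ι] [Fintype κ] [Fintype ν]
  [DecidableEq ι] [DecidableEq κ] [DecidableEq ν]

lemma norm_toLp_sq (v : ι → ℝ) : ‖WithLp.toLp 2 v‖ ^ 2 = v ⬝ᵥ v := by
  rw [EuclideanSpace.real_norm_sq_eq]
  simp [dotProduct, sq]

lemma norm_toLp_eq_sqrt (v : ι → ℝ) : ‖WithLp.toLp 2 v‖ = √(v ⬝ᵥ v) := by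
  rw [← norm_toLp_sq, Real.sqrt_sq (norm_nonneg _)]

lemma dotProduct_self_nonneg' (v : ι → ℝ) : 0 ≤ v ⬝ᵥ v := by
  rw [← norm_toLp_sq]; positivity

lemma abs_dotProduct_le (u v : ι → ℝ) :
    |u ⬝ᵥ v| ≤ ‖WithLp.toLp 2 u‖ * ‖WithLp.toLp 2 v‖ := by
  have h := abs_real_inner_le_norm (WithLp.toLp 2 u : EuclideanSpace ℝ ι) (WithLp.toLp 2 v)
  rw [EuclideanSpace.inner_toLp_toLp] at h
  simpa [dotProduct_comm] using h

lemma norm_toLp_mulVec_le (T : Matrix κ ι ℝ) (v : ι → ℝ) :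
    ‖WithLp.toLp 2 (T *ᵥ v)‖ ≤ ‖T‖ * ‖WithLp.toLp 2 v‖ :=
  Matrix.l2_opNorm_mulVec T (WithLp.toLp 2 v)

lemma abs_dotProduct_mulVec_le (T : Matrix κ ι ℝ) (u : κ → ℝ) (v : ι → ℝ) :
    |u ⬝ᵥ T *ᵥ v| ≤ ‖T‖ * (‖WithLp.toLp 2 u‖ * ‖WithLp.toLp 2 v‖) := by
  refine (abs_dotProduct_le _ _).trans ?_
  have h := mul_le_mul_of_nonneg_left (norm_toLp_mulVec_le T v) (norm_nonneg (WithLp.toLp 2 u))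
  linarith

lemma opNorm_le_of_mulVec (T : Matrix κ ι ℝ) {C : ℝ} (hC : 0 ≤ C)
    (h : ∀ v : ι → ℝ, ‖WithLp.toLp 2 (T *ᵥ v)‖ ≤ C * ‖WithLp.toLp 2 v‖) : ‖T‖ ≤ C := by
  rw [Matrix.l2_opNorm_def]
  refine ContinuousLinearMap.opNorm_le_bound _ hC fun x => ?_
  exact h x.ofLp

lemma norm_transpose (T : Matrix κ ι ℝ) : ‖Tᵀ‖ = ‖T‖ := by
  rw [← Matrix.conjTranspose_eq_transpose_of_trivial, Matrix.l2_opNorm_conjTranspose]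

/-- A bilinear bound on unit vectors bounds the operator norm. -/
lemma opNorm_le_of_bilin (T : Matrix κ ι ℝ) {C : ℝ} (hC : 0 ≤ C)
    (h : ∀ (u : κ → ℝ) (v : ι → ℝ), ‖WithLp.toLp 2 u‖ ≤ 1 → ‖WithLp.toLp 2 v‖ ≤ 1 →
      |u ⬝ᵥ T *ᵥ v| ≤ C) : ‖T‖ ≤ C := by
  have key : ∀ (u : κ → ℝ) (v : ι → ℝ),
      |u ⬝ᵥ T *ᵥ v| ≤ C * (‖WithLp.toLp 2 u‖ * ‖WithLp.toLp 2 v‖) := by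
    intro u v
    rcases eq_or_ne (WithLp.toLp 2 u) 0 with hu | hu
    · have : u = 0 := by simpa using hu
      simp [this]
    rcases eq_or_ne (WithLp.toLp 2 v) 0 with hv | hv
    · have : v = 0 := by simpa using hv
      simp [this]
    have hu' : 0 < ‖WithLp.toLp 2 u‖ := norm_pos_iff.2 hu
    have hv' : 0 < ‖WithLp.toLp 2 v‖ := norm_pos_iff.2 hv
    have := h (‖WithLp.toLp 2 u‖⁻¹ • u) (‖WithLp.toLp 2 v‖⁻¹ • v)
      (by rw [WithLp.toLp_smul, norm_smul, norm_inv, norm_norm, inv_mul_cancel₀ hu'.ne'])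
      (by rw [WithLp.toLp_smul, norm_smul, norm_inv, norm_norm, inv_mul_cancel₀ hv'.ne'])
    rw [Matrix.mulVec_smul, dotProduct_smul, smul_dotProduct, smul_eq_mul, smul_eq_mul, abs_mul,
      abs_mul, abs_of_pos (inv_pos.2 hu'), abs_of_pos (inv_pos.2 hv')] at this
    calc |u ⬝ᵥ T *ᵥ v| = (‖WithLp.toLp 2 v‖⁻¹ * (‖WithLp.toLp 2 u‖⁻¹ * |u ⬝ᵥ T *ᵥ v|)) *
          (‖WithLp.toLp 2 u‖ * ‖WithLp.toLp 2 v‖) := by field_simp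
      _ ≤ _ := by gcongr
  refine opNorm_le_of_mulVec T hC fun v => ?_
  -- Testing with u = Tv recovers ‖Tv‖² from the bilinear form.
  have h1 := key (T *ᵥ v) v
  rw [abs_of_nonneg (dotProduct_self_nonneg' _), ← norm_toLp_sq] at h1
  rcases (norm_nonneg (WithLp.toLp 2 (T *ᵥ v))).eq_or_lt with h0 | h0
  · rw [← h0]; positivity
  · refine le_of_mul_le_mul_left ?_ h0
    calc _ = ‖WithLp.toLp 2 (T *ᵥ v)‖ ^ 2 := by ring
      _ ≤ _ := h1
      _ = _ := by ring

/-- The operator norm is at most the Frobenius norm. -/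
lemma opNorm_le_sqrt_sum_sq (T : Matrix κ ι ℝ) : ‖T‖ ≤ √(∑ a, ∑ i, T a i ^ 2) := by
  refine opNorm_le_of_mulVec T (Real.sqrt_nonneg _) fun v => ?_
  refine Real.le_sqrt_of_sq_le (y := _) ?_ |>.trans_eq (Real.sqrt_mul_self (by positivity))
  rw [norm_toLp_sq, ← sq, mul_pow, Real.sq_sqrt (by positivity), norm_toLp_sq, Finset.sum_mul,
    dotProduct]
  refine Finset.sum_le_sum fun a _ => ?_
  have := Finset.sum_mul_sq_le_sq_mul_sq Finset.univ (T a) v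
  simp only [Matrix.mulVec, dotProduct]
  calc _ = (∑ i, T a i * v i) ^ 2 := by ring
    _ ≤ _ := this
    _ = _ := by simp [sq]

/-- `P` is coercive with constant `p`. -/
def Coercive (P : Matrix ι ι ℝ) (p : ℝ) : Prop :=
  ∀ v : ι → ℝ, p * (v ⬝ᵥ v) ≤ v ⬝ᵥ P *ᵥ v

lemma Coercive.transpose {P : Matrix ι ι ℝ} {p : ℝ} (h : Coercive P p) : Coercive Pᵀ p := by
  intro v
  rw [Matrix.mulVec_transpose, dotProduct_comm v (v ᵥ* P), ← Matrix.dotProduct_mulVec]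
  exact h v

lemma Coercive.isUnit {P : Matrix ι ι ℝ} {p : ℝ} (h : Coercive P p) (hp : 0 < p) : IsUnit P := by
  rw [← Matrix.mulVec_injective_iff_isUnit]
  intro v w hvw
  have h1 := h (v - w)
  have h2 : P *ᵥ (v - w) = 0 := by rw [Matrix.mulVec_sub]; exact sub_eq_zero.2 hvw
  rw [h2, dotProduct_zero] at h1
  have h3 : (v - w) ⬝ᵥ (v - w) = 0 :=
    le_antisymm (by nlinarith [dotProduct_self_nonneg' (v - w)]) (dotProduct_self_nonneg' _)
  exact sub_eq_zero.1 (dotProduct_self_eq_zero.1 h3)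

/-- The regularised resolvent `(P + YᵀY)⁻¹`. -/
def res (P : Matrix ι ι ℝ) (Y : Matrix κ ι ℝ) : Matrix ι ι ℝ := (P + Yᵀ * Y)⁻¹

variable {P : Matrix ι ι ℝ} {p : ℝ}

lemma dotProduct_gram (Y : Matrix κ ι ℝ) (v w : ι → ℝ) :
    v ⬝ᵥ (Yᵀ * Y) *ᵥ w = (Y *ᵥ v) ⬝ᵥ (Y *ᵥ w) := by
  rw [← Matrix.mulVec_mulVec, Matrix.dotProduct_mulVec, Matrix.vecMul_transpose]

lemma Coercive.add_gram (h : Coercive P p) (Y : Matrix κ ι ℝ) : Coercive (P + Yᵀ * Y) p := by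
  intro v
  rw [Matrix.add_mulVec, dotProduct_add, dotProduct_gram]
  linarith [h v, dotProduct_self_nonneg' (Y *ᵥ v)]

lemma Coercive.isUnit_add_gram (h : Coercive P p) (hp : 0 < p) (Y : Matrix κ ι ℝ) :
    IsUnit (P + Yᵀ * Y) := (h.add_gram Y).isUnit hp

lemma Coercive.mul_res (h : Coercive P p) (hp : 0 < p) (Y : Matrix κ ι ℝ) :
    (P + Yᵀ * Y) * res P Y = 1 :=
  Matrix.mul_nonsing_inv _ ((Matrix.isUnit_iff_isUnit_det _).1 (h.isUnit_add_gram hp Y))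

lemma Coercive.res_mul (h : Coercive P p) (hp : 0 < p) (Y : Matrix κ ι ℝ) :
    res P Y * (P + Yᵀ * Y) = 1 :=
  Matrix.nonsing_inv_mul _ ((Matrix.isUnit_iff_isUnit_det _).1 (h.isUnit_add_gram hp Y))

lemma transpose_res (P : Matrix ι ι ℝ) (Y : Matrix κ ι ℝ) : (res P Y)ᵀ = res Pᵀ Y := by
  rw [res, Matrix.transpose_nonsing_inv, res, Matrix.transpose_add, Matrix.transpose_mul,
    Matrix.transpose_transpose]

/-- The energy inequality for the resolvent. -/
lemma Coercive.energy (h : Coercive P p) (hp : 0 < p) (Y : Matrix κ ι ℝ) (v : ι → ℝ) :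
    p * ‖WithLp.toLp 2 (res P Y *ᵥ v)‖ ^ 2 + ‖WithLp.toLp 2 (Y *ᵥ (res P Y *ᵥ v))‖ ^ 2 ≤
      (res P Y *ᵥ v) ⬝ᵥ v := by
  have h1 := h (res P Y *ᵥ v)
  have h2 : (P + Yᵀ * Y) *ᵥ (res P Y *ᵥ v) = v := by
    rw [Matrix.mulVec_mulVec, h.mul_res hp, Matrix.one_mulVec]
  have h3 : (res P Y *ᵥ v) ⬝ᵥ (P + Yᵀ * Y) *ᵥ (res P Y *ᵥ v) = (res P Y *ᵥ v) ⬝ᵥ v := by rw [h2]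
  rw [Matrix.add_mulVec, dotProduct_add, dotProduct_gram, ← norm_toLp_sq (Y *ᵥ _)] at h3
  rw [norm_toLp_sq (res P Y *ᵥ v)]
  linarith

/-- The energy inequality and Cauchy–Schwarz give p‖Kv‖² ≤ ‖Kv‖‖v‖. Symmetry of P plays no role. -/
lemma Coercive.norm_res_le (h : Coercive P p) (hp : 0 < p) (Y : Matrix κ ι ℝ) :
    ‖res P Y‖ ≤ p⁻¹ := by
  refine opNorm_le_of_mulVec _ (inv_nonneg.2 hp.le) fun v => ?_
  have h1 := h.energy hp Y v
  have h2 := (le_abs_self _).trans (abs_dotProduct_le (res P Y *ᵥ v) v)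
  set a := ‖WithLp.toLp 2 (res P Y *ᵥ v)‖
  have ha : 0 ≤ a := norm_nonneg _
  rw [inv_mul_eq_div, le_div_iff₀ hp]
  rcases ha.eq_or_lt with h0 | h0
  · rw [← h0, zero_mul]; exact norm_nonneg _
  · refine le_of_mul_le_mul_left ?_ h0
    nlinarith [sq_nonneg ‖WithLp.toLp 2 (Y *ᵥ (res P Y *ᵥ v))‖]

/-- The second energy term gives ‖YKv‖² ≤ ⟨Kv, v⟩ ≤ p⁻¹‖v‖². The bound is free of ‖Y‖, which is
random and unbounded. -/
lemma Coercive.norm_mul_res_le (h : Coercive P p) (hp : 0 < p) (Y : Matrix κ ι ℝ) :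
    ‖Y * res P Y‖ ≤ (√p)⁻¹ := by
  refine opNorm_le_of_mulVec _ (inv_nonneg.2 (Real.sqrt_nonneg p)) fun v => ?_
  have h1 := h.energy hp Y v
  have h2 := (le_abs_self _).trans (abs_dotProduct_le (res P Y *ᵥ v) v)
  have h3 := norm_toLp_mulVec_le (res P Y) v
  have h4 := mul_le_mul_of_nonneg_right (h.norm_res_le hp Y) (norm_nonneg (WithLp.toLp 2 v))
  rw [← Matrix.mulVec_mulVec]
  set a := ‖WithLp.toLp 2 (res P Y *ᵥ v)‖
  set b := ‖WithLp.toLp 2 (Y *ᵥ (res P Y *ᵥ v))‖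
  set c := ‖WithLp.toLp 2 v‖
  have hc : 0 ≤ c := norm_nonneg _
  refine abs_le_of_sq_le_sq' (a := b) ?_ (by positivity) |>.2
  rw [mul_pow, inv_pow, Real.sq_sqrt hp.le]
  have h5 : a * c ≤ p⁻¹ * c * c := by gcongr; exact h3.trans h4
  have h6 : 0 ≤ p * a ^ 2 := by positivity
  linarith

lemma Coercive.norm_res_mul_le (h : Coercive P p) (hp : 0 < p) (Y : Matrix κ ι ℝ) :
    ‖res P Y * Yᵀ‖ ≤ (√p)⁻¹ := by
  rw [← norm_transpose, Matrix.transpose_mul, Matrix.transpose_transpose, transpose_res]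
  exact h.transpose.norm_mul_res_le hp Y

/-- The energy inequality at Yᵀv reads ‖YKYᵀv‖² ≤ ⟨YKYᵀv, v⟩. -/
lemma Coercive.norm_mul_res_mul_le (h : Coercive P p) (hp : 0 < p) (Y : Matrix κ ι ℝ) :
    ‖Y * res P Y * Yᵀ‖ ≤ 1 := by
  refine opNorm_le_of_mulVec _ zero_le_one fun v => ?_
  have h1 := h.energy hp Y (Yᵀ *ᵥ v)
  rw [Matrix.dotProduct_mulVec, Matrix.vecMul_transpose] at h1
  have h2 := (le_abs_self _).trans (abs_dotProduct_le (Y *ᵥ (res P Y *ᵥ (Yᵀ *ᵥ v))) v)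
  rw [← Matrix.mulVec_mulVec, ← Matrix.mulVec_mulVec]
  set b := ‖WithLp.toLp 2 (Y *ᵥ (res P Y *ᵥ (Yᵀ *ᵥ v)))‖
  have hb : 0 ≤ b := norm_nonneg _
  rcases hb.eq_or_lt with h0 | h0
  · rw [← h0]; positivity
  · refine le_of_mul_le_mul_left ?_ h0
    nlinarith [mul_nonneg hp.le (sq_nonneg ‖WithLp.toLp 2 (res P Y *ᵥ (Yᵀ *ᵥ v))‖)]

/-- The difference of the Gram matrices is split so that Y' stands next to the resolvent of Y' and Y
next to the resolvent of Y. -/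
lemma Coercive.res_sub_res (h : Coercive P p) (hp : 0 < p) (Y Y' : Matrix κ ι ℝ) :
    res P Y - res P Y' =
      res P Y' * (Y'ᵀ * (Y' - Y) + (Y' - Y)ᵀ * Y) * res P Y := by
  have h1 : Y'ᵀ * (Y' - Y) + (Y' - Y)ᵀ * Y = (P + Y'ᵀ * Y') - (P + Yᵀ * Y) := by
    rw [Matrix.transpose_sub, Matrix.mul_sub, Matrix.sub_mul]; abel
  rw [h1, Matrix.mul_sub, Matrix.sub_mul, h.res_mul hp, Matrix.mul_assoc, h.mul_res hp,
    Matrix.one_mul, Matrix.mul_one]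

lemma norm_mul₃_le {α β : Type*} [Fintype α] [Fintype β] [DecidableEq α] [DecidableEq β]
    (A : Matrix κ ι ℝ) (B : Matrix ι α ℝ) (C : Matrix α β ℝ) {a b c : ℝ}
    (hA : ‖A‖ ≤ a) (hB : ‖B‖ ≤ b) (hC : ‖C‖ ≤ c) : ‖A * B * C‖ ≤ a * b * c := by
  have ha : 0 ≤ a := (norm_nonneg _).trans hA
  have hb : 0 ≤ b := (norm_nonneg _).trans hB
  refine (Matrix.l2_opNorm_mul _ _).trans ?_
  have h1 := (Matrix.l2_opNorm_mul A B).trans (mul_le_mul hA hB (norm_nonneg _) ha)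
  exact mul_le_mul h1 hC (norm_nonneg _) (by positivity)

/-- Each factor Y or Y' is absorbed by its own resolvent, so the Lipschitz constant is global. The
next two lemmas use the same absorption. -/
lemma Coercive.norm_res_sub_le (h : Coercive P p) (hp : 0 < p) (Y Y' : Matrix κ ι ℝ) :
    ‖res P Y - res P Y'‖ ≤ 2 * (√p)⁻¹ * p⁻¹ * ‖Y - Y'‖ := by
  have e : res P Y - res P Y' = res P Y' * Y'ᵀ * (Y' - Y) * res P Y +
      res P Y' * (Y' - Y)ᵀ * (Y * res P Y) := by
    rw [h.res_sub_res hp]; simp only [Matrix.mul_add, Matrix.add_mul, Matrix.mul_assoc]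
  have hd : ‖Y' - Y‖ ≤ ‖Y - Y'‖ := (norm_sub_rev _ _).le
  have hd' : ‖(Y' - Y)ᵀ‖ ≤ ‖Y - Y'‖ := by rw [norm_transpose]; exact hd
  rw [e]
  refine (norm_add_le _ _).trans ((add_le_add
    (norm_mul₃_le _ _ _ (h.norm_res_mul_le hp Y') hd (h.norm_res_le hp Y))
    (norm_mul₃_le _ _ _ (h.norm_res_le hp Y') hd' (h.norm_mul_res_le hp Y))).trans_eq ?_)
  ring

lemma Coercive.norm_res_mul_sub_le (h : Coercive P p) (hp : 0 < p) (Y Y' : Matrix κ ι ℝ) :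
    ‖res P Y * Yᵀ - res P Y' * Y'ᵀ‖ ≤ 3 * p⁻¹ * ‖Y - Y'‖ := by
  have e : res P Y * Yᵀ - res P Y' * Y'ᵀ = res P Y' * Y'ᵀ * (Y' - Y) * (res P Y * Yᵀ) +
      res P Y' * (Y' - Y)ᵀ * (Y * res P Y * Yᵀ) + res P Y' * (Y - Y')ᵀ := by
    have e1 : res P Y * Yᵀ - res P Y' * Y'ᵀ = (res P Y - res P Y') * Yᵀ +
        res P Y' * (Y - Y')ᵀ := by
      rw [Matrix.transpose_sub, Matrix.mul_sub, Matrix.sub_mul]; abel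
    rw [e1, h.res_sub_res hp]; simp only [Matrix.mul_add, Matrix.add_mul, Matrix.mul_assoc]
  have hd : ‖Y' - Y‖ ≤ ‖Y - Y'‖ := (norm_sub_rev _ _).le
  have hd' : ‖(Y' - Y)ᵀ‖ ≤ ‖Y - Y'‖ := by rw [norm_transpose]; exact hd
  have hd'' : ‖(Y - Y')ᵀ‖ ≤ ‖Y - Y'‖ := by rw [norm_transpose]
  rw [e]
  refine (norm_add₃_le).trans ((add_le_add (add_le_add
    (norm_mul₃_le _ _ _ (h.norm_res_mul_le hp Y') hd (h.norm_res_mul_le hp Y))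
    (norm_mul₃_le _ _ _ (h.norm_res_le hp Y') hd' (h.norm_mul_res_mul_le hp Y)))
    ((Matrix.l2_opNorm_mul _ _).trans (mul_le_mul (h.norm_res_le hp Y') hd'' (norm_nonneg _)
      (inv_nonneg.2 hp.le)))).trans_eq ?_)
  have : (√p)⁻¹ * (√p)⁻¹ = p⁻¹ := by rw [← mul_inv, Real.mul_self_sqrt hp.le]
  linear_combination ‖Y - Y'‖ * this

lemma Coercive.norm_mul_res_mul_sub_le (h : Coercive P p) (hp : 0 < p) (Y Y' : Matrix κ ι ℝ) :
    ‖Y * res P Y * Yᵀ - Y' * res P Y' * Y'ᵀ‖ ≤ 4 * (√p)⁻¹ * ‖Y - Y'‖ := by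
  have e : Y * res P Y * Yᵀ - Y' * res P Y' * Y'ᵀ =
      Y' * res P Y' * Y'ᵀ * (Y' - Y) * (res P Y * Yᵀ) +
      Y' * res P Y' * (Y' - Y)ᵀ * (Y * res P Y * Yᵀ) + Y' * res P Y' * (Y - Y')ᵀ
      + (Y - Y') * (res P Y * Yᵀ) := by
    have e1 : Y * res P Y * Yᵀ - Y' * res P Y' * Y'ᵀ = Y' * (res P Y - res P Y') * Yᵀ +
        Y' * res P Y' * (Y - Y')ᵀ + (Y - Y') * (res P Y * Yᵀ) := by
      rw [Matrix.transpose_sub]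
      simp only [Matrix.mul_sub, Matrix.sub_mul, Matrix.mul_assoc]; abel
    rw [e1, h.res_sub_res hp]; simp only [Matrix.mul_add, Matrix.add_mul, Matrix.mul_assoc]
  have hd : ‖Y' - Y‖ ≤ ‖Y - Y'‖ := (norm_sub_rev _ _).le
  have hd' : ‖(Y' - Y)ᵀ‖ ≤ ‖Y - Y'‖ := by rw [norm_transpose]; exact hd
  have hd'' : ‖(Y - Y')ᵀ‖ ≤ ‖Y - Y'‖ := by rw [norm_transpose]
  have hs : 0 ≤ (√p)⁻¹ := by positivity
  rw [e]
  refine (norm_add_le _ _).trans ((add_le_add ((norm_add₃_le).trans (add_le_add (add_le_add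
    (norm_mul₃_le _ _ _ (h.norm_mul_res_mul_le hp Y') hd (h.norm_res_mul_le hp Y))
    (norm_mul₃_le _ _ _ (h.norm_mul_res_le hp Y') hd' (h.norm_mul_res_mul_le hp Y)))
    ((Matrix.l2_opNorm_mul _ _).trans (mul_le_mul (h.norm_mul_res_le hp Y') hd'' (norm_nonneg _)
      hs)))) ((Matrix.l2_opNorm_mul _ _).trans (mul_le_mul le_rfl (h.norm_res_mul_le hp Y)
        (norm_nonneg _) (norm_nonneg _)))).trans_eq ?_)
  ring

/-! ### Leaving out one row: rank-one perturbation identities -/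

section LeaveOneOut

variable (Y : Matrix κ ι ℝ) (a : κ)

/-- Zeroing a row instead of deleting it keeps the index type and only removes a rank-one term from
the Gram matrix. -/
lemma gram_updateRow_zero :
    Yᵀ * Y = (Y.updateRow a 0)ᵀ * Y.updateRow a 0 + Matrix.vecMulVec (Y a) (Y a) := by
  ext i j
  simp only [Matrix.add_apply, Matrix.mul_apply, Matrix.transpose_apply, Matrix.vecMulVec_apply]
  rw [← Finset.add_sum_erase _ _ (Finset.mem_univ a), ← Finset.add_sum_erase Finset.univ
    (fun x => Y.updateRow a 0 x i * Y.updateRow a 0 x j) (Finset.mem_univ a)]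
  simp only [Matrix.updateRow_self, Pi.zero_apply, mul_zero, zero_add]
  rw [add_comm]
  congr 1
  refine Finset.sum_congr rfl fun x hx => ?_
  rw [Matrix.updateRow_ne (Finset.ne_of_mem_erase hx)]

/-- `1 - yᵀ (P + YᵀY)⁻¹ y` for the row `y` of `Y` with index `a`. -/
def leverage (P : Matrix ι ι ℝ) : ℝ := 1 - Y a ⬝ᵥ res P Y *ᵥ Y a

/-- The resolvent in which the row with index `a` is left out. -/
def resOut (P : Matrix ι ι ℝ) : Matrix ι ι ℝ := res P (Y.updateRow a 0)

lemma Coercive.resOut_sub_res (h : Coercive P p) (hp : 0 < p) :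
    resOut Y a P - res P Y = resOut Y a P * Matrix.vecMulVec (Y a) (Y a) * res P Y := by
  have h1 : Matrix.vecMulVec (Y a) (Y a) =
      (P + Yᵀ * Y) - (P + (Y.updateRow a 0)ᵀ * Y.updateRow a 0) := by
    rw [gram_updateRow_zero Y a]; abel
  rw [h1, Matrix.mul_sub, Matrix.sub_mul, Matrix.mul_assoc, h.mul_res hp, Matrix.mul_one, resOut,
    h.res_mul hp, Matrix.one_mul]

lemma Coercive.dotProduct_resOut_sub_res (h : Coercive P p) (hp : 0 < p) (u v : ι → ℝ) :
    u ⬝ᵥ resOut Y a P *ᵥ v - u ⬝ᵥ res P Y *ᵥ v =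
      (u ⬝ᵥ resOut Y a P *ᵥ Y a) * (Y a ⬝ᵥ res P Y *ᵥ v) := by
  rw [← dotProduct_sub, ← Matrix.sub_mulVec, h.resOut_sub_res Y a hp, ← Matrix.mulVec_mulVec,
    ← Matrix.mulVec_mulVec, Matrix.vecMulVec_mulVec, op_smul_eq_smul, Matrix.mulVec_smul,
    dotProduct_smul, smul_eq_mul, mul_comm]

/-- With q = yᵀKy and q₋ = yᵀK₋y the rank-one identity at u = v = y is q₋ - q = q₋q, that is, (1 -
q)(1 + q₋) = 1. -/
lemma Coercive.leverage_mul (h : Coercive P p) (hp : 0 < p) :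
    leverage Y a P * (1 + Y a ⬝ᵥ resOut Y a P *ᵥ Y a) = 1 := by
  have := h.dotProduct_resOut_sub_res Y a hp (Y a) (Y a)
  rw [leverage]
  linear_combination this

/-- This trades K, which depends on the row y, for K₋, which does not, at the price of a scalar
factor that concentrates. -/
lemma Coercive.dotProduct_res_row (h : Coercive P p) (hp : 0 < p) (u : ι → ℝ) :
    u ⬝ᵥ res P Y *ᵥ Y a = leverage Y a P * (u ⬝ᵥ resOut Y a P *ᵥ Y a) := by
  have := h.dotProduct_resOut_sub_res Y a hp u (Y a)
  rw [leverage]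
  linear_combination -this

lemma Coercive.dotProduct_res_self_nonneg (h : Coercive P p) (hp : 0 < p) (v : ι → ℝ) :
    0 ≤ v ⬝ᵥ res P Y *ᵥ v := by
  have := h.energy hp Y v
  rw [dotProduct_comm]
  refine le_trans ?_ this
  positivity

lemma Coercive.leverage_pos (h : Coercive P p) (hp : 0 < p) : 0 < leverage Y a P := by
  have h1 := h.leverage_mul Y a hp
  have h2 := h.dotProduct_res_self_nonneg (Y.updateRow a 0) hp (Y a)
  rw [← resOut] at h2
  by_contra hn
  nlinarith

lemma Coercive.leverage_le_one (h : Coercive P p) (hp : 0 < p) : leverage Y a P ≤ 1 := by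
  have h2 := h.dotProduct_res_self_nonneg Y hp (Y a)
  rw [leverage]; linarith

lemma Coercive.inv_leverage (h : Coercive P p) (hp : 0 < p) :
    (leverage Y a P)⁻¹ = 1 + Y a ⬝ᵥ resOut Y a P *ᵥ Y a := by
  have h1 := h.leverage_mul Y a hp
  field_simp [(h.leverage_pos Y a hp).ne']
  linarith

/-- Since ‖K₋‖ ≤ p⁻¹, the bound involves only the row itself, so moments of the row control moments
of the inverse leverage. -/
lemma Coercive.inv_leverage_le (h : Coercive P p) (hp : 0 < p) :
    (leverage Y a P)⁻¹ ≤ 1 + p⁻¹ * (Y a ⬝ᵥ Y a) := by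
  rw [h.inv_leverage Y a hp]
  have h1 := (le_abs_self _).trans (abs_dotProduct_mulVec_le (resOut Y a P) (Y a) (Y a))
  have h2 := h.norm_res_le hp (Y.updateRow a 0)
  rw [← sq, norm_toLp_sq] at h1
  have := mul_le_mul_of_nonneg_right h2 (dotProduct_self_nonneg' (Y a))
  rw [resOut] at h1 ⊢
  linarith

/-- `uᵀ(K₋ - K)v = D⁻¹ (uᵀKy)(yᵀKv)`. -/
lemma Coercive.dotProduct_resOut_sub_res' (h : Coercive P p) (hp : 0 < p) (u v : ι → ℝ) :
    u ⬝ᵥ resOut Y a P *ᵥ v - u ⬝ᵥ res P Y *ᵥ v =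
      (leverage Y a P)⁻¹ * (u ⬝ᵥ res P Y *ᵥ Y a) * (Y a ⬝ᵥ res P Y *ᵥ v) := by
  rw [h.dotProduct_resOut_sub_res Y a hp, h.dotProduct_res_row Y a hp,
    inv_mul_cancel_left₀ (h.leverage_pos Y a hp).ne']

end LeaveOneOut

/-- The trace of a product with a Gram matrix. -/
lemma abs_trace_gram_mul_le (B : Matrix κ ι ℝ) (T : Matrix ι ι ℝ) :
    |((Bᵀ * B) * T).trace| ≤ (Bᵀ * B).trace * ‖T‖ := by
  have e : ((Bᵀ * B) * T).trace = ∑ a, B a ⬝ᵥ T *ᵥ B a := by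
    rw [Matrix.mul_assoc, Matrix.trace_mul_comm, Matrix.trace]
    refine Finset.sum_congr rfl fun a _ => ?_
    rw [Matrix.diag_apply, Matrix.mul_apply', Matrix.dotProduct_mulVec]
    rfl
  have e' : (Bᵀ * B).trace = ∑ a, B a ⬝ᵥ B a := by
    rw [Matrix.trace_mul_comm, Matrix.trace]
    rfl
  rw [e, e', Finset.sum_mul]
  refine (Finset.abs_sum_le_sum_abs _ _).trans (Finset.sum_le_sum fun a _ => ?_)
  refine (abs_dotProduct_mulVec_le _ _ _).trans_eq ?_
  rw [← sq, norm_toLp_sq, mul_comm]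

end LinearAlgebra

/-! ### Fourth moment concentration for Lipschitz functions of a Gaussian vector -/

section GaussianConcentration

lemma pi_absolutelyContinuous {μ ν : Measure ℝ} [SigmaFinite μ] [SigmaFinite ν] (h : μ ≪ ν)
    (n : ℕ) : (Measure.pi fun _ : Fin n => μ) ≪ Measure.pi fun _ : Fin n => ν := by
  induction n with
  | zero => rw [Measure.pi_of_empty, Measure.pi_of_empty]
  | succ n ih =>
    have h1 := (measurePreserving_piFinSuccAbove (fun _ : Fin (n + 1) => μ) 0).symm.map_eq
    have h2 := (measurePreserving_piFinSuccAbove (fun _ : Fin (n + 1) => ν) 0).symm.map_eq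
    rw [← h1, ← h2]
    exact (h.prod ih).map (MeasurableEquiv.measurable _)

variable {E : Type*} [NormedAddCommGroup E] [InnerProductSpace ℝ E] [FiniteDimensional ℝ E]
  [MeasurableSpace E] [BorelSpace E]

/-- Transfers Rademacher's theorem from Lebesgue measure: a Lipschitz function is differentiable
almost everywhere for the Gaussian law. -/
lemma stdGaussian_absolutelyContinuous : stdGaussian E ≪ (volume : Measure E) := by
  have h1 := pi_absolutelyContinuous
    (gaussianReal_absolutelyContinuous 0 (one_ne_zero : (1 : ℝ≥0) ≠ 0)) (Module.finrank ℝ E)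
  have e : (fun x : Fin (Module.finrank ℝ E) → ℝ ↦ ∑ i, x i • stdOrthonormalBasis ℝ E i) =
      (stdOrthonormalBasis ℝ E).measurableEquiv.symm ∘ (WithLp.toLp 2) := by
    ext x
    simp [OrthonormalBasis.measurableEquiv, ← OrthonormalBasis.sum_repr_symm]
  have h2 : Measure.map (fun x : Fin (Module.finrank ℝ E) → ℝ ↦
      ∑ i, x i • stdOrthonormalBasis ℝ E i) volume = volume := by
    rw [e]
    exact ((stdOrthonormalBasis ℝ E).measurePreserving_measurableEquiv.symm.comp
      (PiLp.volume_preserving_toLp _)).map_eq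
  rw [← h2]
  exact h1.map (by fun_prop)

/-- Linear growth, together with the finite moments of a Gaussian measure. -/
lemma memLp_of_lipschitz {F : Type*} [NormedAddCommGroup F] [NormedSpace ℝ F]
    [MeasurableSpace F] [BorelSpace F] [CompleteSpace F] [SecondCountableTopology F]
    (ν : Measure F) [IsGaussian ν] {f : F → ℝ} {L : ℝ≥0} (hf : LipschitzWith L f) :
    MemLp f 4 ν := by
  have h1 : MemLp (fun x => f x - f 0) 4 ν := by
    refine MemLp.of_le_mul (c := L) (IsGaussian.memLp_id ν 4 (by simp)) ?_ ?_
    · exact (hf.continuous.sub continuous_const).aestronglyMeasurable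
    · filter_upwards with x
      simpa using hf.norm_sub_le x 0
  have := h1.add (memLp_const (f 0))
  simpa [Function.comp_def, Pi.add_def] using this

lemma MemLp_integrable_pow_four {Ω : Type*} [MeasurableSpace Ω] {ν : Measure Ω} {f : Ω → ℝ}
    (hf : MemLp f 4 ν) : Integrable (fun x => f x ^ 4) ν := by
  have := MemLp.integrable_norm_pow (p := 4) (by simpa using hf) (by norm_num)
  refine this.congr ?_
  filter_upwards with x
  rw [Real.norm_eq_abs]
  exact Even.pow_abs (by decide) _

/-- The constant in the fourth moment concentration inequality. -/
def concConst : ℝ := (Real.pi / 2) ^ 4 * ∫ t, t ^ 4 ∂gaussianReal 0 1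

lemma concConst_nonneg : 0 ≤ concConst :=
  mul_nonneg (by positivity) (integral_nonneg fun t => by positivity)

/-- Under the standard Gaussian law ℓ is distributed as N(0, ‖ℓ‖²). -/
lemma integral_dual_pow_four (ℓ : StrongDual ℝ E) :
    ∫ y, (ℓ y) ^ 4 ∂stdGaussian E = ‖ℓ‖ ^ 4 * ∫ t, t ^ 4 ∂gaussianReal 0 1 := by
  have h1 := IsGaussian.map_eq_gaussianReal (μ := stdGaussian E) ℓ
  rw [integral_strongDual_stdGaussian, variance_dual_stdGaussian] at h1
  have h2 := gaussianReal_map_const_mul (μ := 0) (v := 1) ‖ℓ‖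
  have h3 : ∫ y, (ℓ y) ^ 4 ∂stdGaussian E = ∫ t, t ^ 4 ∂((stdGaussian E).map ℓ) := by
    rw [integral_map (by fun_prop) (by fun_prop)]
  have h4 : (stdGaussian E).map ℓ = (gaussianReal 0 1).map (‖ℓ‖ * ·) := by
    rw [h1, h2]; congr 1
    · simp
    · ext; simp
  rw [h3, h4, integral_map (by fun_prop) (by fun_prop), ← integral_const_mul]
  simp_rw [mul_pow]

lemma sum_pow_four_le (K : ℕ) (a : ℕ → ℝ) :
    (∑ j ∈ Finset.range K, a j) ^ 4 ≤ (K : ℝ) ^ 3 * ∑ j ∈ Finset.range K, a j ^ 4 := by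
  have h1 := sq_sum_le_card_mul_sum_sq (s := Finset.range K) (f := a)
  have h2 := sq_sum_le_card_mul_sum_sq (s := Finset.range K) (f := fun j => a j ^ 2)
  rw [Finset.card_range] at h1 h2
  have h3 : (∑ j ∈ Finset.range K, a j) ^ 4 ≤ (K * ∑ j ∈ Finset.range K, a j ^ 2) ^ 2 := by
    calc _ = ((∑ j ∈ Finset.range K, a j) ^ 2) ^ 2 := by ring
      _ ≤ _ := by gcongr
  refine h3.trans ?_
  calc _ = (K : ℝ) ^ 2 * (∑ j ∈ Finset.range K, a j ^ 2) ^ 2 := by ring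
    _ ≤ (K : ℝ) ^ 2 * (K * ∑ j ∈ Finset.range K, (a j ^ 2) ^ 2) := by gcongr
    _ = _ := by simp_rw [← pow_mul]; ring

variable {F : E → ℝ} {L : ℝ≥0}

/-- The increment of `F` under a rotation by `θ`. -/
def rotInc (F : E → ℝ) (θ : ℝ) (p : E × E) : ℝ :=
  F (Real.cos θ • p.1 + Real.sin θ • p.2) - F p.1

lemma lipschitz_comp_fst {G : Type*} [NormedAddCommGroup G] [NormedSpace ℝ G] {F : G → ℝ}
    (hF : LipschitzWith L F) (A : E × E →L[ℝ] G) : LipschitzWith (L * ‖A‖₊) (fun p => F (A p)) :=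
  hF.comp A.lipschitz

lemma memLp_rotInc (hF : LipschitzWith L F) (θ : ℝ) :
    MemLp (rotInc F θ) 4 ((stdGaussian E).prod (stdGaussian E)) := by
  have h1 := memLp_of_lipschitz ((stdGaussian E).prod (stdGaussian E)) (lipschitz_comp_fst hF
    ((ContinuousLinearMap.fst ℝ E E).comp (ContinuousLinearMap.rotation θ)))
  have h2 := memLp_of_lipschitz ((stdGaussian E).prod (stdGaussian E)) (lipschitz_comp_fst hF
    (ContinuousLinearMap.fst ℝ E E))
  exact h1.sub h2

/-- A pair of independent standard Gaussian vectors is invariant under rotation by α, so the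
increment from angle α to α + θ has the law of the one from 0 to θ. -/
lemma integral_rotInc_step (hF : LipschitzWith L F) (α θ : ℝ) :
    Integrable (fun p : E × E => (F (Real.cos (α + θ) • p.1 + Real.sin (α + θ) • p.2) -
      F (Real.cos α • p.1 + Real.sin α • p.2)) ^ 4) ((stdGaussian E).prod (stdGaussian E)) ∧
    ∫ p : E × E, (F (Real.cos (α + θ) • p.1 + Real.sin (α + θ) • p.2) -
      F (Real.cos α • p.1 + Real.sin α • p.2)) ^ 4 ∂(stdGaussian E).prod (stdGaussian E) =
    ∫ p, rotInc F θ p ^ 4 ∂(stdGaussian E).prod (stdGaussian E) := by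
  have hmp : MeasurePreserving (ContinuousLinearMap.rotation α : E × E →L[ℝ] E × E)
      ((stdGaussian E).prod (stdGaussian E)) ((stdGaussian E).prod (stdGaussian E)) :=
    ⟨by fun_prop, IsGaussian.map_rotation_eq_self (by simp) α⟩
  have e : (fun p : E × E => (F (Real.cos (α + θ) • p.1 + Real.sin (α + θ) • p.2) -
      F (Real.cos α • p.1 + Real.sin α • p.2)) ^ 4) =
      (fun q => rotInc F θ q ^ 4) ∘ (ContinuousLinearMap.rotation α : E × E →L[ℝ] E × E) := by
    ext p
    simp only [rotInc, Function.comp, ContinuousLinearMap.rotation_apply]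
    congr 3
    rw [Real.cos_add, Real.sin_add]
    module
  have hint := MemLp_integrable_pow_four (memLp_rotInc hF θ)
  refine ⟨?_, ?_⟩
  · rw [e]
    exact hmp.integrable_comp_of_integrable hint
  · have h := integral_map (μ := (stdGaussian E).prod (stdGaussian E))
      hmp.measurable.aemeasurable (f := fun q => rotInc F θ q ^ 4)
      (by rw [hmp.map_eq]; exact hint.aestronglyMeasurable)
    rw [hmp.map_eq] at h
    rw [h]
    exact congrArg (fun g => ∫ p, g p ∂(stdGaussian E).prod (stdGaussian E)) e

/-- The quarter turn from x to y is cut into k + 1 equal rotations. The power mean inequality costs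
(k+1)³ and the k + 1 increments have equal fourth moments, which makes (k+1)⁴ in total. -/
lemma integral_sub_pow_four_le (hF : LipschitzWith L F) (k : ℕ) :
    ∫ p : E × E, (F p.2 - F p.1) ^ 4 ∂(stdGaussian E).prod (stdGaussian E) ≤
      ∫ p, (((k : ℝ) + 1) * rotInc F (Real.pi / 2 / (k + 1)) p) ^ 4
        ∂(stdGaussian E).prod (stdGaussian E) := by
  set θ := Real.pi / 2 / ((k : ℝ) + 1) with hθ
  set μ2 := (stdGaussian E).prod (stdGaussian E)
  let a : E × E → ℕ → ℝ := fun p j =>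
    F (Real.cos ((j : ℝ) * θ + θ) • p.1 + Real.sin ((j : ℝ) * θ + θ) • p.2) -
      F (Real.cos ((j : ℝ) * θ) • p.1 + Real.sin ((j : ℝ) * θ) • p.2)
  have hsum : ∀ p : E × E, F p.2 - F p.1 = ∑ j ∈ Finset.range (k + 1), a p j := by
    intro p
    have := Finset.sum_range_sub (fun j : ℕ =>
      F (Real.cos ((j : ℝ) * θ) • p.1 + Real.sin ((j : ℝ) * θ) • p.2)) (k + 1)
    have hk : ((k + 1 : ℕ) : ℝ) * θ = Real.pi / 2 := by
      rw [hθ]; push_cast; field_simp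
    rw [hk] at this
    simp only [Real.cos_pi_div_two, Real.sin_pi_div_two, zero_smul, one_smul, zero_add,
      Nat.cast_zero, zero_mul, Real.cos_zero, Real.sin_zero, add_zero] at this
    rw [← this]
    refine Finset.sum_congr rfl fun j _ => ?_
    simp only [a]
    push_cast
    rw [add_mul, one_mul]
  have hstep := fun j : ℕ => integral_rotInc_step hF ((j : ℝ) * θ) θ
  have hfst : Integrable (fun p : E × E => (F p.2 - F p.1) ^ 4) μ2 := by
    have h := memLp_rotInc (E := E) hF (Real.pi / 2)
    refine (MemLp_integrable_pow_four h).congr ?_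
    filter_upwards with p
    simp [rotInc]
  calc ∫ p : E × E, (F p.2 - F p.1) ^ 4 ∂μ2
      ≤ ∫ p : E × E, ((k + 1 : ℕ) : ℝ) ^ 3 * ∑ j ∈ Finset.range (k + 1), a p j ^ 4 ∂μ2 := by
        refine integral_mono hfst ?_ fun p => ?_
        · exact (integrable_finsetSum _ fun j _ => (hstep j).1).const_mul _
        · simp only
          rw [hsum]; exact sum_pow_four_le _ _
    _ = ((k + 1 : ℕ) : ℝ) ^ 3 * ∑ j ∈ Finset.range (k + 1), ∫ p, rotInc F θ p ^ 4 ∂μ2 := by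
        rw [integral_const_mul, integral_finsetSum _ fun j _ => (hstep j).1]
        congr 1
        exact Finset.sum_congr rfl fun j _ => (hstep j).2
    _ = ∫ p, (((k : ℝ) + 1) * rotInc F θ p) ^ 4 ∂μ2 := by
        simp_rw [mul_pow]
        rw [integral_const_mul, Finset.sum_const, Finset.card_range, nsmul_eq_mul]
        push_cast; ring

/-- The bound does not depend on k, which supplies the dominating function for k → ∞. -/
lemma abs_rotInc_le (hF : LipschitzWith L F) (k : ℕ) (p : E × E) :
    |((k : ℝ) + 1) * rotInc F (Real.pi / 2 / (k + 1)) p| ≤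
      Real.pi / 2 * L * (‖p.1‖ + ‖p.2‖) := by
  set θ := Real.pi / 2 / ((k : ℝ) + 1) with hθ
  have hk : (0 : ℝ) < (k : ℝ) + 1 := by positivity
  have hθ0 : 0 ≤ θ := by positivity
  have h1 := hF.norm_sub_le (Real.cos θ • p.1 + Real.sin θ • p.2) p.1
  have h2 : Real.cos θ • p.1 + Real.sin θ • p.2 - p.1 =
    (Real.cos θ - 1) • p.1 + Real.sin θ • p.2 := by module
  have h3 : |Real.cos θ - 1| ≤ θ := by
    have := Real.abs_cos_sub_cos_le θ 0
    simpa [abs_of_nonneg hθ0] using this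
  have h4 : |Real.sin θ| ≤ θ := by
    have := Real.abs_sin_le_abs (x := θ)
    rwa [abs_of_nonneg hθ0] at this
  have h5 : ‖Real.cos θ • p.1 + Real.sin θ • p.2 - p.1‖ ≤ θ * (‖p.1‖ + ‖p.2‖) := by
    rw [h2]
    refine (norm_add_le _ _).trans ?_
    rw [norm_smul, norm_smul, mul_add, Real.norm_eq_abs, Real.norm_eq_abs]
    gcongr
  rw [abs_mul, abs_of_pos hk]
  calc _ ≤ ((k : ℝ) + 1) * (L * (θ * (‖p.1‖ + ‖p.2‖))) := by
        gcongr
        exact h1.trans (by gcongr)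
    _ = _ := by rw [hθ]; field_simp

/-- The curve cos θ · x + sin θ · y leaves x with velocity y. -/
lemma tendsto_rotInc {p : E × E} (hd : DifferentiableAt ℝ F p.1) :
    Tendsto (fun k : ℕ => ((k : ℝ) + 1) * rotInc F (Real.pi / 2 / (k + 1)) p) atTop
      (𝓝 (Real.pi / 2 * fderiv ℝ F p.1 p.2)) := by
  have hc : HasDerivAt (fun θ : ℝ => Real.cos θ • p.1 + Real.sin θ • p.2) p.2 0 := by
    have h1 := (Real.hasDerivAt_cos 0).smul_const p.1
    have h2 := (Real.hasDerivAt_sin 0).smul_const p.2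
    have h3 := h1.add h2
    simp only [Real.sin_zero, Real.cos_zero, neg_zero, zero_smul, one_smul, zero_add] at h3
    exact h3
  have hg : HasDerivAt (fun θ : ℝ => F (Real.cos θ • p.1 + Real.sin θ • p.2))
      (fderiv ℝ F p.1 p.2) 0 := by
    refine HasFDerivAt.comp_hasDerivAt (l := F) (l' := fderiv ℝ F p.1) 0 ?_ hc
    simpa using hd.hasFDerivAt
  rw [hasDerivAt_iff_tendsto_slope] at hg
  have hθ : Tendsto (fun k : ℕ => Real.pi / 2 / ((k : ℝ) + 1)) atTop (𝓝[≠] 0) := by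
    refine tendsto_nhdsWithin_iff.2 ⟨?_, Eventually.of_forall fun k => ?_⟩
    · exact Tendsto.div_atTop tendsto_const_nhds
        (tendsto_atTop_add_const_right _ _ tendsto_natCast_atTop_atTop)
    · have : 0 < Real.pi / 2 / ((k : ℝ) + 1) := by positivity
      exact this.ne'
  refine ((hg.comp hθ).const_mul (Real.pi / 2)).congr fun k => ?_
  simp only [Function.comp, slope_def_field, rotInc, Real.cos_zero, Real.sin_zero, one_smul,
    zero_smul, add_zero, sub_zero]
  field_simp

/-- In the limit of infinitely many rotations the bound becomes E[((π/2) F'(x)y)⁴]. Given x, the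
variable F'(x)y is centred Gaussian with standard deviation ‖F'(x)‖ ≤ L. -/
lemma integral_prod_sub_pow_four_le (hF : LipschitzWith L F) :
    ∫ p : E × E, (F p.2 - F p.1) ^ 4 ∂(stdGaussian E).prod (stdGaussian E) ≤
      concConst * L ^ 4 := by
  set μ2 := (stdGaussian E).prod (stdGaussian E) with hμ2
  have hdiff : ∀ᵐ p ∂μ2, DifferentiableAt ℝ F p.1 := by
    have h1 : ∀ᵐ x ∂stdGaussian E, DifferentiableAt ℝ F x :=
      stdGaussian_absolutelyContinuous.ae_le hF.ae_differentiableAt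
    exact Measure.quasiMeasurePreserving_fst.ae h1
  have hnorm : Integrable (fun p : E × E => (Real.pi / 2 * L * (‖p.1‖ + ‖p.2‖)) ^ 4) μ2 := by
    have h1 : LipschitzWith (1 * 1) (fun p : E × E => ‖p.1‖) :=
      lipschitzWith_one_norm.comp LipschitzWith.prod_fst
    have h2 : LipschitzWith (1 * 1) (fun p : E × E => ‖p.2‖) :=
      lipschitzWith_one_norm.comp LipschitzWith.prod_snd
    have h3 : MemLp (fun p : E × E => ‖p.1‖) 4 μ2 := memLp_of_lipschitz μ2 h1
    have h4 : MemLp (fun p : E × E => ‖p.2‖) 4 μ2 := memLp_of_lipschitz μ2 h2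
    exact MemLp_integrable_pow_four ((h3.add h4).const_mul (Real.pi / 2 * L))
  have hlim : Tendsto (fun k : ℕ => ∫ p, (((k : ℝ) + 1) * rotInc F (Real.pi / 2 / (k + 1)) p) ^ 4
      ∂μ2) atTop (𝓝 (∫ p, (Real.pi / 2 * fderiv ℝ F p.1 p.2) ^ 4 ∂μ2)) := by
    refine tendsto_integral_of_dominated_convergence _ (fun k => ?_) hnorm (fun k => ?_) ?_
    · have h := (memLp_rotInc hF (Real.pi / 2 / ((k : ℝ) + 1))).const_mul ((k : ℝ) + 1)
      exact h.aestronglyMeasurable.pow 4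
    · filter_upwards with p
      rw [norm_pow, Real.norm_eq_abs]
      exact pow_le_pow_left₀ (abs_nonneg _) (abs_rotInc_le hF k p) 4
    · filter_upwards [hdiff] with p hp
      exact (tendsto_rotInc hp).pow 4
  have h1 := ge_of_tendsto' hlim (integral_sub_pow_four_le hF)
  refine h1.trans ?_
  have hbd : ∀ x, ‖fderiv ℝ F x‖ ≤ L := fun x => norm_fderiv_le_of_lipschitz ℝ hF
  have hmeas : Measurable fun p : E × E => fderiv ℝ F p.1 p.2 := by
    -- Expanding y in an orthonormal basis reduces joint measurability to derivatives in fixed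
    -- directions.
    have e : ∀ p : E × E, fderiv ℝ F p.1 p.2 =
        ∑ i, inner ℝ (stdOrthonormalBasis ℝ E i) p.2 *
          fderiv ℝ F p.1 (stdOrthonormalBasis ℝ E i) := by
      intro p
      conv_lhs => rw [← (stdOrthonormalBasis ℝ E).sum_repr' p.2]
      simp only [map_sum, map_smul, smul_eq_mul]
    simp_rw [e]
    refine Finset.measurable_sum _ fun i _ => ?_
    exact (by fun_prop : Measurable fun p : E × E => inner ℝ (stdOrthonormalBasis ℝ E i) p.2).mul
      ((measurable_fderiv_apply_const ℝ F _).comp measurable_fst)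
  have hint : Integrable (fun p : E × E => (Real.pi / 2 * fderiv ℝ F p.1 p.2) ^ 4) μ2 := by
    refine hnorm.mono' ((hmeas.const_mul _).pow_const 4).aestronglyMeasurable ?_
    filter_upwards with p
    rw [norm_pow]
    refine pow_le_pow_left₀ (norm_nonneg _) ?_ 4
    rw [norm_mul, Real.norm_of_nonneg (by positivity), mul_assoc]
    have := (fderiv ℝ F p.1).le_of_opNorm_le (hbd p.1) p.2
    gcongr
    refine this.trans ?_
    gcongr
    linarith [norm_nonneg p.1]
  rw [hμ2, integral_prod _ hint]
  have h2 : ∀ x : E, ∫ y, (Real.pi / 2 * fderiv ℝ F x y) ^ 4 ∂stdGaussian E ≤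
      concConst * L ^ 4 := by
    intro x
    simp_rw [mul_pow]
    rw [integral_const_mul, integral_dual_pow_four, concConst]
    have h3 : 0 ≤ ∫ t, t ^ 4 ∂gaussianReal 0 1 := integral_nonneg fun t => by positivity
    calc _ ≤ (Real.pi / 2) ^ 4 * ((L : ℝ) ^ 4 * ∫ t, t ^ 4 ∂gaussianReal 0 1) := by
          gcongr; exact hbd x
      _ = _ := by ring
  calc _ ≤ ∫ _ : E, concConst * (L : ℝ) ^ 4 ∂stdGaussian E :=
        integral_mono hint.integral_prod_left (integrable_const _) h2
    _ = _ := by simp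

/-- Fourth moment concentration of Lipschitz functions of a standard Gaussian vector. -/
theorem integral_sub_integral_pow_four_le (hF : LipschitzWith L F) :
    ∫ x, (F x - ∫ y, F y ∂stdGaussian E) ^ 4 ∂stdGaussian E ≤ concConst * L ^ 4 := by
  have hm := memLp_of_lipschitz (stdGaussian E) hF
  have hi : Integrable F (stdGaussian E) := hm.integrable (by norm_num)
  have hint : Integrable (fun p : E × E => (F p.2 - F p.1) ^ 4)
      ((stdGaussian E).prod (stdGaussian E)) := by
    refine (MemLp_integrable_pow_four (memLp_rotInc (E := E) hF (Real.pi / 2))).congr ?_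
    filter_upwards with p
    simp [rotInc]
  refine le_trans ?_ (integral_prod_sub_pow_four_le hF)
  rw [integral_prod _ hint]
  refine integral_mono (MemLp_integrable_pow_four (hm.sub (memLp_const _)))
    hint.integral_prod_left fun x => ?_
  have h4 : Integrable (fun y => (F y - F x) ^ 4) (stdGaussian E) :=
    MemLp_integrable_pow_four (hm.sub (memLp_const _))
  -- Jensen in the independent copy y: the deviation from the mean is dominated by the deviation
  -- from the copy.
  have h1 := (Even.convexOn_pow (𝕜 := ℝ) (n := 4) (by decide)).map_integral_le
    (μ := stdGaussian E) (f := fun y => F y - F x)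
    (continuous_pow 4).continuousOn isClosed_univ (by simp) (hi.sub (integrable_const _)) h4
  rw [integral_sub hi (integrable_const _)] at h1
  simp only [integral_const, probReal_univ, one_smul] at h1
  refine le_trans (le_of_eq ?_) h1
  ring

end GaussianConcentration

/-! ### Concentration for Gaussian matrices in the Frobenius norm -/

section GaussianMatrix

variable {N d : ℕ}

instance : IsProbabilityMeasure (gaussianVector d) := by
  unfold gaussianVector; infer_instance

instance : IsProbabilityMeasure (gaussianMatrix N d) := by
  unfold gaussianMatrix; infer_instance

/-- The space of `N × d` matrices with the Frobenius norm. -/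
abbrev FrobSpace (N d : ℕ) : Type := PiLp 2 fun _ : Fin N => EuclideanSpace ℝ (Fin d)

/-- The identification of matrices with points of the Frobenius space. -/
def toFrob (w : Fin N → Fin d → ℝ) : FrobSpace N d := WithLp.toLp 2 fun a => WithLp.toLp 2 (w a)

lemma norm_toFrob_sub_sq (w w' : Fin N → Fin d → ℝ) :
    ‖toFrob w - toFrob w'‖ ^ 2 = ∑ a, ∑ l, (w a l - w' a l) ^ 2 := by
  rw [PiLp.norm_sq_eq_of_L2]
  refine Finset.sum_congr rfl fun a _ => ?_
  rw [EuclideanSpace.real_norm_sq_eq]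
  rfl

/-- Compared through characteristic functions: the squared Frobenius norm is the sum over the rows,
so the product of the row factors is that of the full Gaussian. -/
lemma map_toFrob_gaussianMatrix :
    (gaussianMatrix N d).map toFrob = stdGaussian (FrobSpace N d) := by
  have h1 : (gaussianMatrix N d).map (fun w a => (WithLp.toLp 2 (w a) : EuclideanSpace ℝ (Fin d)))
      = Measure.pi fun _ : Fin N => stdGaussian (EuclideanSpace ℝ (Fin d)) := by
    rw [gaussianMatrix, Measure.pi_map_pi (fun _ => by fun_prop)]
    congr 1
    ext1 a
    exact map_pi_eq_stdGaussian
  have h2 : (gaussianMatrix N d).map toFrob =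
      (Measure.pi fun _ : Fin N => stdGaussian (EuclideanSpace ℝ (Fin d))).map (WithLp.toLp 2) := by
    rw [← h1, Measure.map_map (by fun_prop) (by fun_prop)]
    rfl
  rw [h2]
  apply Measure.ext_of_charFun
  ext t
  rw [charFun_pi, charFun_stdGaussian]
  simp_rw [charFun_stdGaussian, ← Complex.exp_sum, ← Complex.ofReal_pow, PiLp.norm_sq_eq_of_L2]
  simp [Finset.sum_div, neg_div]

/-- Lipschitz functions of a Gaussian matrix, in the Frobenius norm. -/
def FrobLipschitz (F : (Fin N → Fin d → ℝ) → ℝ) (L : ℝ) : Prop :=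
  ∀ w w', |F w - F w'| ≤ L * √(∑ a, ∑ l, (w a l - w' a l) ^ 2)

lemma FrobLipschitz.lift {F : (Fin N → Fin d → ℝ) → ℝ} {L : ℝ} (hL : 0 ≤ L)
    (hF : FrobLipschitz F L) : ∃ G : FrobSpace N d → ℝ, LipschitzWith L.toNNReal G ∧
      ∀ w, G (toFrob w) = F w := by
  refine ⟨fun x => F fun a => (x a).ofLp, LipschitzWith.of_dist_le_mul fun x y => ?_, fun w => rfl⟩
  rw [Real.dist_eq, dist_eq_norm, Real.coe_toNNReal _ hL]
  refine (hF _ _).trans_eq ?_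
  rw [← norm_toFrob_sub_sq, Real.sqrt_sq (norm_nonneg _)]
  rfl

lemma measurable_toFrob : Measurable (toFrob : (Fin N → Fin d → ℝ) → FrobSpace N d) := by
  unfold toFrob; fun_prop

lemma FrobLipschitz.memLp {F : (Fin N → Fin d → ℝ) → ℝ} {L : ℝ} (hL : 0 ≤ L)
    (hF : FrobLipschitz F L) : MemLp F 4 (gaussianMatrix N d) := by
  obtain ⟨G, hG, hGF⟩ := hF.lift hL
  have h := memLp_of_lipschitz (stdGaussian (FrobSpace N d)) hG
  rw [← map_toFrob_gaussianMatrix] at h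
  have := h.comp_of_map measurable_toFrob.aemeasurable
  exact (memLp_congr_ae (Eventually.of_forall hGF)).1 this

lemma FrobLipschitz.concentration {F : (Fin N → Fin d → ℝ) → ℝ} {L : ℝ} (hL : 0 ≤ L)
    (hF : FrobLipschitz F L) :
    ∫ w, (F w - ∫ w', F w' ∂gaussianMatrix N d) ^ 4 ∂gaussianMatrix N d ≤ concConst * L ^ 4 := by
  obtain ⟨G, hG, hGF⟩ := hF.lift hL
  have h := integral_sub_integral_pow_four_le hG
  rw [Real.coe_toNNReal _ hL, ← map_toFrob_gaussianMatrix,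
    integral_map measurable_toFrob.aemeasurable hG.continuous.aestronglyMeasurable,
    integral_map measurable_toFrob.aemeasurable
      (Continuous.aestronglyMeasurable (by have := hG.continuous; fun_prop))] at h
  simpa only [hGF] using h

/-- A Lipschitz function of a Gaussian matrix with bounded second moment has a bounded fourth
moment. -/
lemma FrobLipschitz.integral_pow_four_le {F : (Fin N → Fin d → ℝ) → ℝ} {L s : ℝ} (hL : 0 ≤ L)
    (hF : FrobLipschitz F L) (hs : ∫ w, F w ^ 2 ∂gaussianMatrix N d ≤ s) :
    ∫ w, F w ^ 4 ∂gaussianMatrix N d ≤ 8 * (concConst * L ^ 4 + s ^ 2) := by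
  set m := ∫ w', F w' ∂gaussianMatrix N d with hm
  have hM := hF.memLp hL
  have hM2 : MemLp F 2 (gaussianMatrix N d) := hM.mono_exponent (by norm_num)
  have h1 : m ^ 2 ≤ s := by
    have := variance_nonneg F (gaussianMatrix N d)
    rw [variance_eq_sub hM2] at this
    simp only [Pi.pow_apply] at this
    linarith
  have hint : Integrable (fun w => (F w - m) ^ 4) (gaussianMatrix N d) :=
    MemLp_integrable_pow_four (hM.sub (memLp_const m))
  calc ∫ w, F w ^ 4 ∂gaussianMatrix N d
      ≤ ∫ w, 8 * ((F w - m) ^ 4 + m ^ 4) ∂gaussianMatrix N d := by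
        refine integral_mono (MemLp_integrable_pow_four hM)
          ((hint.add (integrable_const _)).const_mul 8) fun w => ?_
        simp only
        -- (a + b)⁴ ≤ 8(a⁴ + b⁴) with a = F - m and b = m.
        nlinarith [sq_nonneg ((F w - m) - m), sq_nonneg ((F w - m) ^ 2 - m ^ 2),
          sq_nonneg ((F w - m) + m), sq_nonneg ((F w - m) * ((F w - m) - m)), sq_nonneg (m * ((F w - m) - m)),
          mul_nonneg (sq_nonneg (F w - m - m)) (sq_nonneg (F w - m)), mul_nonneg (sq_nonneg (F w - m - m)) (sq_nonneg m), mul_nonneg (sq_nonneg (F w - m - m)) (sq_nonneg (F w))]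
    _ = 8 * ((∫ w, (F w - m) ^ 4 ∂gaussianMatrix N d) + m ^ 4) := by
        rw [integral_const_mul, integral_add hint (integrable_const _)]
        simp
    _ ≤ 8 * (concConst * L ^ 4 + s ^ 2) := by
        have h2 := hF.concentration hL
        have h3 : m ^ 4 ≤ s ^ 2 := by
          calc m ^ 4 = (m ^ 2) ^ 2 := by ring
            _ ≤ s ^ 2 := by gcongr
        gcongr

end GaussianMatrix

/-! ### Exchangeability and independence of the rows -/

section GaussianMatrixLaw

variable {N d : ℕ}

lemma integral_comp_perm (f : (Fin N → Fin d → ℝ) → ℝ) (e : Equiv.Perm (Fin N)) :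
    ∫ W, f (fun a => W (e a)) ∂gaussianMatrix N d = ∫ W, f W ∂gaussianMatrix N d := by
  have h := measurePreserving_piCongrLeft (fun _ : Fin N => gaussianVector d) e.symm
  have h2 := h.integral_comp' f
  rw [gaussianMatrix, ← h2]
  refine integral_congr_ae (Eventually.of_forall fun W => ?_)
  simp only
  congr 1
  funext a
  have := MeasurableEquiv.piCongrLeft_apply_apply e.symm (β := fun _ : Fin N => Fin d → ℝ) W (e a)
  simpa using this.symm

lemma measurePreserving_row (a : Fin N) :
    MeasurePreserving (fun W : Fin N → Fin d → ℝ => W a) (gaussianMatrix N d)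
      (gaussianVector d) :=
  measurePreserving_eval (fun _ : Fin N => gaussianVector d) a

/-- A function of one row is independent of a function that ignores this row. -/
lemma integral_row_mul (a : Fin N) (f : (Fin d → ℝ) → ℝ) (h : (Fin N → Fin d → ℝ) → ℝ)
    (hh : ∀ W w, h (Function.update W a w) = h W) :
    ∫ W, f (W a) * h W ∂gaussianMatrix N d =
      (∫ w, f w ∂gaussianVector d) * ∫ W, h W ∂gaussianMatrix N d := by
  rcases N with _ | n
  · exact a.elim0
  have hm := measurePreserving_piFinSuccAbove (fun _ : Fin (n + 1) => gaussianVector d) a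
  -- As h ignores row a, filling that row with 0 exhibits h as a function of the other rows.
  let h' : (Fin n → Fin d → ℝ) → ℝ := fun t => h (a.insertNth (0 : Fin d → ℝ) t)
  have hh' : ∀ W, h W = h' (MeasurableEquiv.piFinSuccAbove (fun _ => Fin d → ℝ) a W).2 := by
    intro W
    rw [← hh W 0]
    simp only [h']
    congr 1
    exact (Fin.insertNth_removeNth a (0 : Fin d → ℝ) W).symm
  have e1 := hm.integral_comp' (fun q => f q.1 * h' q.2)
  have e2 := hm.integral_comp' (fun q => h' q.2)
  have e3 : ∀ W : Fin (n + 1) → Fin d → ℝ,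
    (MeasurableEquiv.piFinSuccAbove (fun _ => Fin d → ℝ) a W).1 = W a := fun W => rfl
  simp only [← hh', e3] at e1 e2
  rw [gaussianMatrix, e1, e2, integral_prod_mul, integral_fun_snd]
  simp

end GaussianMatrixLaw

/-! ### Products of four factors and expectations of random matrices -/

section Integrals

variable {Ω : Type*} [MeasurableSpace Ω] {μ : Measure Ω}

lemma memLp_four_of_integrable {f : Ω → ℝ} (hf : AEStronglyMeasurable f μ)
    (hi : Integrable (fun ω => f ω ^ 4) μ) : MemLp f 4 μ := by
  rw [← integrable_norm_rpow_iff hf (by norm_num) (by simp)]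
  refine hi.congr (Eventually.of_forall fun ω => ?_)
  simp only [Real.norm_eq_abs]
  have : ((4 : ENNReal).toReal) = ((4 : ℕ) : ℝ) := by norm_num
  rw [this, Real.rpow_natCast]
  exact (Even.pow_abs (by decide) _).symm

/-- Arithmetic–geometric mean inequality. The stochastic error terms below are written as products
of four factors (padded by 1), so bounded fourth moments suffice. -/
lemma abs_mul₄_le (a b c d : ℝ) :
    |a * b * c * d| ≤ (a ^ 4 + b ^ 4 + c ^ 4 + d ^ 4) / 4 := by
  rw [abs_le]
  constructor <;>
  nlinarith [sq_nonneg (a * b - c * d), sq_nonneg (a * b + c * d), sq_nonneg (a ^ 2 - b ^ 2),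
    sq_nonneg (c ^ 2 - d ^ 2)]

variable {a b c d : Ω → ℝ}

lemma integrable_mul₄ (ha : MemLp a 4 μ) (hb : MemLp b 4 μ) (hc : MemLp c 4 μ)
    (hd : MemLp d 4 μ) : Integrable (fun ω => a ω * b ω * c ω * d ω) μ := by
  refine Integrable.mono' (((((MemLp_integrable_pow_four ha).add
    (MemLp_integrable_pow_four hb)).add (MemLp_integrable_pow_four hc)).add
    (MemLp_integrable_pow_four hd)).div_const 4) ?_ (Eventually.of_forall fun ω => ?_)
  · exact ((ha.aestronglyMeasurable.mul hb.aestronglyMeasurable).mul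
      hc.aestronglyMeasurable).mul hd.aestronglyMeasurable
  · exact abs_mul₄_le _ _ _ _

lemma abs_integral_mul₄_le (ha : MemLp a 4 μ) (hb : MemLp b 4 μ) (hc : MemLp c 4 μ)
    (hd : MemLp d 4 μ) :
    |∫ ω, a ω * b ω * c ω * d ω ∂μ| ≤
      ((∫ ω, a ω ^ 4 ∂μ) + (∫ ω, b ω ^ 4 ∂μ) + (∫ ω, c ω ^ 4 ∂μ) + ∫ ω, d ω ^ 4 ∂μ) / 4 := by
  have ha' := MemLp_integrable_pow_four ha
  have hb' := MemLp_integrable_pow_four hb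
  have hc' := MemLp_integrable_pow_four hc
  have hd' := MemLp_integrable_pow_four hd
  refine abs_integral_le_integral_abs.trans ?_
  have hab : Integrable (fun ω => a ω ^ 4 + b ω ^ 4) μ := ha'.add hb'
  have habc : Integrable (fun ω => a ω ^ 4 + b ω ^ 4 + c ω ^ 4) μ := hab.add hc'
  rw [← integral_add ha' hb', ← integral_add hab hc', ← integral_add habc hd', ← integral_div]
  exact integral_mono (integrable_mul₄ ha hb hc hd).abs
    ((((ha'.add hb').add hc').add hd').div_const 4) fun ω => abs_mul₄_le _ _ _ _

variable {ι κ : Type*} [Fintype ι] [Fintype κ]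

/-- The entrywise expectation of a random matrix. -/
def expMat (μ : Measure Ω) (T : Ω → Matrix κ ι ℝ) : Matrix κ ι ℝ :=
  Matrix.of fun i j => ∫ ω, T ω i j ∂μ

lemma integrable_dotProduct_mulVec {T : Ω → Matrix κ ι ℝ}
    (hT : ∀ i j, Integrable (fun ω => T ω i j) μ) (u : κ → ℝ) (v : ι → ℝ) :
    Integrable (fun ω => u ⬝ᵥ T ω *ᵥ v) μ := by
  simp only [dotProduct, Matrix.mulVec, Finset.mul_sum]
  exact integrable_finsetSum _ fun i _ => integrable_finsetSum _ fun j _ =>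
    ((hT i j).mul_const _).const_mul _

lemma dotProduct_expMat_mulVec {T : Ω → Matrix κ ι ℝ}
    (hT : ∀ i j, Integrable (fun ω => T ω i j) μ) (u : κ → ℝ) (v : ι → ℝ) :
    u ⬝ᵥ expMat μ T *ᵥ v = ∫ ω, u ⬝ᵥ T ω *ᵥ v ∂μ := by
  simp only [dotProduct, Matrix.mulVec, Finset.mul_sum, expMat, Matrix.of_apply]
  rw [integral_finsetSum _ fun i _ => integrable_finsetSum _ fun j _ =>
    ((hT i j).mul_const _).const_mul _]
  refine Finset.sum_congr rfl fun i _ => ?_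
  rw [integral_finsetSum _ fun j _ => ((hT i j).mul_const _).const_mul _]
  refine Finset.sum_congr rfl fun j _ => ?_
  rw [integral_const_mul, integral_mul_const]

end Integrals

/-! ### Lipschitz dependence of resolvents on the Gaussian matrix -/

section SampleMatrix

variable {ι : Type*} [Fintype ι] [DecidableEq ι] {N d : ℕ}

/-- The random matrix whose rows are `s • x(w)` for the rows `w` of the Gaussian matrix. -/
def sampleMatrix (x : (Fin d → ℝ) → ι → ℝ) (s : ℝ) (W : Fin N → Fin d → ℝ) :
    Matrix (Fin N) ι ℝ :=
  Matrix.of fun a => s • x (W a)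

lemma sampleMatrix_row (x : (Fin d → ℝ) → ι → ℝ) (s : ℝ) (W : Fin N → Fin d → ℝ) (a : Fin N) :
    sampleMatrix x s W a = s • x (W a) := rfl

/-- `x` is Lipschitz for the Euclidean norms. -/
def VecLipschitz (x : (Fin d → ℝ) → ι → ℝ) (L : ℝ) : Prop :=
  ∀ w w', ‖WithLp.toLp 2 (x w - x w')‖ ≤ L * √(∑ l, (w l - w' l) ^ 2)

/-- `T` is Lipschitz from the Frobenius norm to the operator norm. -/
def MatLipschitz {κ ν : Type*} [Fintype κ] [Fintype ν] [DecidableEq ν]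
    (T : (Fin N → Fin d → ℝ) → Matrix κ ν ℝ) (L : ℝ) : Prop :=
  ∀ W W', ‖T W - T W'‖ ≤ L * √(∑ a, ∑ l, (W a l - W' a l) ^ 2)

lemma MatLipschitz.bilin {κ ν : Type*} [Fintype κ] [Fintype ν] [DecidableEq κ] [DecidableEq ν]
    {T : (Fin N → Fin d → ℝ) → Matrix κ ν ℝ} {L : ℝ} (hT : MatLipschitz T L)
    (u : κ → ℝ) (v : ν → ℝ) : FrobLipschitz (fun W => u ⬝ᵥ T W *ᵥ v)
      (L * (‖WithLp.toLp 2 u‖ * ‖WithLp.toLp 2 v‖)) := by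
  intro W W'
  rw [← dotProduct_sub, ← Matrix.sub_mulVec]
  refine (abs_dotProduct_mulVec_le _ _ _).trans ?_
  have := mul_le_mul_of_nonneg_right (hT W W')
    (mul_nonneg (norm_nonneg (WithLp.toLp 2 u)) (norm_nonneg (WithLp.toLp 2 v)))
  linarith

lemma norm_toLp_single {κ : Type*} [Fintype κ] [DecidableEq κ] (a : κ) :
    ‖WithLp.toLp 2 (Pi.single a (1 : ℝ) : κ → ℝ)‖ = 1 := by
  rw [norm_toLp_eq_sqrt]; simp

lemma apply_eq_dotProduct_mulVec {κ ν : Type*} [Fintype κ] [Fintype ν] [DecidableEq κ]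
    [DecidableEq ν] (T : Matrix κ ν ℝ) (i : κ) (j : ν) :
    T i j = Pi.single i 1 ⬝ᵥ T *ᵥ Pi.single j 1 := by
  simp

lemma MatLipschitz.apply {κ ν : Type*} [Fintype κ] [Fintype ν] [DecidableEq κ] [DecidableEq ν]
    {T : (Fin N → Fin d → ℝ) → Matrix κ ν ℝ} {L : ℝ} (hT : MatLipschitz T L)
    (i : κ) (j : ν) : FrobLipschitz (fun W => T W i j) L := by
  have := hT.bilin (Pi.single i 1) (Pi.single j 1)
  simp only [← apply_eq_dotProduct_mulVec, norm_toLp_single, mul_one] at this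
  exact this

lemma MatLipschitz.integrable_apply {κ ν : Type*} [Fintype κ] [Fintype ν] [DecidableEq κ]
    [DecidableEq ν] {T : (Fin N → Fin d → ℝ) → Matrix κ ν ℝ} {L : ℝ} (hT : MatLipschitz T L)
    (hL : 0 ≤ L) (i : κ) (j : ν) :
    Integrable (fun W => T W i j) (gaussianMatrix N d) :=
  ((hT.apply i j).memLp hL).integrable (by norm_num)

variable {x : (Fin d → ℝ) → ι → ℝ} {L s : ℝ}

/-- In the Frobenius norm the rowwise estimates add up in squares, so the constant does not grow
with the number of rows. -/
lemma sqrt_sum_sq_sampleMatrix_le (hx : VecLipschitz x L) (hL : 0 ≤ L) (hs : 0 ≤ s)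
    (W W' : Fin N → Fin d → ℝ) :
    √(∑ a, ∑ i, (sampleMatrix x s W a i - sampleMatrix x s W' a i) ^ 2) ≤
      s * L * √(∑ a, ∑ l, (W a l - W' a l) ^ 2) := by
  rw [← Real.sqrt_sq (mul_nonneg hs hL), ← Real.sqrt_mul (sq_nonneg _)]
  refine Real.sqrt_le_sqrt ?_
  rw [Finset.mul_sum]
  refine Finset.sum_le_sum fun a _ => ?_
  have h1 := pow_le_pow_left₀ (norm_nonneg _) (hx (W a) (W' a)) 2
  rw [mul_pow, Real.sq_sqrt (by positivity), norm_toLp_sq] at h1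
  calc ∑ i, (sampleMatrix x s W a i - sampleMatrix x s W' a i) ^ 2
      = s ^ 2 * ((x (W a) - x (W' a)) ⬝ᵥ (x (W a) - x (W' a))) := by
        rw [dotProduct, Finset.mul_sum]
        refine Finset.sum_congr rfl fun i _ => ?_
        simp only [sampleMatrix_row, Pi.smul_apply, Pi.sub_apply, smul_eq_mul]
        ring
    _ ≤ s ^ 2 * (L ^ 2 * ∑ l, (W a l - W' a l) ^ 2) := by gcongr
    _ = _ := by ring

lemma matLipschitz_sampleMatrix (hx : VecLipschitz x L) (hL : 0 ≤ L) (hs : 0 ≤ s) :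
    MatLipschitz (sampleMatrix (N := N) x s) (s * L) := fun W W' =>
  (opNorm_le_sqrt_sum_sq _).trans (sqrt_sum_sq_sampleMatrix_le hx hL hs W W')

lemma matLipschitz_sampleMatrix_updateRow (hx : VecLipschitz x L) (hL : 0 ≤ L) (hs : 0 ≤ s)
    (a : Fin N) :
    MatLipschitz (fun W => (sampleMatrix (N := N) x s W).updateRow a 0) (s * L) := fun W W' => by
  refine (opNorm_le_sqrt_sum_sq _).trans (le_trans (Real.sqrt_le_sqrt ?_)
    (sqrt_sum_sq_sampleMatrix_le hx hL hs W W'))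
  refine Finset.sum_le_sum fun b _ => Finset.sum_le_sum fun i _ => ?_
  change ((sampleMatrix x s W).updateRow a 0 b i - (sampleMatrix x s W').updateRow a 0 b i) ^ 2 ≤ _
  rcases eq_or_ne b a with rfl | hb
  · rw [Matrix.updateRow_self, Matrix.updateRow_self]
    simp [sq_nonneg]
  · rw [Matrix.updateRow_ne hb, Matrix.updateRow_ne hb]

variable {P : Matrix ι ι ℝ} {p : ℝ}

lemma MatLipschitz.res {Y : (Fin N → Fin d → ℝ) → Matrix (Fin N) ι ℝ} {c : ℝ}
    (hY : MatLipschitz Y c) (h : Coercive P p) (hp : 0 < p) :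
    MatLipschitz (fun W => res P (Y W)) (2 * (√p)⁻¹ * p⁻¹ * c) := fun W W' => by
  refine (h.norm_res_sub_le hp _ _).trans ?_
  have := mul_le_mul_of_nonneg_left (hY W W') (by positivity : 0 ≤ 2 * (√p)⁻¹ * p⁻¹)
  linarith

lemma MatLipschitz.res_mul {Y : (Fin N → Fin d → ℝ) → Matrix (Fin N) ι ℝ} {c : ℝ}
    (hY : MatLipschitz Y c) (h : Coercive P p) (hp : 0 < p) :
    MatLipschitz (fun W => RFLSTD.res P (Y W) * (Y W)ᵀ) (3 * p⁻¹ * c) := fun W W' => by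
  refine (h.norm_res_mul_sub_le hp _ _).trans ?_
  have := mul_le_mul_of_nonneg_left (hY W W') (by positivity : 0 ≤ 3 * p⁻¹)
  linarith

lemma MatLipschitz.mul_res_mul {Y : (Fin N → Fin d → ℝ) → Matrix (Fin N) ι ℝ} {c : ℝ}
    (hY : MatLipschitz Y c) (h : Coercive P p) (hp : 0 < p) :
    MatLipschitz (fun W => Y W * RFLSTD.res P (Y W) * (Y W)ᵀ) (4 * (√p)⁻¹ * c) := fun W W' => by
  refine (h.norm_mul_res_mul_sub_le hp _ _).trans ?_
  have := mul_le_mul_of_nonneg_left (hY W W') (by positivity : 0 ≤ 4 * (√p)⁻¹)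
  linarith

end SampleMatrix

lemma dotProduct_mulVec_comm {ι κ : Type*} [Fintype ι] [Fintype κ] (T : Matrix κ ι ℝ)
    (u : κ → ℝ) (v : ι → ℝ) : u ⬝ᵥ T *ᵥ v = v ⬝ᵥ Tᵀ *ᵥ u := by
  rw [Matrix.mulVec_transpose, Matrix.dotProduct_mulVec, dotProduct_comm]

/-- The parameters on which the error bounds depend. -/
structure BoundParams where
  /-- the Lipschitz constant of the random vector -/
  L : ℝ
  /-- the moment bound -/
  b : ℝ
  /-- the lower bound of `N / m` -/
  c₀ : ℝ
  /-- the upper bound of `N / m` -/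
  C₀ : ℝ

/-! ### Error constants that do not involve the dimensions -/

namespace BoundParams

variable (S : BoundParams)

/-- The fourth moment bound of linear functionals of the resolvent. -/
def boundLin (p : ℝ) : ℝ := 8 * (concConst * (3 * p⁻¹ * S.L) ^ 4 + (p⁻¹ * S.c₀⁻¹) ^ 2)

/-- The fourth moment bound of the inverse leverage. -/
def boundInv (p : ℝ) : ℝ := 8 * (1 + p⁻¹ ^ 4 * S.b)

/-- The bound of the inverse mean leverage. -/
def boundMean (p : ℝ) : ℝ := 1 + p⁻¹ * (1 + S.b)

/-- The fourth moment bound of linear functionals of the deterministic resolvent. -/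
def boundDet (p : ℝ) : ℝ :=
  8 * (concConst * (S.L * p⁻¹) ^ 4 + (S.boundMean p * S.c₀⁻¹ * p⁻¹) ^ 2)

/-- The fourth moment bound of the centred leverage. -/
def boundLev (p : ℝ) : ℝ := concConst * (4 * (√p)⁻¹ * S.L) ^ 4

/-- The constant in the leave-one-out estimate. -/
def boundOut (p : ℝ) : ℝ := (S.boundInv p + S.boundLin p + S.boundLin p + 1) / 4

/-- The constant in the estimate of the expected resolvent. -/
def boundRes (p : ℝ) : ℝ :=
  S.C₀ * (S.boundOut p * (√(1 + S.b) * √(S.boundMean p * S.c₀⁻¹ * p⁻¹)) +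
    (S.boundLev p + S.boundInv p + S.boundLin p + S.boundDet p) / 4)

/-- The constant in the estimate of the fixed-point equation. -/
def boundFix (p : ℝ) : ℝ :=
  (S.boundLev p + S.boundInv p + 1 + 1) / 4 + (1 + S.b) * (S.boundOut p + S.boundRes p)

/-- The constant in the deterministic equivalent of the expected resolvent. -/
def boundTotal (p : ℝ) : ℝ :=
  S.boundRes p + S.C₀ * S.boundFix p * (S.boundMean p * S.c₀⁻¹ * p⁻¹)

end BoundParams

open BoundParams

/-- A sample of `N` independent copies of a Lipschitz image `x` of a Gaussian vector, with norms of
order `√m`, where `N` is of order `m`. -/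
structure SampleModel (ι : Type*) [Fintype ι] [DecidableEq ι] (N d : ℕ) extends
    BoundParams where
  /-- the random vector -/
  x : (Fin d → ℝ) → ι → ℝ
  /-- the size parameter -/
  m : ℝ
  one_le_m : 1 ≤ m
  L_nonneg : 0 ≤ L
  c₀_pos : 0 < c₀
  le_N : c₀ * m ≤ N
  N_le : N ≤ C₀ * m
  measurable_x : Measurable x
  lipschitz : VecLipschitz x L
  integrable_moment : Integrable (fun w => (x w ⬝ᵥ x w / m) ^ 4) (gaussianVector d)
  moment_le : ∫ w, (x w ⬝ᵥ x w / m) ^ 4 ∂gaussianVector d ≤ b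

/-! ### Moments of leverages and of linear functionals of the resolvent -/

namespace SampleModel

variable {ι : Type*} [Fintype ι] [DecidableEq ι] {N d : ℕ} (S : SampleModel ι N d)

/-- The normalised data matrix. -/
def Y (W : Fin N → Fin d → ℝ) : Matrix (Fin N) ι ℝ := sampleMatrix S.x (√S.m)⁻¹ W

/-- The second moment matrix. -/
def Φ : Matrix ι ι ℝ := Matrix.of fun i j => ∫ w, S.x w i * S.x w j ∂gaussianVector d

/-- The law of the Gaussian matrix. -/
local notation "𝔾" => gaussianMatrix N d

lemma m_pos : 0 < S.m := zero_lt_one.trans_le S.one_le_m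

lemma sqrt_m_pos : 0 < √S.m := Real.sqrt_pos.2 S.m_pos

lemma N_pos (S : SampleModel ι N d) : (0 : ℝ) < N := (mul_pos S.c₀_pos S.m_pos).trans_le S.le_N

lemma C₀_pos : 0 < S.C₀ := by
  have := S.N_pos.trans_le S.N_le
  exact pos_of_mul_pos_left this S.m_pos.le

lemma b_nonneg : 0 ≤ S.b := le_trans (integral_nonneg fun w => by positivity) S.moment_le

lemma Y_row (W : Fin N → Fin d → ℝ) (a : Fin N) : S.Y W a = (√S.m)⁻¹ • S.x (W a) := rfl

lemma x_eq (W : Fin N → Fin d → ℝ) (a : Fin N) : S.x (W a) = √S.m • S.Y W a := by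
  rw [Y_row, smul_smul, mul_inv_cancel₀ S.sqrt_m_pos.ne', one_smul]

lemma inv_sqrt_m_sq : (√S.m)⁻¹ * (√S.m)⁻¹ = S.m⁻¹ := by
  rw [← mul_inv, Real.mul_self_sqrt S.m_pos.le]

lemma matLipschitz_Y : MatLipschitz S.Y ((√S.m)⁻¹ * S.L) :=
  matLipschitz_sampleMatrix S.lipschitz S.L_nonneg (by positivity)

variable {P : Matrix ι ι ℝ} {p : ℝ}

lemma integrable_res (h : Coercive P p) (hp : 0 < p)
    (i j : ι) : Integrable (fun W => res P (S.Y W) i j) 𝔾 :=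
  (S.matLipschitz_Y.res h hp).integrable_apply (mul_nonneg (by positivity)
    (mul_nonneg (by positivity) S.L_nonneg)) i j

lemma integrable_resOut (h : Coercive P p) (hp : 0 < p) (a : Fin N) (i j : ι) :
    Integrable (fun W => resOut (S.Y W) a P i j) 𝔾 :=
  ((matLipschitz_sampleMatrix_updateRow S.lipschitz S.L_nonneg (by positivity) a).res
    h hp).integrable_apply (mul_nonneg (by positivity)
    (mul_nonneg (by positivity) S.L_nonneg)) i j

/-- uᵀKx = √m · uᵀ(KYᵀ)e for the row index e, and √m cancels the m^{-1/2} in the Lipschitz constant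
of Y. -/
lemma frobLipschitz_lin (h : Coercive P p) (hp : 0 < p)
    (a : Fin N) {u : ι → ℝ} (hu : ‖WithLp.toLp 2 u‖ ≤ 1) :
    FrobLipschitz (fun W => u ⬝ᵥ res P (S.Y W) *ᵥ S.x (W a)) (3 * p⁻¹ * S.L) := by
  have h1 := (S.matLipschitz_Y.res_mul h hp).bilin u (Pi.single a 1)
  have e : ∀ W, u ⬝ᵥ res P (S.Y W) *ᵥ S.x (W a) =
      √S.m * (u ⬝ᵥ (res P (S.Y W) * (S.Y W)ᵀ) *ᵥ Pi.single a 1) := by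
    intro W
    rw [S.x_eq, ← Matrix.mulVec_mulVec, Matrix.mulVec_single_one, Matrix.mulVec_smul,
      dotProduct_smul, smul_eq_mul]
    rfl
  intro W W'
  have h2 := mul_le_mul_of_nonneg_left (h1 W W') S.sqrt_m_pos.le
  rw [← abs_of_pos S.sqrt_m_pos, ← abs_mul, abs_of_pos S.sqrt_m_pos, mul_sub, ← e, ← e,
    norm_toLp_single] at h2
  refine h2.trans ?_
  have e2 : √S.m * (3 * p⁻¹ * ((√S.m)⁻¹ * S.L) * (‖WithLp.toLp 2 u‖ * 1) *
      √(∑ a, ∑ l, (W a l - W' a l) ^ 2)) =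
      ‖WithLp.toLp 2 u‖ * (3 * p⁻¹ * S.L * √(∑ a, ∑ l, (W a l - W' a l) ^ 2)) := by
    have := S.sqrt_m_pos.ne'
    field_simp
  rw [e2]
  exact mul_le_of_le_one_left (mul_nonneg (mul_nonneg (by positivity) S.L_nonneg)
    (Real.sqrt_nonneg _)) hu

lemma memLp_lin (h : Coercive P p) (hp : 0 < p)
    (a : Fin N) {u : ι → ℝ} (hu : ‖WithLp.toLp 2 u‖ ≤ 1) :
    MemLp (fun W => u ⬝ᵥ res P (S.Y W) *ᵥ S.x (W a)) 4 𝔾 :=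
  (S.frobLipschitz_lin h hp a hu).memLp (mul_nonneg (by positivity) S.L_nonneg)

/-- The law of the pair of the resolvent and a row does not depend on the row. -/
lemma integral_exchange (G : Matrix ι ι ℝ → (Fin d → ℝ) → ℝ) (a a' : Fin N) :
    ∫ W, G (res P (S.Y W)) (W a') ∂𝔾 = ∫ W, G (res P (S.Y W)) (W a) ∂𝔾 := by
  rw [← integral_comp_perm (fun W => G (res P (S.Y W)) (W a)) (Equiv.swap a a')]
  have e : ∀ W : Fin N → Fin d → ℝ,
      res P (S.Y fun b => W (Equiv.swap a a' b)) = res P (S.Y W) := by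
    intro W
    -- The resolvent sees Y only through its Gram matrix, which does not change when rows are
    -- permuted.
    have : (S.Y fun b => W (Equiv.swap a a' b))ᵀ * (S.Y fun b => W (Equiv.swap a a' b)) =
        (S.Y W)ᵀ * S.Y W := by
      ext i j
      simp only [Matrix.mul_apply, Matrix.transpose_apply]
      exact Equiv.sum_comp (Equiv.swap a a') fun b => S.Y W b i * S.Y W b j
    rw [res, res, this]
  simp only [e, Equiv.swap_apply_left]

/-- All rows contribute equally, and the sum over the rows is m‖YKᵀu‖² ≤ m/p. Division by N ≥ c₀m
gives the bound. -/
lemma integral_lin_sq_le (h : Coercive P p) (hp : 0 < p)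
    (a : Fin N) {u : ι → ℝ} (hu : ‖WithLp.toLp 2 u‖ ≤ 1) :
    ∫ W, (u ⬝ᵥ res P (S.Y W) *ᵥ S.x (W a)) ^ 2 ∂𝔾 ≤ p⁻¹ * S.c₀⁻¹ := by
  have hint : ∀ a', Integrable (fun W => (u ⬝ᵥ res P (S.Y W) *ᵥ S.x (W a')) ^ 2) 𝔾 := fun a' =>
    ((S.memLp_lin h hp a' hu).mono_exponent (p := 2) (by norm_num)).integrable_sq
  have h1 : (N : ℝ) * ∫ W, (u ⬝ᵥ res P (S.Y W) *ᵥ S.x (W a)) ^ 2 ∂𝔾 =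
      ∫ W, ∑ a', (u ⬝ᵥ res P (S.Y W) *ᵥ S.x (W a')) ^ 2 ∂𝔾 := by
    rw [integral_finsetSum _ fun a' _ => hint a',
      Finset.sum_congr rfl fun a' _ => S.integral_exchange (P := P)
        (fun T w => (u ⬝ᵥ T *ᵥ S.x w) ^ 2) a a']
    simp
  have h2 : ∀ W, ∑ a', (u ⬝ᵥ res P (S.Y W) *ᵥ S.x (W a')) ^ 2 ≤ S.m * p⁻¹ := by
    intro W
    have e : ∑ a', (u ⬝ᵥ res P (S.Y W) *ᵥ S.x (W a')) ^ 2 =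
        S.m * ‖WithLp.toLp 2 ((S.Y W * res Pᵀ (S.Y W)) *ᵥ u)‖ ^ 2 := by
      rw [norm_toLp_sq, dotProduct, Finset.mul_sum]
      refine Finset.sum_congr rfl fun a' _ => ?_
      have : ((S.Y W * res Pᵀ (S.Y W)) *ᵥ u) a' = u ⬝ᵥ res P (S.Y W) *ᵥ S.Y W a' := by
        rw [← Matrix.mulVec_mulVec, dotProduct_mulVec_comm (res P (S.Y W)) u (S.Y W a'), transpose_res]
        rfl
      rw [this, S.x_eq, Matrix.mulVec_smul, dotProduct_smul, smul_eq_mul, mul_pow,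
        Real.sq_sqrt S.m_pos.le]
      ring
    rw [e]
    have h3 := (norm_toLp_mulVec_le (S.Y W * res Pᵀ (S.Y W)) u).trans (mul_le_mul
      (h.transpose.norm_mul_res_le hp (S.Y W)) hu (norm_nonneg _) (by positivity))
    have h4 := pow_le_pow_left₀ (norm_nonneg _) h3 2
    rw [mul_one, inv_pow, Real.sq_sqrt hp.le] at h4
    exact mul_le_mul_of_nonneg_left h4 S.m_pos.le
  have h5 : (N : ℝ) * ∫ W, (u ⬝ᵥ res P (S.Y W) *ᵥ S.x (W a)) ^ 2 ∂𝔾 ≤ S.m * p⁻¹ := by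
    rw [h1]
    calc _ ≤ ∫ _ : Fin N → Fin d → ℝ, S.m * p⁻¹ ∂𝔾 :=
          integral_mono (integrable_finsetSum _ fun a' _ => hint a') (integrable_const _) h2
      _ = _ := by simp
  set I := ∫ W, (u ⬝ᵥ res P (S.Y W) *ᵥ S.x (W a)) ^ 2 ∂𝔾
  have hI : 0 ≤ I := integral_nonneg fun W => sq_nonneg _
  have h6 : S.m * (S.c₀ * I) ≤ S.m * p⁻¹ := by
    refine le_trans ?_ h5
    have := mul_le_mul_of_nonneg_right S.le_N hI
    linarith
  have h7 := le_of_mul_le_mul_left h6 S.m_pos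
  rw [← div_eq_mul_inv, le_div_iff₀ S.c₀_pos]
  linarith

lemma integral_lin_pow_four_le (h : Coercive P p) (hp : 0 < p)
    (a : Fin N) {u : ι → ℝ} (hu : ‖WithLp.toLp 2 u‖ ≤ 1) :
    ∫ W, (u ⬝ᵥ res P (S.Y W) *ᵥ S.x (W a)) ^ 4 ∂𝔾 ≤ S.boundLin p :=
  (S.frobLipschitz_lin h hp a hu).integral_pow_four_le (mul_nonneg (by positivity) S.L_nonneg)
    (S.integral_lin_sq_le h hp a hu)

lemma memLp_lin' (h : Coercive P p) (hp : 0 < p)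
    (a : Fin N) {v : ι → ℝ} (hv : ‖WithLp.toLp 2 v‖ ≤ 1) :
    MemLp (fun W => S.x (W a) ⬝ᵥ res P (S.Y W) *ᵥ v) 4 𝔾 := by
  simp only [dotProduct_mulVec_comm _ _ v, transpose_res]
  exact S.memLp_lin h.transpose hp a hv

lemma integral_lin'_pow_four_le (h : Coercive P p) (hp : 0 < p)
    (a : Fin N) {v : ι → ℝ} (hv : ‖WithLp.toLp 2 v‖ ≤ 1) :
    ∫ W, (S.x (W a) ⬝ᵥ res P (S.Y W) *ᵥ v) ^ 4 ∂𝔾 ≤ S.boundLin p := by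
  simp only [dotProduct_mulVec_comm _ _ v, transpose_res]
  exact S.integral_lin_pow_four_le h.transpose hp a hv

/-- The leverage is 1 minus a diagonal entry of YKYᵀ. Its constant is of order m^{-1/2}, so
rescaling the centred leverage by √m keeps its moments bounded. -/
lemma frobLipschitz_leverage (h : Coercive P p) (hp : 0 < p) (a : Fin N) :
    FrobLipschitz (fun W => leverage (S.Y W) a P) (4 * (√p)⁻¹ * ((√S.m)⁻¹ * S.L)) := by
  have h1 := (S.matLipschitz_Y.mul_res_mul h hp).apply a a
  have e : ∀ W, leverage (S.Y W) a P = 1 - (S.Y W * res P (S.Y W) * (S.Y W)ᵀ) a a := by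
    intro W
    rw [leverage, Matrix.mul_assoc, Matrix.mul_apply', dotProduct]
    rfl
  intro W W'
  simp only [e]
  rw [sub_sub_sub_cancel_left, abs_sub_comm]
  exact h1 W W'

lemma memLp_leverage (h : Coercive P p) (hp : 0 < p)
    (a : Fin N) : MemLp (fun W => leverage (S.Y W) a P) 4 𝔾 :=
  (S.frobLipschitz_leverage h hp a).memLp (mul_nonneg (by positivity)
    (mul_nonneg (by positivity) S.L_nonneg))

/-- The mean leverage. -/
def meanLev (P : Matrix ι ι ℝ) (a : Fin N) : ℝ := ∫ W, leverage (S.Y W) a P ∂𝔾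

/-- The rescaled centred leverage. -/
def fluct (P : Matrix ι ι ℝ) (a : Fin N) (W : Fin N → Fin d → ℝ) : ℝ :=
  √S.m * (leverage (S.Y W) a P - S.meanLev P a)

lemma memLp_fluct (h : Coercive P p) (hp : 0 < p) (a : Fin N) : MemLp (S.fluct P a) 4 𝔾 :=
  ((S.memLp_leverage h hp a).sub (memLp_const _)).const_mul _

lemma integral_fluct_pow_four_le (h : Coercive P p) (hp : 0 < p)
    (a : Fin N) : ∫ W, S.fluct P a W ^ 4 ∂𝔾 ≤ S.boundLev p := by
  have h1 := (S.frobLipschitz_leverage h hp a).concentration (mul_nonneg (by positivity)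
    (mul_nonneg (by positivity) S.L_nonneg))
  simp only [fluct, mul_pow, integral_const_mul]
  have h2 := mul_le_mul_of_nonneg_left h1 (by positivity : 0 ≤ √S.m ^ 4)
  refine h2.trans_eq ?_
  rw [boundLev]
  have := S.sqrt_m_pos.ne'
  field_simp

lemma integrable_moment_row (a : Fin N) :
    Integrable (fun W : Fin N → Fin d → ℝ => (S.x (W a) ⬝ᵥ S.x (W a) / S.m) ^ 4) 𝔾 :=
  (measurePreserving_row a).integrable_comp_of_integrable S.integrable_moment

lemma integral_row (a : Fin N) {f : (Fin d → ℝ) → ℝ}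
    (hf : AEStronglyMeasurable f (gaussianVector d)) :
    ∫ W, f (W a) ∂𝔾 = ∫ w, f w ∂gaussianVector d := by
  have hmp := measurePreserving_row (N := N) (d := d) a
  rw [← hmp.map_eq, integral_map hmp.measurable.aemeasurable (by rw [hmp.map_eq]; exact hf)]

lemma inv_leverage_le (h : Coercive P p) (hp : 0 < p) (a : Fin N) (W : Fin N → Fin d → ℝ) :
    (leverage (S.Y W) a P)⁻¹ ≤ 1 + p⁻¹ * (S.x (W a) ⬝ᵥ S.x (W a) / S.m) := by
  refine (h.inv_leverage_le (S.Y W) a hp).trans_eq ?_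
  rw [S.Y_row, smul_dotProduct, dotProduct_smul, smul_eq_mul, smul_eq_mul, ← mul_assoc (√S.m)⁻¹,
    S.inv_sqrt_m_sq]
  ring

lemma inv_leverage_pow_four_le (h : Coercive P p) (hp : 0 < p) (a : Fin N) (W : Fin N → Fin d → ℝ) :
    ((leverage (S.Y W) a P)⁻¹) ^ 4 ≤
      8 * (1 + p⁻¹ ^ 4 * (S.x (W a) ⬝ᵥ S.x (W a) / S.m) ^ 4) := by
  have h1 := S.inv_leverage_le h hp a W
  have h0 := (h.leverage_pos (S.Y W) a hp).le
  have h2 := pow_le_pow_left₀ (inv_nonneg.2 h0) h1 4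
  refine h2.trans ?_
  rw [← mul_pow]
  generalize p⁻¹ * (S.x (W a) ⬝ᵥ S.x (W a) / S.m) = t
  -- (1 + t)⁴ ≤ 8(1 + t⁴).
  nlinarith [sq_nonneg (t - 1), sq_nonneg (t ^ 2 - 1), sq_nonneg (t * (t - 1)),
    mul_nonneg (sq_nonneg (t - 1)) (sq_nonneg (t + 1)), sq_nonneg (t + 1)]

lemma memLp_inv_leverage (h : Coercive P p) (hp : 0 < p)
    (a : Fin N) : MemLp (fun W => (leverage (S.Y W) a P)⁻¹) 4 𝔾 := by
  have hm : AEStronglyMeasurable (fun W => (leverage (S.Y W) a P)⁻¹) 𝔾 :=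
    (S.memLp_leverage h hp a).aestronglyMeasurable.aemeasurable.inv.aestronglyMeasurable
  have hi := (S.integrable_moment_row a).const_mul (p⁻¹ ^ 4)
  refine memLp_four_of_integrable hm (Integrable.mono' (((integrable_const 1).add hi).const_mul 8)
    (hm.pow 4) (Eventually.of_forall fun W => ?_))
  rw [Real.norm_of_nonneg (by positivity)]
  exact S.inv_leverage_pow_four_le h hp a W

lemma integral_inv_leverage_pow_four_le (h : Coercive P p) (hp : 0 < p) (a : Fin N) :
    ∫ W, ((leverage (S.Y W) a P)⁻¹) ^ 4 ∂𝔾 ≤ S.boundInv p := by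
  have hi := (S.integrable_moment_row a).const_mul (p⁻¹ ^ 4)
  calc _ ≤ ∫ W, 8 * (1 + p⁻¹ ^ 4 * (S.x (W a) ⬝ᵥ S.x (W a) / S.m) ^ 4) ∂𝔾 :=
        integral_mono (MemLp_integrable_pow_four (S.memLp_inv_leverage h hp a))
          (((integrable_const 1).add hi).const_mul 8) (S.inv_leverage_pow_four_le h hp a)
    _ = 8 * (1 + p⁻¹ ^ 4 * ∫ w, (S.x w ⬝ᵥ S.x w / S.m) ^ 4 ∂gaussianVector d) := by
        rw [integral_const_mul, integral_add (integrable_const _) hi, integral_const_mul,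
          integral_row a (f := fun w => (S.x w ⬝ᵥ S.x w / S.m) ^ 4)
            S.integrable_moment.aestronglyMeasurable]
        simp
    _ ≤ _ := by
        rw [boundInv]
        have := S.moment_le
        gcongr

/-- Leaving out one row changes the expected resolvent by `O(1/m)`. -/
lemma norm_expMat_resOut_sub_le (h : Coercive P p) (hp : 0 < p) (a : Fin N) :
    ‖expMat 𝔾 (fun W => resOut (S.Y W) a P) - expMat 𝔾 (fun W => res P (S.Y W))‖ ≤
      S.boundOut p * S.m⁻¹ := by
  have hnn : 0 ≤ S.boundOut p := by
    have := concConst_nonneg; have := S.b_nonneg; have := S.c₀_pos; have := S.L_nonneg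
    unfold boundOut boundInv boundLin; positivity
  refine opNorm_le_of_bilin _ (mul_nonneg hnn (inv_nonneg.2 S.m_pos.le)) fun u v hu hv => ?_
  rw [Matrix.sub_mulVec, dotProduct_sub, dotProduct_expMat_mulVec (S.integrable_resOut h hp a),
    dotProduct_expMat_mulVec (S.integrable_res h hp), ← integral_sub
      (integrable_dotProduct_mulVec (S.integrable_resOut h hp a) u v)
      (integrable_dotProduct_mulVec (S.integrable_res h hp) u v)]
  -- The two factors m^{-1/2} of the row come out as m⁻¹; the remaining factors have bounded fourth
  -- moments for unit u and v.
  have e : ∀ W, u ⬝ᵥ resOut (S.Y W) a P *ᵥ v - u ⬝ᵥ res P (S.Y W) *ᵥ v =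
      S.m⁻¹ * ((leverage (S.Y W) a P)⁻¹ * (u ⬝ᵥ res P (S.Y W) *ᵥ S.x (W a)) *
        (S.x (W a) ⬝ᵥ res P (S.Y W) *ᵥ v) * 1) := by
    intro W
    rw [h.dotProduct_resOut_sub_res' (S.Y W) a hp, S.Y_row, Matrix.mulVec_smul, dotProduct_smul,
      smul_dotProduct, smul_eq_mul, smul_eq_mul, ← S.inv_sqrt_m_sq]
    ring
  simp only [e]
  rw [integral_const_mul, abs_mul, abs_of_pos (inv_pos.2 S.m_pos), mul_comm]
  refine mul_le_mul_of_nonneg_right ?_ (inv_nonneg.2 S.m_pos.le)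
  refine (abs_integral_mul₄_le (S.memLp_inv_leverage h hp a) (S.memLp_lin h hp a hu)
    (S.memLp_lin' h hp a hv) (memLp_const 1)).trans ?_
  have h1 := S.integral_inv_leverage_pow_four_le h hp a
  have h2 := S.integral_lin_pow_four_le h hp a hu
  have h3 := S.integral_lin'_pow_four_le h hp a hv
  rw [boundOut]
  simp only [one_pow, integral_const, probReal_univ, smul_eq_mul, mul_one]
  linarith

end SampleModel

lemma abs_apply_le_norm {ι κ : Type*} [Fintype ι] [Fintype κ] [DecidableEq ι] [DecidableEq κ]
    (T : Matrix κ ι ℝ) (i : κ) (j : ι) : |T i j| ≤ ‖T‖ := by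
  rw [apply_eq_dotProduct_mulVec T i j]
  refine (abs_dotProduct_mulVec_le _ _ _).trans_eq ?_
  rw [norm_toLp_single, norm_toLp_single, mul_one, mul_one]

lemma sq_apply_le_dotProduct_self {ι : Type*} [Fintype ι] (v : ι → ℝ) (i : ι) :
    v i ^ 2 ≤ v ⬝ᵥ v := by
  have := Finset.single_le_sum (f := fun i => v i * v i) (fun i _ => mul_self_nonneg (v i))
    (Finset.mem_univ i)
  rw [dotProduct]
  nlinarith

lemma norm_le_sqrt_trace_gram {ι κ : Type*} [Fintype ι] [Fintype κ] [DecidableEq ι]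
    [DecidableEq κ] (B : Matrix κ ι ℝ) : ‖B‖ ≤ √((Bᵀ * B).trace) := by
  refine (opNorm_le_sqrt_sum_sq B).trans_eq ?_
  congr 1
  rw [Finset.sum_comm]
  simp [Matrix.trace, Matrix.mul_apply, sq]

lemma gram_sqrt_smul_eq {ι : Type*} [Fintype ι] {B Φ : Matrix ι ι ℝ} {r : ℝ} (hB : Φ = Bᵀ * B)
    (hr : 0 ≤ r) : (√r • B)ᵀ * (√r • B) = r • Φ := by
  rw [Matrix.transpose_smul, Matrix.smul_mul, Matrix.mul_smul, smul_smul, Real.mul_self_sqrt hr, hB]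

open scoped MatrixOrder in
lemma exists_eq_transpose_mul_self {ι : Type*} [Fintype ι] [DecidableEq ι] {A : Matrix ι ι ℝ}
    (hA : A.PosSemidef) : ∃ B : Matrix ι ι ℝ, A = Bᵀ * B := by
  obtain ⟨B, hB⟩ := CStarAlgebra.nonneg_iff_eq_star_mul_self.mp hA.nonneg
  exact ⟨B, by rw [hB, Matrix.star_eq_conjTranspose, Matrix.conjTranspose_eq_transpose_of_trivial]⟩

/-! ### Deterministic approximation of the expected resolvent -/

namespace SampleModel

variable {ι : Type*} [Fintype ι] [DecidableEq ι] {N d : ℕ} (S : SampleModel ι N d)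

/-- The law of the Gaussian matrix. -/
local notation "𝔾" => gaussianMatrix N d

lemma abs_le_moment (w : Fin d → ℝ) :
    S.x w ⬝ᵥ S.x w ≤ S.m * (1 + (S.x w ⬝ᵥ S.x w / S.m) ^ 4) := by
  have h1 : S.x w ⬝ᵥ S.x w = S.m * (S.x w ⬝ᵥ S.x w / S.m) := by
    rw [mul_div_cancel₀ _ S.m_pos.ne']
  conv_lhs => rw [h1]
  have := S.m_pos.le
  gcongr
  generalize S.x w ⬝ᵥ S.x w / S.m = t
  nlinarith [sq_nonneg (t - 1), sq_nonneg (t ^ 2 - 1), sq_nonneg (t ^ 2), sq_nonneg (t + 1)]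

lemma measurable_apply (i : ι) : Measurable fun w => S.x w i :=
  (measurable_pi_apply i).comp S.measurable_x

lemma integrable_mul_apply (i j : ι) :
    Integrable (fun w => S.x w i * S.x w j) (gaussianVector d) := by
  refine Integrable.mono' (((integrable_const 1).add S.integrable_moment).const_mul S.m)
    ((S.measurable_apply i).mul (S.measurable_apply j)).aestronglyMeasurable
    (Eventually.of_forall fun w => ?_)
  refine le_trans ?_ (S.abs_le_moment w)
  have h1 := sq_apply_le_dotProduct_self (S.x w) i
  have h2 := sq_apply_le_dotProduct_self (S.x w) j
  rw [Real.norm_eq_abs, abs_le]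
  constructor <;> nlinarith [sq_nonneg (S.x w i - S.x w j), sq_nonneg (S.x w i + S.x w j)]

lemma integrable_dotProduct_self : Integrable (fun w => S.x w ⬝ᵥ S.x w) (gaussianVector d) :=
  integrable_finsetSum _ fun i _ => S.integrable_mul_apply i i

lemma Φ_eq_expMat : S.Φ = expMat (gaussianVector d) fun w => Matrix.vecMulVec (S.x w) (S.x w) :=
  rfl

lemma dotProduct_Φ_mulVec (u v : ι → ℝ) :
    u ⬝ᵥ S.Φ *ᵥ v = ∫ w, (S.x w ⬝ᵥ u) * (S.x w ⬝ᵥ v) ∂gaussianVector d := by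
  rw [Φ_eq_expMat, dotProduct_expMat_mulVec (T := fun w => Matrix.vecMulVec (S.x w) (S.x w))
    S.integrable_mul_apply]
  refine integral_congr_ae (Eventually.of_forall fun w => ?_)
  simp only [Matrix.vecMulVec_mulVec, op_smul_eq_smul, dotProduct_smul, smul_eq_mul]
  rw [dotProduct_comm u, mul_comm]

/-- With this factor, multiples of Φ fit into `res`, and traces against Φ become sums of quadratic
forms. -/
lemma exists_gram : ∃ B : Matrix ι ι ℝ, S.Φ = Bᵀ * B := by
  have hpsd : S.Φ.PosSemidef := by
    refine Matrix.PosSemidef.of_dotProduct_mulVec_nonneg ?_ fun v => ?_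
    · ext i j
      simp only [Matrix.conjTranspose_apply, Φ, Matrix.of_apply, star_trivial]
      simp_rw [mul_comm]
    · rw [star_trivial, dotProduct_Φ_mulVec]
      exact integral_nonneg fun w => mul_self_nonneg _
  obtain ⟨B, hB⟩ := exists_eq_transpose_mul_self hpsd
  exact ⟨B, hB⟩

lemma trace_Φ : S.Φ.trace = ∫ w, S.x w ⬝ᵥ S.x w ∂gaussianVector d := by
  simp only [dotProduct]
  rw [integral_finsetSum _ fun i _ => S.integrable_mul_apply i i]
  rfl

lemma trace_Φ_le : S.Φ.trace ≤ S.m * (1 + S.b) := by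
  rw [trace_Φ]
  calc _ ≤ ∫ w, S.m * (1 + (S.x w ⬝ᵥ S.x w / S.m) ^ 4) ∂gaussianVector d :=
        integral_mono S.integrable_dotProduct_self
          (((integrable_const 1).add S.integrable_moment).const_mul S.m) S.abs_le_moment
    _ = S.m * (1 + ∫ w, (S.x w ⬝ᵥ S.x w / S.m) ^ 4 ∂gaussianVector d) := by
        rw [integral_const_mul, integral_add (integrable_const _) S.integrable_moment]
        simp
    _ ≤ _ := by
        have := S.moment_le
        have := S.m_pos.le
        gcongr

variable {P : Matrix ι ι ℝ} {p : ℝ} (h : Coercive P p) (hp : 0 < p)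
include h hp

lemma meanLev_le_one (a : Fin N) : S.meanLev P a ≤ 1 := by
  calc S.meanLev P a ≤ ∫ _ : Fin N → Fin d → ℝ, (1 : ℝ) ∂𝔾 :=
        integral_mono ((S.memLp_leverage h hp a).integrable (by norm_num)) (integrable_const _)
          fun W => h.leverage_le_one (S.Y W) a hp
    _ = 1 := by simp

omit h in
lemma boundMean_pos : 0 < S.boundMean p := by
  have := S.b_nonneg
  unfold boundMean; positivity

lemma integral_inv_leverage_le (a : Fin N) :
    ∫ W, (leverage (S.Y W) a P)⁻¹ ∂𝔾 ≤ S.boundMean p := by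
  have hi : Integrable (fun W : Fin N → Fin d → ℝ => S.x (W a) ⬝ᵥ S.x (W a) / S.m) 𝔾 :=
    ((measurePreserving_row a).integrable_comp_of_integrable S.integrable_dotProduct_self).div_const
      S.m
  calc _ ≤ ∫ W, (1 + p⁻¹ * (S.x (W a) ⬝ᵥ S.x (W a) / S.m)) ∂𝔾 :=
        integral_mono ((S.memLp_inv_leverage h hp a).integrable (by norm_num))
          ((integrable_const 1).add (hi.const_mul _)) (S.inv_leverage_le h hp a)
    _ = 1 + p⁻¹ * (S.Φ.trace / S.m) := by
        rw [integral_add (integrable_const _) (hi.const_mul _), integral_const_mul, integral_div,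
          integral_row a (f := fun w => S.x w ⬝ᵥ S.x w)
            S.integrable_dotProduct_self.aestronglyMeasurable, trace_Φ]
        simp
    _ ≤ _ := by
        rw [boundMean]
        have h1 := S.trace_Φ_le
        have : S.Φ.trace / S.m ≤ 1 + S.b := by
          rw [div_le_iff₀ S.m_pos]; linarith
        gcongr

/-- Jensen for the convex function 1/x: a bound on the mean of D⁻¹ keeps the mean of D away from 0.
-/
lemma inv_boundMean_le_meanLev (a : Fin N) : (S.boundMean p)⁻¹ ≤ S.meanLev P a := by
  have hE := S.boundMean_pos hp
  set t := S.boundMean p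
  -- The tangent of 1/x at x = 1/t lies below the graph.
  have h1 : ∀ W, 2 * t - t ^ 2 * leverage (S.Y W) a P ≤ (leverage (S.Y W) a P)⁻¹ := by
    intro W
    have hD := h.leverage_pos (S.Y W) a hp
    rw [← one_div, le_div_iff₀ hD]
    nlinarith [sq_nonneg (t * leverage (S.Y W) a P - 1)]
  have hi := (S.memLp_leverage h hp a).integrable (by norm_num)
  have h2 : 2 * t - t ^ 2 * S.meanLev P a ≤ t := by
    calc 2 * t - t ^ 2 * S.meanLev P a = ∫ W, (2 * t - t ^ 2 * leverage (S.Y W) a P) ∂𝔾 := by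
          rw [integral_sub (integrable_const _) (hi.const_mul _), integral_const_mul, meanLev,
            integral_const_mul]
          simp
      _ ≤ _ := integral_mono ((integrable_const _).sub (hi.const_mul _))
          ((S.memLp_inv_leverage h hp a).integrable (by norm_num)) h1
      _ ≤ t := S.integral_inv_leverage_le h hp a
  rw [inv_le_iff_one_le_mul₀ hE]
  have h3 : t * 1 ≤ t * (S.meanLev P a * t) := by nlinarith
  exact le_of_mul_le_mul_left h3 hE

lemma meanLev_pos (a : Fin N) : 0 < S.meanLev P a :=
  (inv_pos.2 (S.boundMean_pos hp)).trans_le (S.inv_boundMean_le_meanLev h hp a)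

/-- The left-out resolvent is independent of the row that is left out. -/
lemma integral_mul_resOut (a : Fin N) (i j k l : ι) :
    Integrable (fun W => S.x (W a) i * S.x (W a) j * resOut (S.Y W) a P k l) 𝔾 ∧
    ∫ W, S.x (W a) i * S.x (W a) j * resOut (S.Y W) a P k l ∂𝔾 =
      S.Φ i j * expMat 𝔾 (fun W => resOut (S.Y W) a P) k l := by
  constructor
  · have hi : Integrable (fun W : Fin N → Fin d → ℝ => S.x (W a) i * S.x (W a) j) 𝔾 :=
      (measurePreserving_row a).integrable_comp_of_integrable (S.integrable_mul_apply i j)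
    refine hi.mul_bdd (c := p⁻¹) (S.integrable_resOut h hp a k l).aestronglyMeasurable
      (Eventually.of_forall fun W => ?_)
    exact (abs_apply_le_norm _ _ _).trans (h.norm_res_le hp _)
  · refine integral_row_mul a (fun w => S.x w i * S.x w j) (fun W => resOut (S.Y W) a P k l)
      fun W w => ?_
    -- Row a is overwritten by 0, so its value is irrelevant.
    have : (S.Y (Function.update W a w)).updateRow a 0 = (S.Y W).updateRow a 0 := by
      ext b i
      rcases eq_or_ne b a with rfl | hb
      · rw [Matrix.updateRow_self, Matrix.updateRow_self]
      · rw [Matrix.updateRow_ne hb, Matrix.updateRow_ne hb, S.Y_row, S.Y_row,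
          Function.update_of_ne hb]
    rw [resOut, this, resOut]

lemma expMat_resOut_mul (a : Fin N) :
    (∀ i j, Integrable (fun W => (resOut (S.Y W) a P *
      Matrix.vecMulVec (S.x (W a)) (S.x (W a))) i j) 𝔾) ∧
    expMat 𝔾 (fun W => resOut (S.Y W) a P * Matrix.vecMulVec (S.x (W a)) (S.x (W a))) =
      expMat 𝔾 (fun W => resOut (S.Y W) a P) * S.Φ := by
  have e : ∀ i j W, (resOut (S.Y W) a P * Matrix.vecMulVec (S.x (W a)) (S.x (W a))) i j =
      ∑ k, S.x (W a) k * S.x (W a) j * resOut (S.Y W) a P i k := by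
    intro i j W
    rw [Matrix.mul_apply]
    refine Finset.sum_congr rfl fun k _ => ?_
    rw [Matrix.vecMulVec_apply]; ring
  constructor
  · intro i j
    simp only [e]
    exact integrable_finsetSum _ fun k _ => (S.integral_mul_resOut h hp a k j i k).1
  · ext i j
    rw [expMat, Matrix.of_apply, Matrix.mul_apply]
    simp only [e]
    rw [integral_finsetSum _ fun k _ => (S.integral_mul_resOut h hp a k j i k).1]
    refine Finset.sum_congr rfl fun k _ => ?_
    rw [(S.integral_mul_resOut h hp a k j i k).2, mul_comm]

lemma integral_resOut_bilin (a : Fin N) (u v : ι → ℝ) :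
    Integrable (fun W => (u ⬝ᵥ resOut (S.Y W) a P *ᵥ S.x (W a)) * (S.x (W a) ⬝ᵥ v)) 𝔾 ∧
    ∫ W, (u ⬝ᵥ resOut (S.Y W) a P *ᵥ S.x (W a)) * (S.x (W a) ⬝ᵥ v) ∂𝔾 =
      u ⬝ᵥ expMat 𝔾 (fun W => resOut (S.Y W) a P) *ᵥ (S.Φ *ᵥ v) := by
  obtain ⟨h1, h2⟩ := S.expMat_resOut_mul h hp a
  have e : ∀ W, (u ⬝ᵥ resOut (S.Y W) a P *ᵥ S.x (W a)) * (S.x (W a) ⬝ᵥ v) =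
      u ⬝ᵥ (resOut (S.Y W) a P * Matrix.vecMulVec (S.x (W a)) (S.x (W a))) *ᵥ v := by
    intro W
    rw [← Matrix.mulVec_mulVec, Matrix.vecMulVec_mulVec, op_smul_eq_smul, Matrix.mulVec_smul,
      dotProduct_smul, smul_eq_mul, mul_comm]
  simp only [e]
  refine ⟨integrable_dotProduct_mulVec h1 u v, ?_⟩
  rw [← dotProduct_expMat_mulVec h1, h2, Matrix.mulVec_mulVec]

lemma integral_resOut_quad (a : Fin N) :
    Integrable (fun W => S.x (W a) ⬝ᵥ resOut (S.Y W) a P *ᵥ S.x (W a)) 𝔾 ∧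
    ∫ W, S.x (W a) ⬝ᵥ resOut (S.Y W) a P *ᵥ S.x (W a) ∂𝔾 =
      (S.Φ * expMat 𝔾 (fun W => resOut (S.Y W) a P)).trace := by
  obtain ⟨h1, h2⟩ := S.expMat_resOut_mul h hp a
  have e : ∀ W, S.x (W a) ⬝ᵥ resOut (S.Y W) a P *ᵥ S.x (W a) =
      ∑ i, (resOut (S.Y W) a P * Matrix.vecMulVec (S.x (W a)) (S.x (W a))) i i := by
    intro W
    simp only [Matrix.mul_vecMulVec, Matrix.vecMulVec_apply]
    rw [dotProduct_comm]; rfl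
  simp only [e]
  refine ⟨integrable_finsetSum _ fun i _ => h1 i i, ?_⟩
  rw [integral_finsetSum _ fun i _ => h1 i i, Matrix.trace_mul_comm, ← h2]
  rfl

/-! ### Bounds for the deterministic resolvent -/

section Deterministic

variable {B : Matrix ι ι ℝ} (hB : S.Φ = Bᵀ * B) {c : ℝ} (hc : 0 < c)
include hB hc

omit hB in
lemma norm_mul_det_le : ‖B * res P (√c • B)‖ ≤ √(c⁻¹ * p⁻¹) := by
  have h1 := h.norm_mul_res_le hp (√c • B)
  rw [Matrix.smul_mul, norm_smul, Real.norm_of_nonneg (Real.sqrt_nonneg c)] at h1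
  rw [Real.sqrt_mul (inv_nonneg.2 hc.le), Real.sqrt_inv, Real.sqrt_inv]
  rw [inv_mul_eq_div, le_div_iff₀ (Real.sqrt_pos.2 hc), mul_comm]
  exact h1

/-- ‖Φ‖ itself may be of order m. Splitting Φ = BᵀB and letting the resolvent absorb one factor B
leaves only √(tr Φ), of order √m. -/
lemma norm_Φ_mul_det_le :
    ‖S.Φ * res P (√c • B)‖ ≤ √(S.m * (1 + S.b)) * √(c⁻¹ * p⁻¹) := by
  rw [hB, Matrix.mul_assoc]
  refine (Matrix.l2_opNorm_mul _ _).trans (mul_le_mul ?_ (norm_mul_det_le h hp hc)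
    (norm_nonneg _) (Real.sqrt_nonneg _))
  rw [norm_transpose]
  refine (norm_le_sqrt_trace_gram B).trans (Real.sqrt_le_sqrt ?_)
  rw [← hB]
  exact S.trace_Φ_le

variable (hcb : c⁻¹ ≤ S.boundMean p * S.c₀⁻¹)
include hcb

/-- The second moment is ‖BK̄v‖², bounded even where Φ is large; the Lipschitz property in the row
then upgrades it to a fourth moment. -/
lemma det_row_moment (a : Fin N) {v : ι → ℝ} (hv : ‖WithLp.toLp 2 v‖ ≤ 1) :
    MemLp (fun W : Fin N → Fin d → ℝ => S.x (W a) ⬝ᵥ res P (√c • B) *ᵥ v) 4 𝔾 ∧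
    ∫ W, (S.x (W a) ⬝ᵥ res P (√c • B) *ᵥ v) ^ 4 ∂𝔾 ≤ S.boundDet p := by
  have hp' : 0 ≤ p⁻¹ := (inv_pos.2 hp).le
  set v' := res P (√c • B) *ᵥ v with hv'
  have hn : ‖WithLp.toLp 2 v'‖ ≤ p⁻¹ := by
    refine (norm_toLp_mulVec_le _ _).trans ?_
    have := mul_le_mul (h.norm_res_le hp (√c • B)) hv (norm_nonneg _) hp'
    simpa using this
  have hLip : FrobLipschitz (fun W : Fin N → Fin d → ℝ => S.x (W a) ⬝ᵥ v') (S.L * p⁻¹) := by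
    intro W W'
    rw [← sub_dotProduct]
    refine (abs_dotProduct_le _ _).trans ?_
    have h1 : √(∑ l, (W a l - W' a l) ^ 2) ≤ √(∑ a, ∑ l, (W a l - W' a l) ^ 2) :=
      Real.sqrt_le_sqrt (Finset.single_le_sum (f := fun a => ∑ l, (W a l - W' a l) ^ 2)
        (fun a _ => by positivity) (Finset.mem_univ a))
    have h2 := (S.lipschitz (W a) (W' a)).trans (mul_le_mul_of_nonneg_left h1 S.L_nonneg)
    refine (mul_le_mul h2 hn (norm_nonneg _)
      (mul_nonneg S.L_nonneg (Real.sqrt_nonneg _))).trans_eq ?_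
    ring
  have hL : 0 ≤ S.L * p⁻¹ := mul_nonneg S.L_nonneg hp'
  refine ⟨hLip.memLp hL, hLip.integral_pow_four_le hL ?_⟩
  have e : ∫ W : Fin N → Fin d → ℝ, (S.x (W a) ⬝ᵥ v') ^ 2 ∂𝔾 = v' ⬝ᵥ S.Φ *ᵥ v' := by
    rw [dotProduct_Φ_mulVec, integral_row a (f := fun w => (S.x w ⬝ᵥ v') ^ 2)]
    · simp only [sq]
    · refine (Measurable.pow_const ?_ 2).aestronglyMeasurable
      exact Finset.measurable_sum _ fun i _ => (S.measurable_apply i).mul_const _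
  rw [e, hB, dotProduct_gram, ← norm_toLp_sq, hv', Matrix.mulVec_mulVec]
  have h1 := (norm_toLp_mulVec_le (B * res P (√c • B)) v).trans
    (mul_le_mul (norm_mul_det_le h hp hc) hv (norm_nonneg _) (Real.sqrt_nonneg _))
  have h2 := pow_le_pow_left₀ (norm_nonneg _) h1 2
  rw [mul_one, Real.sq_sqrt (mul_nonneg (inv_pos.2 hc).le hp')] at h2
  exact h2.trans (mul_le_mul_of_nonneg_right hcb hp')

end Deterministic

lemma inv_ratio_le (a : Fin N) :
    ((N : ℝ) / S.m * S.meanLev P a)⁻¹ ≤ S.boundMean p * S.c₀⁻¹ := by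
  have h1 := S.inv_boundMean_le_meanLev h hp a
  have h2 : S.c₀ ≤ (N : ℝ) / S.m := by rw [le_div_iff₀ S.m_pos]; exact S.le_N
  have hE := S.boundMean_pos hp
  have h3 : S.c₀ * (S.boundMean p)⁻¹ ≤ (N : ℝ) / S.m * S.meanLev P a :=
    mul_le_mul h2 h1 (inv_pos.2 hE).le (S.c₀_pos.le.trans h2)
  have h4 := inv_anti₀ (mul_pos S.c₀_pos (inv_pos.2 hE)) h3
  rwa [mul_inv S.c₀, inv_inv, mul_comm S.c₀⁻¹] at h4

lemma ratio_pos (a : Fin N) : 0 < (N : ℝ) / S.m * S.meanLev P a :=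
  mul_pos (div_pos S.N_pos S.m_pos) (S.meanLev_pos h hp a)

lemma bounds_nonneg : 0 ≤ S.boundLin p ∧ 0 ≤ S.boundInv p ∧ 0 ≤ S.boundDet p ∧ 0 ≤ S.boundLev p ∧
    0 ≤ S.boundOut p ∧ 0 ≤ S.boundRes p := by
  have := concConst_nonneg
  have := S.b_nonneg
  have := S.c₀_pos
  have := S.C₀_pos
  have := S.L_nonneg
  have := S.boundMean_pos hp
  have h1 : 0 ≤ S.boundLin p := by unfold boundLin; positivity
  have h2 : 0 ≤ S.boundInv p := by unfold boundInv; positivity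
  have h3 : 0 ≤ S.boundDet p := by unfold boundDet; positivity
  have h4 : 0 ≤ S.boundLev p := by unfold boundLev; positivity
  have h5 : 0 ≤ S.boundOut p := by unfold boundOut; positivity
  exact ⟨h1, h2, h3, h4, h5, by unfold boundRes; positivity⟩

/-- The expected resolvent is close to the deterministic resolvent in operator norm. -/
theorem norm_expMat_res_sub_le (a : Fin N) {B : Matrix ι ι ℝ} (hB : S.Φ = Bᵀ * B) :
    ‖expMat 𝔾 (fun W => res P (S.Y W)) -
      res P (√((N : ℝ) / S.m * S.meanLev P a) • B)‖ ≤ S.boundRes p * (√S.m)⁻¹ := by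
  -- The comparison uses the mean leverage rather than the fixed point; this is the choice for which
  -- the main terms cancel.
  set c := (N : ℝ) / S.m * S.meanLev P a with hc_def
  have hc : 0 < c := S.ratio_pos h hp a
  have hcb : c⁻¹ ≤ S.boundMean p * S.c₀⁻¹ := S.inv_ratio_le h hp a
  set D := S.meanLev P a with hD
  obtain ⟨hn1, hn2, hn3, hn4, hn5, hn6⟩ := S.bounds_nonneg h hp
  refine opNorm_le_of_bilin _ (mul_nonneg hn6 (inv_nonneg.2 S.sqrt_m_pos.le)) fun u v hu hv => ?_
  set Kb := res P (√c • B) with hKb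
  set EK := expMat 𝔾 (fun W => res P (S.Y W)) with hEK
  set EO := expMat 𝔾 (fun W => resOut (S.Y W) a P) with hEO
  obtain ⟨hBm, hBb⟩ := S.det_row_moment h hp hB hc hcb a hv
  rw [← hKb] at hBm hBb
  have hiK := S.integrable_res h hp
  -- the resolvent identity
  have hid : ∀ W, u ⬝ᵥ res P (S.Y W) *ᵥ v - u ⬝ᵥ Kb *ᵥ v =
      c * (u ⬝ᵥ res P (S.Y W) *ᵥ (S.Φ *ᵥ (Kb *ᵥ v))) -
        S.m⁻¹ * ∑ a', (u ⬝ᵥ res P (S.Y W) *ᵥ S.x (W a')) * (S.x (W a') ⬝ᵥ Kb *ᵥ v) := by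
    intro W
    have e1 : res P (S.Y W) - Kb =
        res P (S.Y W) * (c • S.Φ - (S.Y W)ᵀ * S.Y W) * Kb := by
      have : c • S.Φ - (S.Y W)ᵀ * S.Y W =
          (P + (√c • B)ᵀ * (√c • B)) - (P + (S.Y W)ᵀ * S.Y W) := by
        rw [gram_sqrt_smul_eq hB hc.le]; abel
      rw [this, Matrix.mul_sub, Matrix.sub_mul, Matrix.mul_assoc, h.mul_res hp, Matrix.mul_one,
        h.res_mul hp, Matrix.one_mul]
    have e2 : ∀ a', (u ⬝ᵥ res P (S.Y W) *ᵥ S.x (W a')) * (S.x (W a') ⬝ᵥ Kb *ᵥ v) =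
        S.m * ((u ᵥ* (res P (S.Y W) * (S.Y W)ᵀ)) a' * (S.Y W *ᵥ (Kb *ᵥ v)) a') := by
      intro a'
      have e3 : (u ᵥ* (res P (S.Y W) * (S.Y W)ᵀ)) a' = u ⬝ᵥ res P (S.Y W) *ᵥ S.Y W a' := by
        rw [← Matrix.vecMul_vecMul, Matrix.vecMul_transpose, Matrix.dotProduct_mulVec,
          dotProduct_comm]
        rfl
      have e4 : (S.Y W *ᵥ (Kb *ᵥ v)) a' = S.Y W a' ⬝ᵥ Kb *ᵥ v := rfl
      rw [e3, e4, S.x_eq, Matrix.mulVec_smul, dotProduct_smul, smul_dotProduct, smul_eq_mul,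
        smul_eq_mul]
      have := Real.mul_self_sqrt S.m_pos.le
      linear_combination (u ⬝ᵥ res P (S.Y W) *ᵥ S.Y W a') * (S.Y W a' ⬝ᵥ Kb *ᵥ v) * this
    rw [← dotProduct_sub, ← Matrix.sub_mulVec, e1]
    simp only [e2]
    rw [← Finset.mul_sum, inv_mul_cancel_left₀ S.m_pos.ne', ← dotProduct,
      ← Matrix.dotProduct_mulVec]
    simp only [Matrix.mul_sub, Matrix.sub_mul, Matrix.sub_mulVec, dotProduct_sub,
      Matrix.mulVec_mulVec, Matrix.mul_smul, Matrix.smul_mul, Matrix.smul_mulVec, dotProduct_smul,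
      smul_eq_mul, Matrix.mul_assoc]
  have hiAB : ∀ a', Integrable (fun W => (u ⬝ᵥ res P (S.Y W) *ᵥ S.x (W a')) *
      (S.x (W a') ⬝ᵥ Kb *ᵥ v)) 𝔾 := by
    intro a'
    have h1 := integrable_mul₄ (S.memLp_lin h hp a' hu) (S.det_row_moment h hp hB hc hcb a' hv).1
      (memLp_const 1) (memLp_const 1)
    simpa using h1
  -- expectation of the resolvent identity
  have hexp : u ⬝ᵥ (EK - Kb) *ᵥ v = c * (u ⬝ᵥ EK *ᵥ (S.Φ *ᵥ (Kb *ᵥ v))) -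
      (N : ℝ) / S.m * ∫ W, (u ⬝ᵥ res P (S.Y W) *ᵥ S.x (W a)) *
        (S.x (W a) ⬝ᵥ Kb *ᵥ v) ∂𝔾 := by
    rw [Matrix.sub_mulVec, dotProduct_sub, hEK, dotProduct_expMat_mulVec hiK,
      dotProduct_expMat_mulVec hiK]
    have e1 : (∫ W, u ⬝ᵥ res P (S.Y W) *ᵥ v ∂𝔾) - u ⬝ᵥ Kb *ᵥ v =
        ∫ W, (u ⬝ᵥ res P (S.Y W) *ᵥ v - u ⬝ᵥ Kb *ᵥ v) ∂𝔾 := by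
      rw [integral_sub (integrable_dotProduct_mulVec hiK u v) (integrable_const _)]
      simp
    rw [e1]
    simp only [hid]
    rw [integral_sub ((integrable_dotProduct_mulVec hiK _ _).const_mul _)
      ((integrable_finsetSum _ fun a' _ => hiAB a').const_mul _), integral_const_mul,
      integral_const_mul, integral_finsetSum _ fun a' _ => hiAB a',
      Finset.sum_congr rfl fun a' _ => S.integral_exchange (P := P)
        (fun T w => (u ⬝ᵥ T *ᵥ S.x w) * (S.x w ⬝ᵥ Kb *ᵥ v)) a a']
    simp only [Finset.sum_const, Finset.card_univ, Fintype.card_fin, nsmul_eq_mul]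
    ring
  -- replacing the leverage by its mean
  have hfl : ∫ W, (u ⬝ᵥ res P (S.Y W) *ᵥ S.x (W a)) * (S.x (W a) ⬝ᵥ Kb *ᵥ v) ∂𝔾 =
      D * (u ⬝ᵥ EO *ᵥ (S.Φ *ᵥ (Kb *ᵥ v))) + (√S.m)⁻¹ * ∫ W, S.fluct P a W *
        (leverage (S.Y W) a P)⁻¹ * (u ⬝ᵥ res P (S.Y W) *ᵥ S.x (W a)) *
        (S.x (W a) ⬝ᵥ Kb *ᵥ v) ∂𝔾 := by
    obtain ⟨g1, g2⟩ := S.integral_resOut_bilin h hp a u (Kb *ᵥ v)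
    have g3 := integrable_mul₄ (S.memLp_fluct h hp a) (S.memLp_inv_leverage h hp a)
      (S.memLp_lin h hp a hu) hBm
    rw [hEO, ← g2, ← integral_const_mul, ← integral_const_mul,
      ← integral_add (g1.const_mul _) (g3.const_mul _)]
    refine integral_congr_ae (Eventually.of_forall fun W => ?_)
    have hl := (h.leverage_pos (S.Y W) a hp).ne'
    have e3 : u ⬝ᵥ res P (S.Y W) *ᵥ S.x (W a) =
        leverage (S.Y W) a P * (u ⬝ᵥ resOut (S.Y W) a P *ᵥ S.x (W a)) := by
      rw [S.x_eq, Matrix.mulVec_smul, Matrix.mulVec_smul, dotProduct_smul, dotProduct_smul,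
        smul_eq_mul, smul_eq_mul, h.dotProduct_res_row (S.Y W) a hp]
      ring
    simp only [fluct]
    rw [e3]
    have hm := S.sqrt_m_pos.ne'
    field_simp
    ring
  -- The leave-one-out error 1/m outweighs the order √m of ΦK̄.
  have hb1 : |u ⬝ᵥ (EO - EK) *ᵥ (S.Φ *ᵥ (Kb *ᵥ v))| ≤
      S.boundOut p * S.m⁻¹ * (√(S.m * (1 + S.b)) * √(S.boundMean p * S.c₀⁻¹ * p⁻¹)) := by
    refine (abs_dotProduct_mulVec_le _ _ _).trans ?_
    have g1 : ‖WithLp.toLp 2 (S.Φ *ᵥ (Kb *ᵥ v))‖ ≤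
        √(S.m * (1 + S.b)) * √(S.boundMean p * S.c₀⁻¹ * p⁻¹) := by
      rw [Matrix.mulVec_mulVec]
      have g2 := (norm_toLp_mulVec_le (S.Φ * Kb) v).trans (mul_le_mul
        (S.norm_Φ_mul_det_le h hp hB hc) hv (norm_nonneg _) (by positivity))
      rw [mul_one] at g2
      refine g2.trans ?_
      have := inv_pos.2 hp
      gcongr
    have g3 := mul_le_mul hu g1 (norm_nonneg _) zero_le_one
    rw [one_mul] at g3
    exact mul_le_mul (S.norm_expMat_resOut_sub_le h hp a) g3 (by positivity)
      (mul_nonneg hn5 (inv_nonneg.2 S.m_pos.le))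
  have hb2 := abs_integral_mul₄_le (S.memLp_fluct h hp a) (S.memLp_inv_leverage h hp a)
      (S.memLp_lin h hp a hu) hBm
  have k1 := S.integral_fluct_pow_four_le h hp a
  have k2 := S.integral_inv_leverage_pow_four_le h hp a
  have k3 := S.integral_lin_pow_four_le h hp a hu
  set I := ∫ W, S.fluct P a W * (leverage (S.Y W) a P)⁻¹ *
    (u ⬝ᵥ res P (S.Y W) *ᵥ S.x (W a)) * (S.x (W a) ⬝ᵥ Kb *ᵥ v) ∂𝔾
  have hb3 : |I| ≤ (S.boundLev p + S.boundInv p + S.boundLin p + S.boundDet p) / 4 := by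
    linarith
  -- Because c = (N/m)E[D], what survives is the change from E[K] to E[K₋] and the fluctuation of
  -- the leverage.
  have hfin : u ⬝ᵥ (EK - Kb) *ᵥ v = -((N : ℝ) / S.m * (D *
      (u ⬝ᵥ (EO - EK) *ᵥ (S.Φ *ᵥ (Kb *ᵥ v))) + (√S.m)⁻¹ * I)) := by
    rw [hexp, hfl, Matrix.sub_mulVec, dotProduct_sub, hc_def]
    ring
  have hD0 : 0 < D := S.meanLev_pos h hp a
  have hD1 : D ≤ 1 := S.meanLev_le_one h hp a
  have hr0 : 0 ≤ (N : ℝ) / S.m := (div_pos S.N_pos S.m_pos).le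
  have hr1 : (N : ℝ) / S.m ≤ S.C₀ := by rw [div_le_iff₀ S.m_pos]; exact S.N_le
  have hs : S.m⁻¹ * √(S.m * (1 + S.b)) = (√S.m)⁻¹ * √(1 + S.b) := by
    rw [Real.sqrt_mul S.m_pos.le, ← S.inv_sqrt_m_sq]
    have := S.sqrt_m_pos.ne'
    field_simp
  set J := u ⬝ᵥ (EO - EK) *ᵥ (S.Φ *ᵥ (Kb *ᵥ v))
  rw [hfin, abs_neg, abs_mul, abs_of_nonneg hr0]
  have q1 : |D * J + (√S.m)⁻¹ * I| ≤ |J| + (√S.m)⁻¹ * |I| := by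
    refine (abs_add_le _ _).trans ?_
    rw [abs_mul, abs_mul, abs_of_pos hD0, abs_of_pos (inv_pos.2 S.sqrt_m_pos)]
    have := mul_le_of_le_one_left (abs_nonneg J) hD1
    linarith
  have hsm := inv_pos.2 S.sqrt_m_pos
  calc _ ≤ S.C₀ * (S.boundOut p * S.m⁻¹ * (√(S.m * (1 + S.b)) *
        √(S.boundMean p * S.c₀⁻¹ * p⁻¹)) + (√S.m)⁻¹ *
        ((S.boundLev p + S.boundInv p + S.boundLin p + S.boundDet p) / 4)) := by
        refine mul_le_mul hr1 (q1.trans (add_le_add hb1 ?_)) (abs_nonneg _) S.C₀_pos.le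
        gcongr
    _ = _ := by
        rw [boundRes]
        linear_combination S.C₀ * S.boundOut p * √(S.boundMean p * S.c₀⁻¹ * p⁻¹) * hs

/-- The mean leverage nearly solves the fixed-point equation. -/
theorem abs_one_sub_meanLev_mul_le (a : Fin N) {B : Matrix ι ι ℝ} (hB : S.Φ = Bᵀ * B) :
    |1 - S.meanLev P a * (1 + S.m⁻¹ *
      (S.Φ * res P (√((N : ℝ) / S.m * S.meanLev P a) • B)).trace)| ≤
      S.boundFix p * (√S.m)⁻¹ := by
  have hmain := S.norm_expMat_res_sub_le h hp a hB
  have hout := S.norm_expMat_resOut_sub_le h hp a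
  obtain ⟨hn1, hn2, hn3, hn4, hn5, hn6⟩ := S.bounds_nonneg h hp
  set Kb := res P (√((N : ℝ) / S.m * S.meanLev P a) • B)
  set EK := expMat 𝔾 (fun W => res P (S.Y W))
  set EO := expMat 𝔾 (fun W => resOut (S.Y W) a P) with hEO
  set D := S.meanLev P a with hD
  have hD0 : 0 < D := S.meanLev_pos h hp a
  have hD1 : D ≤ 1 := S.meanLev_le_one h hp a
  obtain ⟨g1, g2⟩ := S.integral_resOut_quad h hp a
  -- √m(D - E[D])D⁻¹ = √m(1 - E[D]·D⁻¹), with D⁻¹ expressed through K₋.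
  have e1 : ∀ W, S.fluct P a W * (leverage (S.Y W) a P)⁻¹ * 1 * 1 =
      √S.m * (1 - D * (1 + S.m⁻¹ * (S.x (W a) ⬝ᵥ resOut (S.Y W) a P *ᵥ S.x (W a)))) := by
    intro W
    have e2 : (leverage (S.Y W) a P)⁻¹ =
        1 + S.m⁻¹ * (S.x (W a) ⬝ᵥ resOut (S.Y W) a P *ᵥ S.x (W a)) := by
      rw [h.inv_leverage (S.Y W) a hp, S.Y_row, Matrix.mulVec_smul, dotProduct_smul,
        smul_dotProduct, smul_eq_mul, smul_eq_mul, ← mul_assoc, S.inv_sqrt_m_sq]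
    rw [← e2, fluct, ← hD]
    have hl := (h.leverage_pos (S.Y W) a hp).ne'
    field_simp
  have hb := abs_integral_mul₄_le (S.memLp_fluct h hp a) (S.memLp_inv_leverage h hp a)
    (memLp_const (1 : ℝ)) (memLp_const (1 : ℝ))
  simp only [e1] at hb
  have e3 : ∫ W, √S.m * (1 - D * (1 + S.m⁻¹ * (S.x (W a) ⬝ᵥ resOut (S.Y W) a P *ᵥ
      S.x (W a)))) ∂𝔾 = √S.m * (1 - D * (1 + S.m⁻¹ * (S.Φ * EO).trace)) := by
    have i1 := g1.const_mul S.m⁻¹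
    have i2 : Integrable (fun W => 1 + S.m⁻¹ * (S.x (W a) ⬝ᵥ resOut (S.Y W) a P *ᵥ
        S.x (W a))) 𝔾 := (integrable_const 1).add i1
    rw [integral_const_mul, integral_sub (integrable_const _) (i2.const_mul D),
      integral_const_mul, integral_add (integrable_const _) i1, integral_const_mul, g2,
      ← hEO]
    simp
  rw [e3, abs_mul, abs_of_pos S.sqrt_m_pos] at hb
  have k1 := S.integral_fluct_pow_four_le h hp a
  have k2 := S.integral_inv_leverage_pow_four_le h hp a
  simp only [one_pow, integral_const, probReal_univ, smul_eq_mul, mul_one] at hb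
  have hb' : |1 - D * (1 + S.m⁻¹ * (S.Φ * EO).trace)| ≤
      (S.boundLev p + S.boundInv p + 1 + 1) / 4 * (√S.m)⁻¹ := by
    rw [← div_eq_mul_inv, le_div_iff₀ S.sqrt_m_pos]
    linarith
  have hm1 : S.m⁻¹ ≤ (√S.m)⁻¹ := by
    refine inv_anti₀ S.sqrt_m_pos ?_
    exact Real.sqrt_le_self_iff.2 (Or.inr S.one_le_m)
  have htr : |S.m⁻¹ * (S.Φ * EO).trace - S.m⁻¹ * (S.Φ * Kb).trace| ≤
      (1 + S.b) * (S.boundOut p + S.boundRes p) * (√S.m)⁻¹ := by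
    rw [← mul_sub, ← Matrix.trace_sub, ← Matrix.mul_sub, abs_mul, abs_of_pos (inv_pos.2 S.m_pos)]
    -- The trace of Φ is at most of order m, so after division by m the operator norm error passes
    -- to the trace without loss.
    have t1 := abs_trace_gram_mul_le B (EO - Kb)
    rw [← hB] at t1
    have t2 : ‖EO - Kb‖ ≤ (S.boundOut p + S.boundRes p) * (√S.m)⁻¹ := by
      have : EO - Kb = (EO - EK) + (EK - Kb) := by abel
      rw [this, add_mul]
      refine (norm_add_le _ _).trans (add_le_add (hout.trans ?_) hmain)
      gcongr
    have t3 := t1.trans (mul_le_mul S.trace_Φ_le t2 (norm_nonneg _)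
      (mul_nonneg S.m_pos.le (by linarith [S.b_nonneg])))
    have := S.m_pos
    rw [inv_mul_le_iff₀ S.m_pos]
    linarith
  have hfin : 1 - D * (1 + S.m⁻¹ * (S.Φ * Kb).trace) =
      (1 - D * (1 + S.m⁻¹ * (S.Φ * EO).trace)) +
        D * (S.m⁻¹ * (S.Φ * EO).trace - S.m⁻¹ * (S.Φ * Kb).trace) := by ring
  rw [hfin, boundFix, add_mul]
  refine (abs_add_le _ _).trans (add_le_add hb' ?_)
  rw [abs_mul, abs_of_pos hD0]
  exact (mul_le_of_le_one_left (abs_nonneg _) hD1).trans htr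

end SampleModel

/-! ### The scalar equation 1 - 1/t = g(λt) -/

section ScalarFixedPoint

/-- Solutions of the fixed-point equation in the variable `t = 1 + δ`. -/
lemma fixed_point_unique {g : ℝ → ℝ} (hg : AntitoneOn g (Set.Ioi 0)) {lam t t' : ℝ} (hl : 0 < lam)
    (ht : 0 < t) (ht' : 0 < t') (h : 1 - t⁻¹ = g (lam * t)) (h' : 1 - t'⁻¹ = g (lam * t')) :
    t = t' := by
  wlog hlt : t < t' generalizing t t'
  · rcases lt_trichotomy t t' with h1 | h1 | h1
    · exact this ht ht' h h' h1
    · exact h1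
    · exact (this ht' ht h' h h1).symm
  exfalso
  have h1 := hg (mul_pos hl ht) (mul_pos hl ht') (mul_le_mul_of_nonneg_left hlt.le hl.le)
  have h2 := inv_strictAnti₀ ht hlt
  linarith

/-- Intermediate value theorem from t = 1, where the difference of the sides is -g(λ) ≤ 0, to large
t, where it approaches 1. -/
lemma exists_fixed_point {g : ℝ → ℝ} (hc : ContinuousOn g (Set.Ioi 0))
    (hg0 : ∀ s, 0 < s → 0 ≤ g s) (hlim : Tendsto g atTop (𝓝 0)) {lam : ℝ} (hl : 0 < lam) :
    ∃ t, 1 ≤ t ∧ 1 - t⁻¹ = g (lam * t) := by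
  have hcont : ContinuousOn (fun t => 1 - t⁻¹ - g (lam * t)) (Set.Ioi 0) := by
    refine (continuousOn_const.sub (continuousOn_id.inv₀ fun t ht => ne_of_gt ht)).sub ?_
    exact hc.comp (by fun_prop) fun t ht => mul_pos hl ht
  have htop : Tendsto (fun t => 1 - t⁻¹ - g (lam * t)) atTop (𝓝 (1 - 0 - 0)) :=
    (tendsto_const_nhds.sub tendsto_inv_atTop_zero).sub
      (hlim.comp (tendsto_id.const_mul_atTop hl))
  have h1 : ∀ᶠ t in atTop, 0 < 1 - t⁻¹ - g (lam * t) := by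
    refine htop.eventually (lt_mem_nhds ?_)
    norm_num
  obtain ⟨T, hT, hT1⟩ := (h1.and (eventually_ge_atTop 1)).exists
  have h2 := intermediate_value_Icc hT1
    (hcont.mono fun t ht => zero_lt_one.trans_le ht.1)
  have h3 : (0 : ℝ) ∈ Set.Icc (1 - 1⁻¹ - g (lam * 1)) (1 - T⁻¹ - g (lam * T)) := by
    refine ⟨?_, hT.le⟩
    have := hg0 (lam * 1) (by linarith)
    norm_num at this ⊢
    exact this
  obtain ⟨t, ht, ht0⟩ := h2 h3
  simp only at ht0
  exact ⟨t, ht.1, by linarith⟩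

/-- If t ≤ t', then λt < λ't', so the right side drops strictly while the left side does not. -/
lemma fixed_point_strictAnti {g : ℝ → ℝ} (hg : StrictAntiOn g (Set.Ioi 0)) {lam lam' t t' : ℝ}
    (hl : 0 < lam) (hll : lam < lam') (ht : 0 < t) (ht' : 0 < t')
    (h : 1 - t⁻¹ = g (lam * t)) (h' : 1 - t'⁻¹ = g (lam' * t')) : t' < t := by
  by_contra hn
  have hle := not_lt.1 hn
  have h1 := hg (mul_pos hl ht) (mul_pos (hl.trans hll) ht')
    (mul_lt_mul hll hle ht (hl.trans hll).le)
  have h2 := inv_anti₀ ht hle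
  linarith

/-- `|D - 1/t|` is controlled by the residual of `D` in the fixed-point equation. -/
lemma fixed_point_stable {g : ℝ → ℝ} (hg : AntitoneOn g (Set.Ioi 0)) {lam t D : ℝ} (hl : 0 < lam)
    (ht : 0 < t) (hD : 0 < D) (h : 1 - t⁻¹ = g (lam * t)) :
    |D - t⁻¹| ≤ |1 - D - g (lam * D⁻¹)| := by
  have hD' := inv_pos.2 hD
  have ht' := inv_pos.2 ht
  -- Moving away from the solution changes the two sides in opposite directions, so the changes add
  -- up in the residual.
  rcases le_total D t⁻¹ with hle | hle
  · have h1 : t ≤ D⁻¹ := by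
      rw [le_inv_comm₀ ht hD]; exact hle
    have h2 := hg (mul_pos hl ht) (mul_pos hl hD') (mul_le_mul_of_nonneg_left h1 hl.le)
    rw [abs_of_nonpos (by linarith)]
    exact le_trans (by linarith) (le_abs_self _)
  · have h1 : D⁻¹ ≤ t := by
      rw [inv_le_comm₀ hD ht]; exact hle
    have h2 := hg (mul_pos hl hD') (mul_pos hl ht) (mul_le_mul_of_nonneg_left h1 hl.le)
    rw [abs_of_nonneg (by linarith)]
    exact le_trans (by linarith) (neg_abs_le _ |> neg_le.1)

lemma tendsto_sub_one_of_fixed_point {α : Type*} {l : Filter α} {t v : α → ℝ}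
    (h : ∀ᶠ i in l, 1 ≤ t i ∧ 1 - (t i)⁻¹ = v i) (hv : Tendsto v l (𝓝 0)) :
    Tendsto (fun i => t i - 1) l (𝓝 0) := by
  have h1 : Tendsto (fun i => (1 - v i)⁻¹ - 1) l (𝓝 ((1 - 0)⁻¹ - 1)) :=
    ((tendsto_const_nhds.sub hv).inv₀ (by norm_num)).sub_const 1
  rw [sub_zero, inv_one, sub_self] at h1
  refine h1.congr' (h.mono fun i hi => ?_)
  rw [← hi.2, sub_sub_cancel, inv_inv]

end ScalarFixedPoint

/-! ### Monotonicity, limits and continuity of the trace function -/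

section MatrixFixedPoint

variable {ι : Type*} [Fintype ι] [DecidableEq ι] {A : Matrix ι ι ℝ} {ξ K : ℝ}

lemma Coercive.smul {P : Matrix ι ι ℝ} {p s : ℝ} (h : Coercive P p) (hs : 0 ≤ s) :
    Coercive (s • P) (s * p) := by
  intro v
  rw [Matrix.smul_mulVec, dotProduct_smul, smul_eq_mul, mul_assoc]
  exact mul_le_mul_of_nonneg_left (h v) hs

lemma Coercive.mul_inv_self (h : Coercive A ξ) (hξ : 0 < ξ) : A * A⁻¹ = 1 :=
  Matrix.mul_nonsing_inv _ ((Matrix.isUnit_iff_isUnit_det _).1 (h.isUnit hξ))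

lemma Coercive.inv_mul_self (h : Coercive A ξ) (hξ : 0 < ξ) : A⁻¹ * A = 1 :=
  Matrix.nonsing_inv_mul _ ((Matrix.isUnit_iff_isUnit_det _).1 (h.isUnit hξ))

/-- With w = A⁻¹v the form equals wᵀAw. -/
lemma Coercive.inv_form_pos (h : Coercive A ξ) (hξ : 0 < ξ) {v : ι → ℝ} (hv : v ≠ 0) :
    0 < v ⬝ᵥ A⁻¹ *ᵥ v := by
  have e : A *ᵥ (A⁻¹ *ᵥ v) = v := by
    rw [Matrix.mulVec_mulVec, h.mul_inv_self hξ, Matrix.one_mulVec]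
  have h1 := h (A⁻¹ *ᵥ v)
  rw [e, dotProduct_comm (A⁻¹ *ᵥ v) v] at h1
  refine lt_of_lt_of_le (mul_pos hξ ?_) h1
  refine lt_of_le_of_ne (dotProduct_self_nonneg' _) fun h0 => hv ?_
  rw [← e, dotProduct_self_eq_zero.1 h0.symm, Matrix.mulVec_zero]

lemma Coercive.inv (h : Coercive A ξ) (hξ : 0 < ξ) (hK : 0 < K) (hA : ‖A‖ ≤ K) :
    Coercive A⁻¹ (ξ * (K ^ 2)⁻¹) := by
  intro v
  have e : A *ᵥ (A⁻¹ *ᵥ v) = v := by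
    rw [Matrix.mulVec_mulVec, h.mul_inv_self hξ, Matrix.one_mulVec]
  have h1 := h (A⁻¹ *ᵥ v)
  rw [e, dotProduct_comm (A⁻¹ *ᵥ v) v] at h1
  refine le_trans ?_ h1
  rw [mul_assoc]
  refine mul_le_mul_of_nonneg_left ?_ hξ.le
  rw [inv_mul_le_iff₀ (by positivity), ← norm_toLp_sq, ← norm_toLp_sq, ← mul_pow]
  refine pow_le_pow_left₀ (norm_nonneg _) ?_ 2
  have h2 := norm_toLp_mulVec_le A (A⁻¹ *ᵥ v)
  rw [e] at h2
  exact h2.trans (mul_le_mul_of_nonneg_right hA (norm_nonneg _))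

lemma Coercive.norm_inv_le (h : Coercive A ξ) (hξ : 0 < ξ) : ‖A⁻¹‖ ≤ ξ⁻¹ := by
  have := h.norm_res_le hξ (0 : Matrix ι ι ℝ)
  simpa [res] using this

/-- The function `s ↦ tr(Φ (s A⁻¹ + r Φ)⁻¹)`. -/
def traceFun (A Φ : Matrix ι ι ℝ) (r s : ℝ) : ℝ := (Φ * (s • A⁻¹ + r • Φ)⁻¹).trace

lemma trace_gram_mul {κ : Type*} [Fintype κ] [DecidableEq κ] (B : Matrix κ ι ℝ)
    (T : Matrix ι ι ℝ) : ((Bᵀ * B) * T).trace = ∑ a, B a ⬝ᵥ T *ᵥ B a := by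
  rw [Matrix.mul_assoc, Matrix.trace_mul_comm, Matrix.trace]
  refine Finset.sum_congr rfl fun a _ => ?_
  rw [Matrix.diag_apply, Matrix.mul_apply', Matrix.dotProduct_mulVec]
  rfl

lemma trace_gram_mul_nonneg {B T : Matrix ι ι ℝ} (hT : ∀ v, v ≠ 0 → 0 < v ⬝ᵥ T *ᵥ v) :
    0 ≤ ((Bᵀ * B) * T).trace := by
  rw [trace_gram_mul]
  refine Finset.sum_nonneg fun a _ => ?_
  rcases eq_or_ne (B a) 0 with h0 | h0
  · simp [h0]
  · exact (hT _ h0).le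

lemma trace_gram_mul_pos {B T : Matrix ι ι ℝ} (hT : ∀ v, v ≠ 0 → 0 < v ⬝ᵥ T *ᵥ v)
    (hB : Bᵀ * B ≠ 0) : 0 < ((Bᵀ * B) * T).trace := by
  rw [trace_gram_mul]
  have hex : ∃ a, B a ≠ 0 := by
    by_contra hn
    push Not at hn
    refine hB ?_
    have : B = 0 := funext hn
    rw [this, Matrix.mul_zero]
  obtain ⟨a, ha⟩ := hex
  refine Finset.sum_pos' (fun a _ => ?_) ⟨a, Finset.mem_univ _, hT _ ha⟩
  rcases eq_or_ne (B a) 0 with h0 | h0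
  · simp [h0]
  · exact (hT _ h0).le

variable {B Φ : Matrix ι ι ℝ} {r s s' : ℝ}

lemma res_sqrt_smul_eq (P : Matrix ι ι ℝ) (hB : Φ = Bᵀ * B) (hr : 0 ≤ r) :
    res P (√r • B) = (P + r • Φ)⁻¹ := by
  rw [res, gram_sqrt_smul_eq hB hr]

lemma exists_inv_coercive (h : Coercive A ξ) (hξ : 0 < ξ) : ∃ q, 0 < q ∧ Coercive A⁻¹ q :=
  ⟨_, by positivity, h.inv hξ (by positivity : 0 < ‖A‖ + 1) (by linarith)⟩

lemma coercive_add_gram (h : Coercive A ξ) (hξ : 0 < ξ) (hB : Φ = Bᵀ * B) (hr : 0 ≤ r)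
    (hs : 0 < s) : ∃ q, 0 < q ∧ Coercive (s • A⁻¹ + r • Φ) q := by
  obtain ⟨q, hq, hAq⟩ := exists_inv_coercive h hξ
  refine ⟨s * q, mul_pos hs hq, ?_⟩
  rw [← gram_sqrt_smul_eq hB hr]
  exact (hAq.smul hs.le).add_gram _

/-- With T and T' the matrices at s and s', T⁻¹ - T'⁻¹ = (s' - s)(T'AT)⁻¹. Here T'AT = ss'A⁻¹ +
r(s+s')Φ + r²ΦAΦ is coercive, so its inverse has a positive quadratic form and the sign of the
difference is that of s' - s. -/
lemma traceFun_sub (h : Coercive A ξ) (hξ : 0 < ξ) (hB : Φ = Bᵀ * B) (hr : 0 ≤ r)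
    (hs : 0 < s) (hs' : 0 < s') : ∃ M : Matrix ι ι ℝ, (∃ q, 0 < q ∧ Coercive M q) ∧
      traceFun A Φ r s - traceFun A Φ r s' = (s' - s) * (Φ * M⁻¹).trace := by
  obtain ⟨q, hq, hM⟩ := coercive_add_gram h hξ hB hr hs
  obtain ⟨q', hq', hM'⟩ := coercive_add_gram h hξ hB hr hs'
  set T := s • A⁻¹ + r • Φ with hT
  set T' := s' • A⁻¹ + r • Φ with hT'
  refine ⟨T' * A * T, ?_, ?_⟩
  · have e : T' * A * T = (s * s') • A⁻¹ + (r * (s + s')) • Φ + (r ^ 2) • (Φ * A * Φ) := by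
      have h1 := h.mul_inv_self hξ
      have h2 := h.inv_mul_self hξ
      rw [hT, hT', Matrix.add_mul, Matrix.smul_mul, h2, Matrix.mul_add, Matrix.add_mul,
        Matrix.add_mul]
      simp only [Matrix.smul_mul, Matrix.mul_smul, Matrix.one_mul, Matrix.mul_assoc, h1,
        Matrix.mul_one, smul_smul]
      rw [← sub_eq_zero]
      module
    obtain ⟨q0, hq0, hA0⟩ := exists_inv_coercive h hξ
    refine ⟨s * s' * q0, by positivity, fun v => ?_⟩
    rw [e, Matrix.add_mulVec, Matrix.add_mulVec, dotProduct_add, dotProduct_add,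
      Matrix.smul_mulVec, Matrix.smul_mulVec, Matrix.smul_mulVec, dotProduct_smul,
      dotProduct_smul, dotProduct_smul, smul_eq_mul, smul_eq_mul, smul_eq_mul]
    have h1 := mul_le_mul_of_nonneg_left (hA0 v) (mul_pos hs hs').le
    have h2 : 0 ≤ v ⬝ᵥ Φ *ᵥ v := by
      rw [hB, dotProduct_gram]; exact dotProduct_self_nonneg' _
    have h3 : 0 ≤ v ⬝ᵥ (Φ * A * Φ) *ᵥ v := by
      have hsym : Φᵀ = Φ := by rw [hB, Matrix.transpose_mul, Matrix.transpose_transpose]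
      have e3 : v ⬝ᵥ (Φ * A * Φ) *ᵥ v = (Φ *ᵥ v) ⬝ᵥ A *ᵥ (Φ *ᵥ v) := by
        rw [← Matrix.mulVec_mulVec, ← Matrix.mulVec_mulVec, Matrix.dotProduct_mulVec,
          ← Matrix.mulVec_transpose, hsym]
      rw [e3]
      exact le_trans (mul_nonneg hξ.le (dotProduct_self_nonneg' _)) (h (Φ *ᵥ v))
    have h4 : 0 ≤ r * (s + s') * (v ⬝ᵥ Φ *ᵥ v) := by positivity
    have h5 : 0 ≤ r ^ 2 * (v ⬝ᵥ (Φ * A * Φ) *ᵥ v) := by positivity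
    linarith
  · have e : T⁻¹ - T'⁻¹ = (s' - s) • (T' * A * T)⁻¹ := by
      rw [Matrix.mul_inv_rev, Matrix.mul_inv_rev]
      have h1 : (s' - s) • A⁻¹ = T' - T := by rw [hT, hT']; module
      rw [← Matrix.mul_smul, ← Matrix.smul_mul, h1, Matrix.sub_mul, Matrix.mul_sub,
        hM'.mul_inv_self hq', Matrix.mul_one, ← Matrix.mul_assoc, hM.inv_mul_self hq,
        Matrix.one_mul]
    rw [traceFun, traceFun, ← hT, ← hT', ← Matrix.trace_sub, ← Matrix.mul_sub, e, Matrix.mul_smul,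
      Matrix.trace_smul, smul_eq_mul]

lemma traceFun_antitoneOn (h : Coercive A ξ) (hξ : 0 < ξ) (hB : Φ = Bᵀ * B) (hr : 0 ≤ r) :
    AntitoneOn (traceFun A Φ r) (Set.Ioi 0) := by
  intro s hs s' hs' hss
  obtain ⟨M, ⟨q, hq, hM⟩, e⟩ := traceFun_sub h hξ hB hr hs hs'
  have h1 := trace_gram_mul_nonneg (B := B) fun v hv => hM.inv_form_pos hq hv
  rw [← hB] at h1
  have := mul_nonneg (sub_nonneg.2 hss) h1
  linarith

lemma traceFun_strictAntiOn (h : Coercive A ξ) (hξ : 0 < ξ) (hB : Φ = Bᵀ * B) (hr : 0 ≤ r)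
    (hΦ : Φ ≠ 0) : StrictAntiOn (traceFun A Φ r) (Set.Ioi 0) := by
  intro s hs s' hs' hss
  obtain ⟨M, ⟨q, hq, hM⟩, e⟩ := traceFun_sub h hξ hB hr hs hs'
  have h1 := trace_gram_mul_pos (B := B) (fun v hv => hM.inv_form_pos hq hv) (hB ▸ hΦ)
  rw [← hB] at h1
  have := mul_pos (sub_pos.2 hss) h1
  linarith

lemma traceFun_nonneg (h : Coercive A ξ) (hξ : 0 < ξ) (hB : Φ = Bᵀ * B) (hr : 0 ≤ r)
    (hs : 0 < s) : 0 ≤ traceFun A Φ r s := by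
  obtain ⟨q, hq, hM⟩ := coercive_add_gram h hξ hB hr hs
  have h1 := trace_gram_mul_nonneg (B := B) fun v hv => hM.inv_form_pos hq hv
  rwa [← hB] at h1

lemma traceFun_pos (h : Coercive A ξ) (hξ : 0 < ξ) (hB : Φ = Bᵀ * B) (hr : 0 ≤ r)
    (hΦ : Φ ≠ 0) (hs : 0 < s) : 0 < traceFun A Φ r s := by
  obtain ⟨q, hq, hM⟩ := coercive_add_gram h hξ hB hr hs
  have h1 := trace_gram_mul_pos (B := B) (fun v hv => hM.inv_form_pos hq hv) (hB ▸ hΦ)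
  rwa [← hB] at h1

/-- The left side is the trace of YKYᵀ with Y = √r B, a matrix of norm at most 1. This gives the
decay in the number of features. -/
lemma mul_traceFun_le (h : Coercive A ξ) (hξ : 0 < ξ) (hB : Φ = Bᵀ * B) (hr : 0 ≤ r)
    (hs : 0 < s) : r * traceFun A Φ r s ≤ Fintype.card ι := by
  obtain ⟨q, hq, hA⟩ := exists_inv_coercive h hξ
  have h1 := (hA.smul hs.le).norm_mul_res_mul_le (mul_pos hs hq) (√r • B)
  have e : r * traceFun A Φ r s =
      ((√r • B) * res (s • A⁻¹) (√r • B) * (√r • B)ᵀ).trace := by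
    rw [Matrix.trace_mul_comm, ← Matrix.mul_assoc, gram_sqrt_smul_eq hB hr,
      res_sqrt_smul_eq _ hB hr, Matrix.smul_mul, Matrix.trace_smul, smul_eq_mul, traceFun]
  rw [e, Matrix.trace]
  refine (Finset.sum_le_card_nsmul _ _ 1 fun i _ => ?_).trans (by simp)
  exact (le_abs_self _).trans ((abs_apply_le_norm _ i i).trans h1)

lemma traceFun_tendsto (h : Coercive A ξ) (hξ : 0 < ξ) (hB : Φ = Bᵀ * B) (hr : 0 ≤ r) :
    Tendsto (traceFun A Φ r) atTop (𝓝 0) := by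
  obtain ⟨q, hq, hA⟩ := exists_inv_coercive h hξ
  have h1 : Tendsto (fun s : ℝ => Φ.trace * (s * q)⁻¹) atTop (𝓝 (Φ.trace * 0)) :=
    (tendsto_inv_atTop_zero.comp (tendsto_id.atTop_mul_const hq)).const_mul _
  rw [mul_zero] at h1
  refine squeeze_zero' ((eventually_gt_atTop 0).mono fun s hs =>
    traceFun_nonneg h hξ hB hr hs) ((eventually_gt_atTop 0).mono fun s hs => ?_) h1
  have h2 := abs_trace_gram_mul_le B (res (s • A⁻¹) (√r • B))
  rw [← hB] at h2
  have h3 := (hA.smul hs.le).norm_res_le (mul_pos hs hq) (√r • B)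
  rw [traceFun, ← res_sqrt_smul_eq _ hB hr]
  refine (le_abs_self _).trans (h2.trans (mul_le_mul_of_nonneg_left h3 ?_))
  have := trace_gram_mul B 1
  rw [Matrix.mul_one, ← hB] at this
  rw [this]
  exact Finset.sum_nonneg fun a _ => by rw [Matrix.one_mulVec]; exact dotProduct_self_nonneg' _

/-- By the adjugate formula this is a rational function of s whose denominator does not vanish. -/
lemma traceFun_continuousOn (h : Coercive A ξ) (hξ : 0 < ξ) (hB : Φ = Bᵀ * B) (hr : 0 ≤ r) :
    ContinuousOn (traceFun A Φ r) (Set.Ioi 0) := by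
  have h0 : Continuous fun s : ℝ => s • A⁻¹ + r • Φ := by fun_prop
  have e : traceFun A Φ r = fun s : ℝ => (s • A⁻¹ + r • Φ).det⁻¹ *
      (Φ * (s • A⁻¹ + r • Φ).adjugate).trace := by
    ext s
    rw [traceFun, Matrix.inv_def, Ring.inverse_eq_inv', Matrix.mul_smul, Matrix.trace_smul,
      smul_eq_mul]
  rw [e]
  refine ContinuousOn.mul (ContinuousOn.inv₀ h0.matrix_det.continuousOn fun s hs => ?_)
    (Continuous.continuousOn ?_)
  · obtain ⟨q, hq, hM⟩ := coercive_add_gram h hξ hB hr hs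
    exact ((Matrix.isUnit_iff_isUnit_det _).1 (hM.isUnit hq)).ne_zero
  · exact (continuous_const.matrix_mul h0.matrix_adjugate).matrix_trace

/-- Rescaling the argument of the trace function. -/
lemma trace_rescaled (h : Coercive A ξ) (hξ : 0 < ξ) (hB : Φ = Bᵀ * B) (hr : 0 ≤ r)
    {t lam : ℝ} (hl : 0 < lam) (ht : 0 < t) :
    (Φ * (lam • A⁻¹ + (r * t⁻¹) • Φ)⁻¹).trace = t * traceFun A Φ r (lam * t) := by
  obtain ⟨q, hq, hM⟩ := coercive_add_gram h hξ hB hr (mul_pos hl ht)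
  have e : lam • A⁻¹ + (r * t⁻¹) • Φ = t⁻¹ • ((lam * t) • A⁻¹ + r • Φ) := by
    rw [smul_add, smul_smul, smul_smul]
    congr 2
    · field_simp
    · ring
  have e2 : (lam • A⁻¹ + (r * t⁻¹) • Φ)⁻¹ = t • ((lam * t) • A⁻¹ + r • Φ)⁻¹ := by
    rw [e]
    refine Matrix.inv_eq_right_inv ?_
    rw [Matrix.smul_mul, Matrix.mul_smul, smul_smul, inv_mul_cancel₀ ht.ne', one_smul,
      hM.mul_inv_self hq]
  rw [e2, Matrix.mul_smul, Matrix.trace_smul, smul_eq_mul, traceFun]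

end MatrixFixedPoint

/-! ### Reduction from transitions to visited states -/

section PushThrough

variable {ι ν : Type*} [Fintype ι] [Fintype ν] [DecidableEq ι] [DecidableEq ν]
  {A T Z : Matrix ι ι ℝ} {C U : Matrix ι ν ℝ} {lam : ℝ}

/-- The inverse of `CᵀZU + lam` is affine in the inverse of `lam A⁻¹ + Z`, where `A = UCᵀ`. -/
lemma push_through (hA : A = U * Cᵀ) (hA1 : A * A⁻¹ = 1) (hT : (lam • A⁻¹ + Z) * T = 1)
    (hl : lam ≠ 0) :
    (Cᵀ * Z * U + lam • (1 : Matrix ν ν ℝ)) *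
      (lam⁻¹ • (1 - Cᵀ * A⁻¹ * U) + Cᵀ * A⁻¹ * T * A⁻¹ * U) = 1 := by
  have h1 : Cᵀ * Z * U * (Cᵀ * A⁻¹ * U) = Cᵀ * Z * U := by
    calc _ = Cᵀ * Z * ((U * Cᵀ) * A⁻¹) * U := by simp only [Matrix.mul_assoc]
      _ = _ := by rw [← hA, hA1, Matrix.mul_one]
  have h2 : Cᵀ * Z * U * (Cᵀ * A⁻¹ * T * A⁻¹ * U) = Cᵀ * (Z * T) * A⁻¹ * U := by
    calc _ = Cᵀ * Z * ((U * Cᵀ) * A⁻¹) * T * A⁻¹ * U := by simp only [Matrix.mul_assoc]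
      _ = _ := by rw [← hA, hA1, Matrix.mul_one]; simp only [Matrix.mul_assoc]
  have h3 : Z * T = 1 - lam • (A⁻¹ * T) := by
    rw [← hT, Matrix.add_mul, Matrix.smul_mul]; abel
  have h4 : Cᵀ * (1 - lam • (A⁻¹ * T)) * A⁻¹ * U =
      Cᵀ * A⁻¹ * U - lam • (Cᵀ * A⁻¹ * T * A⁻¹ * U) := by
    simp only [Matrix.mul_sub, Matrix.sub_mul, Matrix.mul_one, Matrix.mul_smul, Matrix.smul_mul,
      Matrix.mul_assoc]
  rw [Matrix.mul_add, Matrix.add_mul, Matrix.add_mul, h2, h3, h4, Matrix.mul_smul, Matrix.mul_sub,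
    Matrix.mul_one, h1, sub_self, smul_zero, zero_add, Matrix.smul_mul, Matrix.one_mul, smul_smul,
    mul_inv_cancel₀ hl, one_smul, Matrix.smul_mul, Matrix.one_mul]
  abel

lemma push_through_inv (hA : A = U * Cᵀ) (hA1 : A * A⁻¹ = 1) (hT : (lam • A⁻¹ + Z) * T = 1)
    (hl : lam ≠ 0) :
    (Cᵀ * Z * U + lam • (1 : Matrix ν ν ℝ))⁻¹ =
      lam⁻¹ • (1 - Cᵀ * A⁻¹ * U) + Cᵀ * A⁻¹ * T * A⁻¹ * U :=
  Matrix.inv_eq_right_inv (push_through hA hA1 hT hl)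

/-- U moves through the inverse, U(CᵀZU + λ)⁻¹ = TA⁻¹U, and cyclicity of the trace closes up UCᵀ =
A. -/
lemma push_through_trace (hA : A = U * Cᵀ) (hA1 : A * A⁻¹ = 1) (hA2 : A⁻¹ * A = 1)
    (hT : (lam • A⁻¹ + Z) * T = 1) (hl : lam ≠ 0) (Φ : Matrix ι ι ℝ) :
    (Cᵀ * Φ * U * (Cᵀ * Z * U + lam • (1 : Matrix ν ν ℝ))⁻¹).trace = (Φ * T).trace := by
  have h1 : U * (Cᵀ * Z * U + lam • (1 : Matrix ν ν ℝ))⁻¹ = T * A⁻¹ * U := by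
    rw [push_through_inv hA hA1 hT hl, Matrix.mul_add, Matrix.mul_smul, Matrix.mul_sub]
    have h2 : U * (Cᵀ * A⁻¹ * U) = U := by
      calc _ = (U * Cᵀ) * A⁻¹ * U := by simp only [Matrix.mul_assoc]
        _ = _ := by rw [← hA, hA1, Matrix.one_mul]
    have h3 : U * (Cᵀ * A⁻¹ * T * A⁻¹ * U) = T * A⁻¹ * U := by
      calc _ = ((U * Cᵀ) * A⁻¹) * (T * A⁻¹ * U) := by simp only [Matrix.mul_assoc]
        _ = _ := by rw [← hA, hA1, Matrix.one_mul]
    rw [h2, h3, Matrix.mul_one, sub_self, smul_zero, zero_add]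
  rw [Matrix.mul_assoc, h1, Matrix.mul_assoc, Matrix.trace_mul_comm]
  calc _ = (Φ * T * (A⁻¹ * (U * Cᵀ))).trace := by simp only [Matrix.mul_assoc]
    _ = _ := by rw [← hA, hA2, Matrix.mul_one]

end PushThrough

/-! ### From the mean leverage to the fixed point -/

namespace SampleModel

variable {ι : Type*} [Fintype ι] [DecidableEq ι] {N d : ℕ} (S : SampleModel ι N d)

lemma trace_Φ_mul_res_le {P : Matrix ι ι ℝ} {p : ℝ} (h : Coercive P p) (hp : 0 < p)
    (Y : Matrix ι ι ℝ) : (S.Φ * res P Y).trace ≤ S.m * ((1 + S.b) * p⁻¹) := by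
  obtain ⟨B, hB⟩ := S.exists_gram
  have h1 := abs_trace_gram_mul_le B (res P Y)
  rw [← hB] at h1
  have hb := S.b_nonneg
  calc _ ≤ _ := (le_abs_self _).trans h1
    _ ≤ (S.m * (1 + S.b)) * p⁻¹ :=
      mul_le_mul S.trace_Φ_le (h.norm_res_le hp Y) (norm_nonneg _)
        (mul_nonneg S.m_pos.le (by linarith))
    _ = _ := by ring

/-- The expected resolvent is close to its deterministic equivalent, in terms of the solution `t`
of the fixed-point equation. -/
theorem norm_expMat_res_sub_equivalent_le {A : Matrix ι ι ℝ} {ξ lam t p : ℝ} (hA : Coercive A ξ)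
    (hξ : 0 < ξ) (hl : 0 < lam) (hp : 0 < p) (hP : Coercive (lam • A⁻¹) p) (ht : 1 ≤ t)
    (hfix : 1 - t⁻¹ = S.m⁻¹ * traceFun A S.Φ ((N : ℝ) / S.m) (lam * t)) :
    ‖expMat (gaussianMatrix N d) (fun W => res (lam • A⁻¹) (S.Y W)) -
      (lam • A⁻¹ + ((N : ℝ) / S.m * t⁻¹) • S.Φ)⁻¹‖ ≤ S.boundTotal p * (√S.m)⁻¹ := by
  obtain ⟨B, hB⟩ := S.exists_gram
  have hN : 0 < N := by exact_mod_cast S.N_pos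
  have hm := S.m_pos
  have ht0 : 0 < t := by linarith
  set a : Fin N := ⟨0, hN⟩
  set r := (N : ℝ) / S.m with hr_def
  have hr : 0 < r := div_pos S.N_pos hm
  set P := lam • A⁻¹ with hP_def
  set D := S.meanLev P a with hD_def
  have hD : 0 < D := S.meanLev_pos hP hp a
  have hbm := S.boundMean_pos hp
  have hb := S.b_nonneg
  have hDfix := S.abs_one_sub_meanLev_mul_le hP hp a hB
  rw [← hr_def, ← hD_def, res_sqrt_smul_eq P hB (by positivity)] at hDfix
  have htr : (S.Φ * (P + (r * D) • S.Φ)⁻¹).trace = D⁻¹ * traceFun A S.Φ r (lam * D⁻¹) := by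
    have := trace_rescaled hA hξ hB hr.le hl (inv_pos.2 hD)
    rwa [inv_inv] at this
  -- After rescaling, the residual of E[D] is exactly the quantity bounded in `hDfix`.
  have hstab : |D - t⁻¹| ≤ S.boundFix p * (√S.m)⁻¹ := by
    have h1 := fixed_point_stable (g := fun s => S.m⁻¹ * traceFun A S.Φ r s)
      (fun s hs s' hs' hss => mul_le_mul_of_nonneg_left
        (traceFun_antitoneOn hA hξ hB hr.le hs hs' hss) (inv_pos.2 hm).le) hl ht0 hD hfix
    refine h1.trans (le_trans (le_of_eq ?_) hDfix)
    rw [htr]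
    congr 1
    field_simp
    ring
  -- t - 1 is a normalised trace against a bounded resolvent; the bound keeps the coefficient
  -- (N/m)/t away from 0.
  have htb : t ≤ S.boundMean p := by
    have h1 := S.trace_Φ_mul_res_le hP hp (√(r * t⁻¹) • B)
    rw [res_sqrt_smul_eq P hB (by positivity), trace_rescaled hA hξ hB hr.le hl ht0] at h1
    have h2 : t * (1 - t⁻¹) ≤ (1 + S.b) * p⁻¹ := by
      rw [hfix]
      calc _ = S.m⁻¹ * (t * traceFun A S.Φ r (lam * t)) := by ring
        _ ≤ S.m⁻¹ * (S.m * ((1 + S.b) * p⁻¹)) := mul_le_mul_of_nonneg_left h1 (inv_pos.2 hm).le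
        _ = _ := by rw [inv_mul_cancel_left₀ hm.ne']
    rw [mul_sub, mul_one, mul_inv_cancel₀ ht0.ne'] at h2
    unfold BoundParams.boundMean
    linarith
  have hrc : r⁻¹ ≤ S.c₀⁻¹ := by
    refine inv_anti₀ S.c₀_pos ?_
    rw [hr_def, le_div_iff₀ hm]
    exact S.le_N
  have hrC : r ≤ S.C₀ := by
    rw [hr_def, div_le_iff₀ hm]
    exact S.N_le
  have hc0 : 0 < S.c₀⁻¹ := inv_pos.2 S.c₀_pos
  have hcD : (r * D)⁻¹ ≤ S.boundMean p * S.c₀⁻¹ := S.inv_ratio_le hP hp a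
  have hct : (r * t⁻¹)⁻¹ ≤ S.boundMean p * S.c₀⁻¹ := by
    rw [mul_inv, inv_inv, mul_comm]
    exact mul_le_mul htb hrc (inv_pos.2 hr).le hbm.le
  have hrD : 0 < r * D := mul_pos hr hD
  have hrt : 0 < r * t⁻¹ := mul_pos hr (inv_pos.2 ht0)
  have hmain := S.norm_expMat_res_sub_le hP hp a hB
  rw [← hr_def, ← hD_def] at hmain
  rw [← res_sqrt_smul_eq P hB hrt.le]
  set KD := res P (√(r * D) • B) with hKD
  set Kt := res P (√(r * t⁻¹) • B) with hKt
  set q := S.boundMean p * S.c₀⁻¹ * p⁻¹ with hq_def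
  have hq : 0 < q := by positivity
  have hBt : ‖B * Kt‖ ≤ √q :=
    (norm_mul_det_le hP hp hrt).trans (Real.sqrt_le_sqrt
      (mul_le_mul_of_nonneg_right hct (inv_pos.2 hp).le))
  have hBD : ‖KD * Bᵀ‖ ≤ √q := by
    rw [← norm_transpose, Matrix.transpose_mul, Matrix.transpose_transpose, hKD, transpose_res]
    exact (norm_mul_det_le hP.transpose hp hrD).trans (Real.sqrt_le_sqrt
      (mul_le_mul_of_nonneg_right hcD (inv_pos.2 hp).le))
  -- Φ is shared between the two resolvents as Bᵀ and B, so the possibly large ‖Φ‖ does not enter.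
  have hdiff : KD - Kt = (r * t⁻¹ - r * D) • ((KD * Bᵀ) * (B * Kt)) := by
    have e1 := hP.res_mul hp (√(r * D) • B)
    have e2 := hP.mul_res hp (√(r * t⁻¹) • B)
    rw [gram_sqrt_smul_eq hB hrD.le] at e1
    rw [gram_sqrt_smul_eq hB hrt.le] at e2
    have e3 : (r * t⁻¹ - r * D) • S.Φ = (P + (r * t⁻¹) • S.Φ) - (P + (r * D) • S.Φ) := by
      rw [sub_smul]; abel
    calc KD - Kt = KD * ((r * t⁻¹ - r * D) • S.Φ) * Kt := by
          rw [e3, Matrix.mul_sub, Matrix.sub_mul, e1, Matrix.mul_assoc, e2, Matrix.mul_one,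
            Matrix.one_mul]
      _ = _ := by
          rw [hB, Matrix.mul_smul, Matrix.smul_mul]
          simp only [Matrix.mul_assoc]
  have hnd : ‖KD - Kt‖ ≤ S.C₀ * S.boundFix p * q * (√S.m)⁻¹ := by
    have hC := S.C₀_pos
    have hf : 0 ≤ S.boundFix p * (√S.m)⁻¹ := (abs_nonneg _).trans hstab
    have h1 : |r * t⁻¹ - r * D| ≤ S.C₀ * (S.boundFix p * (√S.m)⁻¹) := by
      rw [← mul_sub, abs_mul, abs_of_pos hr, abs_sub_comm]
      exact mul_le_mul hrC hstab (abs_nonneg _) hC.le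
    have h2 : ‖(KD * Bᵀ) * (B * Kt)‖ ≤ √q * √q := (Matrix.l2_opNorm_mul _ _).trans
      (mul_le_mul hBD hBt (norm_nonneg _) (Real.sqrt_nonneg _))
    rw [Real.mul_self_sqrt hq.le] at h2
    rw [hdiff, norm_smul, Real.norm_eq_abs]
    calc _ ≤ S.C₀ * (S.boundFix p * (√S.m)⁻¹) * q :=
          mul_le_mul h1 h2 (norm_nonneg _) (mul_nonneg hC.le hf)
      _ = _ := by ring
  calc _ = ‖(expMat (gaussianMatrix N d) (fun W => res P (S.Y W)) - KD) + (KD - Kt)‖ := by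
        rw [sub_add_sub_cancel]
    _ ≤ _ := norm_add_le _ _
    _ ≤ S.boundRes p * (√S.m)⁻¹ + S.C₀ * S.boundFix p * q * (√S.m)⁻¹ := add_le_add hmain hnd
    _ = _ := by rw [BoundParams.boundTotal]; ring

end SampleModel

/-! ### Eighth moments of the Gaussian weights -/

section GaussianMoments

variable {d : ℕ}

/-- The eighth moment of the standard normal law. -/
def gaussianEighth : ℝ := ∫ t, t ^ 8 ∂gaussianReal 0 1

lemma integrable_gaussian_pow_eight : Integrable (fun t : ℝ => t ^ 8) (gaussianReal 0 1) := by
  have := (memLp_id_gaussianReal' (μ := 0) (v := 1) 8 (by simp)).integrable_norm_pow (p := 8)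
    (by norm_num)
  refine this.congr (Eventually.of_forall fun t => ?_)
  simp only [id, Real.norm_eq_abs]
  exact Even.pow_abs (by decide) _

lemma measurePreserving_coord (l : Fin d) :
    MeasurePreserving (fun w : Fin d → ℝ => w l) (gaussianVector d) (gaussianReal 0 1) :=
  measurePreserving_eval (fun _ : Fin d => gaussianReal 0 1) l

lemma integrable_sum_pow_eight :
    Integrable (fun w : Fin d → ℝ => ∑ l, w l ^ 8) (gaussianVector d) :=
  integrable_finsetSum _ fun l _ =>
    (measurePreserving_coord l).integrable_comp_of_integrable integrable_gaussian_pow_eight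

lemma integral_sum_pow_eight :
    ∫ w : Fin d → ℝ, ∑ l, w l ^ 8 ∂gaussianVector d = d * gaussianEighth := by
  have hi : ∀ l : Fin d, Integrable (fun w : Fin d → ℝ => w l ^ 8) (gaussianVector d) := fun l =>
    (measurePreserving_coord l).integrable_comp_of_integrable integrable_gaussian_pow_eight
  rw [integral_finsetSum _ fun l _ => hi l]
  have : ∀ l : Fin d, ∫ w : Fin d → ℝ, w l ^ 8 ∂gaussianVector d = gaussianEighth := fun l => by
    rw [gaussianEighth, ← (measurePreserving_coord l).map_eq,
      integral_map (measurePreserving_coord l).measurable.aemeasurable]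
    exact (by fun_prop : Continuous fun t : ℝ => t ^ 8).aestronglyMeasurable
  simp [this]

lemma gaussianEighth_nonneg : 0 ≤ gaussianEighth :=
  integral_nonneg fun t => by positivity

lemma sum_sq_pow_four_le (w : Fin d → ℝ) :
    (∑ l, w l ^ 2) ^ 4 ≤ (d : ℝ) ^ 3 * ∑ l, w l ^ 8 := by
  rcases Nat.eq_zero_or_pos d with rfl | hd
  · simp
  have h := pow_sum_div_card_le_sum_pow (s := Finset.univ) (f := fun l => w l ^ 2)
    (fun l _ => sq_nonneg _) 3
  rw [div_le_iff₀ (by simp; positivity)] at h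
  simp only [Finset.card_univ, Fintype.card_fin, ← pow_mul] at h
  norm_num at h
  linarith

end GaussianMoments

/-! ### Lipschitz and growth bounds for random features -/

section LipschitzFeatures

variable {ι κ : Type*} [Fintype ι] [Fintype κ] [DecidableEq ι] [DecidableEq κ]

lemma norm_toLp_comp_sub_le {f : ℝ → ℝ} {K : ℝ≥0} (hf : LipschitzWith K f) (u v : ι → ℝ) :
    ‖WithLp.toLp 2 ((fun i => f (u i)) - fun i => f (v i))‖ ≤ K * ‖WithLp.toLp 2 (u - v)‖ := by
  refine le_of_sq_le_sq ?_ (by positivity)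
  rw [mul_pow, norm_toLp_sq, norm_toLp_sq, dotProduct, dotProduct, Finset.mul_sum]
  refine Finset.sum_le_sum fun i _ => ?_
  have h := hf.dist_le_mul (u i) (v i)
  rw [Real.dist_eq, Real.dist_eq] at h
  have h2 := pow_le_pow_left₀ (abs_nonneg _) h 2
  rw [mul_pow, sq_abs, sq_abs] at h2
  simp only [Pi.sub_apply]
  nlinarith

lemma norm_toLp_const (c : ℝ) :
    ‖WithLp.toLp 2 (fun _ : ι => c)‖ = √(Fintype.card ι) * |c| := by
  rw [norm_toLp_eq_sqrt, dotProduct, Finset.sum_const, nsmul_eq_mul, Finset.card_univ,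
    Real.sqrt_mul (by positivity), Real.sqrt_mul_self_eq_abs]

/-- The random vector `σ(φ(w)ᵀ A)`. -/
def featureVec (σ φ : ℝ → ℝ) (A : Matrix κ ι ℝ) (w : κ → ℝ) : ι → ℝ :=
  fun i => σ (∑ l, φ (w l) * A l i)

variable {σ φ : ℝ → ℝ} {Kσ Kφ : ℝ≥0} (hσ : LipschitzWith Kσ σ) (hφ : LipschitzWith Kφ φ)
  {A : Matrix κ ι ℝ} {KS : ℝ} (hA : ‖A‖ ≤ KS)

include hσ hφ in
lemma measurable_featureVec : Measurable (featureVec σ φ A) := by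
  have h1 := hσ.continuous
  have h2 := hφ.continuous
  refine Continuous.measurable (continuous_pi fun i => ?_)
  unfold featureVec
  fun_prop

include hσ hA in
lemma norm_featureVec_sub_le (u v : κ → ℝ) :
    ‖WithLp.toLp 2 ((fun i => σ (∑ l, u l * A l i)) - fun i => σ (∑ l, v l * A l i))‖ ≤
      Kσ * KS * ‖WithLp.toLp 2 (u - v)‖ := by
  refine (norm_toLp_comp_sub_le hσ _ _).trans ?_
  have e : ((fun i => ∑ l, u l * A l i) - fun i => ∑ l, v l * A l i) = Aᵀ *ᵥ (u - v) := by
    ext i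
    simp only [Pi.sub_apply, Matrix.mulVec, dotProduct, Matrix.transpose_apply,
      ← Finset.sum_sub_distrib]
    exact Finset.sum_congr rfl fun l _ => by ring
  rw [e, mul_assoc]
  refine mul_le_mul_of_nonneg_left ((norm_toLp_mulVec_le _ _).trans ?_) Kσ.2
  rw [norm_transpose]
  exact mul_le_mul_of_nonneg_right hA (norm_nonneg _)

include hσ hφ hA in
lemma norm_featureVec_sub_featureVec_le (w w' : κ → ℝ) :
    ‖WithLp.toLp 2 (featureVec σ φ A w - featureVec σ φ A w')‖ ≤
      Kσ * KS * Kφ * ‖WithLp.toLp 2 (w - w')‖ := by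
  refine (norm_featureVec_sub_le hσ hA (fun l => φ (w l)) fun l => φ (w' l)).trans ?_
  rw [mul_assoc _ (Kφ : ℝ)]
  exact mul_le_mul_of_nonneg_left (norm_toLp_comp_sub_le hφ w w')
    (mul_nonneg Kσ.2 ((norm_nonneg _).trans hA))

-- At w = 0 the features are compared with the constant vector σ(0). The constant vectors σ(0) and
-- φ(0) have norms of order √|ι| and √|κ|, both controlled by √m.
include hσ hA in
lemma norm_featureVec_zero_le {m C : ℝ} (hm : 0 ≤ m) (hι : Fintype.card ι ≤ m)
    (hκ : Fintype.card κ ≤ C * m) :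
    ‖WithLp.toLp 2 (featureVec σ φ A 0)‖ ≤ √m * (|σ 0| + Kσ * KS * (√C * |φ 0|)) := by
  have hKS := (norm_nonneg _).trans hA
  have h1 := norm_featureVec_sub_le hσ hA (fun _ => φ 0) 0
  have e1 : (fun i => σ (∑ l, (0 : κ → ℝ) l * A l i)) = fun _ : ι => σ 0 := by
    ext i; simp
  have e2 : ((fun _ : κ => φ 0) - 0) = fun _ => φ 0 := sub_zero _
  rw [e1, e2, norm_toLp_const] at h1
  have h2 : ‖WithLp.toLp 2 (featureVec σ φ A 0)‖ ≤
      ‖WithLp.toLp 2 ((fun i => σ (∑ l, (fun _ : κ => φ 0) l * A l i)) - fun _ : ι => σ 0)‖ +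
        ‖WithLp.toLp 2 (fun _ : ι => σ 0)‖ := by
    refine le_trans (le_of_eq ?_) (norm_add_le _ _)
    rw [← WithLp.toLp_add, sub_add_cancel]
    rfl
  rw [norm_toLp_const] at h2
  have h3 : √(Fintype.card κ : ℝ) ≤ √C * √m := by
    rw [← Real.sqrt_mul' _ hm]; exact Real.sqrt_le_sqrt hκ
  have h4 : √(Fintype.card ι : ℝ) ≤ √m := Real.sqrt_le_sqrt hι
  calc _ ≤ _ := h2
    _ ≤ Kσ * KS * (√(Fintype.card κ : ℝ) * |φ 0|) + √(Fintype.card ι : ℝ) * |σ 0| :=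
      add_le_add_left h1 _
    _ ≤ Kσ * KS * ((√C * √m) * |φ 0|) + √m * |σ 0| := by gcongr
    _ = _ := by ring

include hσ hφ in
lemma vecLipschitz_featureVec {d : ℕ} {A : Matrix (Fin d) ι ℝ} (hA : ‖A‖ ≤ KS) :
    VecLipschitz (featureVec σ φ A) (Kσ * KS * Kφ) := fun w w' => by
  refine (norm_featureVec_sub_featureVec_le hσ hφ hA w w').trans_eq ?_
  rw [norm_toLp_eq_sqrt (w - w')]
  simp only [dotProduct, Pi.sub_apply, sq]

/-- The bound of `E[(|x|² / m)⁴]` for the feature vector `x`. -/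
def momentBound (σ φ : ℝ → ℝ) (Kσ Kφ : ℝ≥0) (KS C : ℝ) : ℝ :=
  128 * (|σ 0| + Kσ * KS * (√C * |φ 0|)) ^ 8 + 128 * (Kσ * KS * Kφ) ^ 8 * C ^ 4 * gaussianEighth

end LipschitzFeatures

/-! ### Random features as a sample model -/

section FeatureModel

variable {ι : Type*} [Fintype ι] [DecidableEq ι] {d : ℕ} {σ φ : ℝ → ℝ} {Kσ Kφ : ℝ≥0}
  (hσ : LipschitzWith Kσ σ) (hφ : LipschitzWith Kφ φ) {A : Matrix (Fin d) ι ℝ} {KS m C : ℝ}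
  (hA : ‖A‖ ≤ KS) (hm : 1 ≤ m) (hι : Fintype.card ι ≤ m) (hd : d ≤ C * m)
include hσ hφ hA hm hι hd

/-- ‖x(w)‖ ≤ L‖w‖ + a√m, and the power mean inequality reduces ‖w‖⁸ to d³ Σ w_l⁸. After integration
this is of order (d/m)⁴. -/
lemma featureVec_moment_le (w : Fin d → ℝ) :
    (featureVec σ φ A w ⬝ᵥ featureVec σ φ A w / m) ^ 4 ≤
      128 * (|σ 0| + Kσ * KS * (√C * |φ 0|)) ^ 8 +
        128 * (Kσ * KS * Kφ) ^ 8 * ((d : ℝ) ^ 3 / m ^ 4 * ∑ l, w l ^ 8) := by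
  have hm0 : 0 < m := by linarith
  have hKS := (norm_nonneg _).trans hA
  set a := |σ 0| + Kσ * KS * (√C * |φ 0|) with ha
  set L := (Kσ : ℝ) * KS * Kφ with hL
  have ha0 : 0 ≤ a := by positivity
  have h0 := norm_featureVec_zero_le (φ := φ) hσ hA hm0.le hι (by simpa using hd)
  have h1 := norm_featureVec_sub_featureVec_le hσ hφ hA w 0
  rw [sub_zero, ← hL] at h1
  have h2 : ‖WithLp.toLp 2 (featureVec σ φ A w)‖ ≤ L * ‖WithLp.toLp 2 w‖ + √m * a := by
    calc _ = ‖WithLp.toLp 2 (featureVec σ φ A w - featureVec σ φ A 0) +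
          WithLp.toLp 2 (featureVec σ φ A 0)‖ := by rw [← WithLp.toLp_add, sub_add_cancel]
      _ ≤ _ := (norm_add_le _ _).trans (add_le_add h1 h0)
  have h3 : featureVec σ φ A w ⬝ᵥ featureVec σ φ A w ≤ 2 * (L ^ 2 * (w ⬝ᵥ w)) + 2 * (m * a ^ 2) := by
    rw [← norm_toLp_sq, ← norm_toLp_sq]
    refine (pow_le_pow_left₀ (norm_nonneg _) h2 2).trans ?_
    rw [← Real.sq_sqrt hm0.le, Real.sqrt_sq (Real.sqrt_nonneg m)]
    nlinarith [sq_nonneg (L * ‖WithLp.toLp 2 w‖ - √m * a)]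
  have h4 : featureVec σ φ A w ⬝ᵥ featureVec σ φ A w / m ≤
      2 * (L ^ 2 * (w ⬝ᵥ w) / m) + 2 * a ^ 2 := by
    rw [div_le_iff₀ hm0]
    refine h3.trans (le_of_eq ?_)
    field_simp
  have h5 : ∀ u v : ℝ, 0 ≤ u → 0 ≤ v → (2 * u + 2 * v) ^ 4 ≤ 128 * u ^ 4 + 128 * v ^ 4 := by
    intro u v _ _
    have e1 : (u + v) ^ 2 ≤ 2 * (u ^ 2 + v ^ 2) := by nlinarith [sq_nonneg (u - v)]
    have e2 := pow_le_pow_left₀ (sq_nonneg (u + v)) e1 2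
    nlinarith [sq_nonneg (u ^ 2 - v ^ 2)]
  have hw := dotProduct_self_nonneg' w
  have h6 := sum_sq_pow_four_le w
  have e6 : ∑ l, w l ^ 2 = w ⬝ᵥ w := Finset.sum_congr rfl fun l _ => by ring
  rw [e6] at h6
  calc _ ≤ (2 * (L ^ 2 * (w ⬝ᵥ w) / m) + 2 * a ^ 2) ^ 4 :=
        pow_le_pow_left₀ (div_nonneg (dotProduct_self_nonneg' _) hm0.le) h4 4
    _ ≤ 128 * (L ^ 2 * (w ⬝ᵥ w) / m) ^ 4 + 128 * (a ^ 2) ^ 4 :=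
        h5 _ _ (by positivity) (by positivity)
    _ = 128 * a ^ 8 + 128 * L ^ 8 * ((w ⬝ᵥ w) ^ 4 / m ^ 4) := by
        rw [div_pow]; ring
    _ ≤ 128 * a ^ 8 + 128 * L ^ 8 * (((d : ℝ) ^ 3 * ∑ l, w l ^ 8) / m ^ 4) := by
        gcongr
    _ = _ := by ring

lemma integrable_featureVec_moment :
    Integrable (fun w => (featureVec σ φ A w ⬝ᵥ featureVec σ φ A w / m) ^ 4)
      (gaussianVector d) := by
  have hmeas : Measurable fun w => (featureVec σ φ A w ⬝ᵥ featureVec σ φ A w / m) ^ 4 := by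
    have h1 := measurable_featureVec hσ hφ (A := A)
    have h2 : ∀ i, Measurable fun w => featureVec σ φ A w i := fun i =>
      (measurable_pi_apply i).comp h1
    exact ((Finset.measurable_fun_sum _ fun i _ => (h2 i).mul (h2 i)).div_const m).pow_const 4
  refine Integrable.mono' ((integrable_const (128 * (|σ 0| + Kσ * KS * (√C * |φ 0|)) ^ 8)).add
    ((integrable_sum_pow_eight.const_mul ((d : ℝ) ^ 3 / m ^ 4)).const_mul
      (128 * (Kσ * KS * Kφ) ^ 8))) hmeas.aestronglyMeasurable (Eventually.of_forall fun w => ?_)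
  rw [Real.norm_of_nonneg (by positivity)]
  exact featureVec_moment_le hσ hφ hA hm hι hd w

lemma integral_featureVec_moment_le :
    ∫ w, (featureVec σ φ A w ⬝ᵥ featureVec σ φ A w / m) ^ 4 ∂gaussianVector d ≤
      momentBound σ φ Kσ Kφ KS C := by
  have hm0 : 0 < m := by linarith
  have hKS := (norm_nonneg _).trans hA
  have hi := ((integrable_sum_pow_eight (d := d)).const_mul ((d : ℝ) ^ 3 / m ^ 4)).const_mul
    (128 * (Kσ * KS * Kφ) ^ 8)
  refine (integral_mono (integrable_featureVec_moment hσ hφ hA hm hι hd)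
    ((integrable_const _).add hi) (featureVec_moment_le hσ hφ hA hm hι hd)).trans ?_
  have e : ∫ w : Fin d → ℝ, (128 * (|σ 0| + Kσ * KS * (√C * |φ 0|)) ^ 8 +
      128 * (Kσ * KS * Kφ) ^ 8 * ((d : ℝ) ^ 3 / m ^ 4 * ∑ l, w l ^ 8)) ∂gaussianVector d =
      128 * (|σ 0| + Kσ * KS * (√C * |φ 0|)) ^ 8 +
        128 * (Kσ * KS * Kφ) ^ 8 * (((d : ℝ) / m) ^ 4 * gaussianEighth) := by
    rw [integral_add (integrable_const _) hi, integral_const, integral_const_mul,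
      integral_const_mul, integral_sum_pow_eight, probReal_univ, one_smul]
    ring
  refine (le_of_eq e).trans ?_
  rw [momentBound, mul_assoc (128 * _) (C ^ 4)]
  have hdm : (d : ℝ) / m ≤ C := by rwa [div_le_iff₀ hm0]
  have := gaussianEighth_nonneg
  gcongr

/-- The sample model of the random features. -/
def featureModel {N : ℕ} {c₀ C₀ : ℝ} (hc₀ : 0 < c₀) (hN : c₀ * m ≤ N) (hN' : N ≤ C₀ * m) :
    SampleModel ι N d where
  x := featureVec σ φ A
  m := m
  L := Kσ * KS * Kφ
  b := momentBound σ φ Kσ Kφ KS C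
  c₀ := c₀
  C₀ := C₀
  one_le_m := hm
  L_nonneg := mul_nonneg (mul_nonneg Kσ.2 ((norm_nonneg _).trans hA)) Kφ.2
  c₀_pos := hc₀
  le_N := hN
  N_le := hN'
  measurable_x := measurable_featureVec hσ hφ
  lipschitz := vecLipschitz_featureVec hσ hφ hA
  integrable_moment := integrable_featureVec_moment hσ hφ hA hm hι hd
  moment_le := integral_featureVec_moment_le hσ hφ hA hm hι hd

end FeatureModel

-- The spectrum of H - ξ is nonnegative, so H - ξ is positive semidefinite.
open scoped MatrixOrder in
lemma coercive_of_spectrum_subset {ι : Type*} [Fintype ι] [DecidableEq ι] {H : Matrix ι ι ℝ}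
    {ξ ξ' : ℝ} (hH : H.IsHermitian) (hs : spectrum ℝ H ⊆ Set.Icc ξ ξ') : Coercive H ξ := by
  have hpsd : (H - algebraMap ℝ (Matrix ι ι ℝ) ξ).PosSemidef := by
    refine Matrix.posSemidef_iff_isHermitian_and_spectrum_nonneg.2 ⟨?_, ?_⟩
    · refine hH.sub ?_
      rw [Algebra.algebraMap_eq_smul_one, Matrix.IsHermitian, Matrix.conjTranspose_smul,
        Matrix.conjTranspose_one, star_trivial]
    · rw [← spectrum.sub_singleton_eq]
      rintro x ⟨y, hy, z, hz, rfl⟩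
      rw [Set.mem_singleton_iff] at hz
      subst hz
      exact sub_nonneg.2 (hs hy).1
  intro v
  have h := hpsd.dotProduct_mulVec_nonneg v
  rw [Algebra.algebraMap_eq_smul_one, Matrix.sub_mulVec, dotProduct_sub, Matrix.smul_mulVec,
    Matrix.one_mulVec, dotProduct_smul, smul_eq_mul, star_trivial] at h
  linarith

/-! ### Expectation of an affine function of a random matrix -/

section AffineExpectation

variable {Ω : Type*} [MeasurableSpace Ω] {μ : Measure Ω} {ι ν ρ : Type*} [Fintype ι]
  [Fintype ν] {T : Ω → Matrix ι ι ℝ} (hT : ∀ i j, Integrable (fun ω => T ω i j) μ)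
  (M : Matrix ρ ρ ℝ) (L : Matrix ρ ι ℝ) (R : Matrix ι ρ ℝ)

lemma mul_mul_apply_eq (L : Matrix ρ ι ℝ) (X : Matrix ι ι ℝ) (R : Matrix ι ρ ℝ) (i j : ρ) :
    (L * X * R) i j = L i ⬝ᵥ X *ᵥ Rᵀ j := by
  rw [Matrix.mul_assoc, Matrix.mul_apply']
  rfl

include hT

lemma integrable_add_mul_mul [IsFiniteMeasure μ] (i j : ρ) :
    Integrable (fun ω => (M + L * T ω * R) i j) μ := by
  simp only [Matrix.add_apply, mul_mul_apply_eq]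
  exact (integrable_const _).add (integrable_dotProduct_mulVec hT _ _)

lemma expMat_add_mul_mul [IsProbabilityMeasure μ] [Fintype ρ] :
    expMat μ (fun ω => M + L * T ω * R) = M + L * expMat μ T * R := by
  ext i j
  rw [Matrix.add_apply, mul_mul_apply_eq, dotProduct_expMat_mulVec hT]
  simp only [expMat, Matrix.of_apply, Matrix.add_apply, mul_mul_apply_eq]
  rw [integral_add (integrable_const _) (integrable_dotProduct_mulVec hT _ _)]
  simp

end AffineExpectation

/-! ### Application to the training data -/

namespace TrainingData

variable {d n : ℕ} (D : TrainingData d n) {σ φ : ℝ → ℝ} {Kσ Kφ : ℝ≥0} {κ γ lam ξ ξ' : ℝ} {N : ℕ}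

lemma card_visited : Fintype.card D.visited = D.m := Fintype.card_coe _

lemma coercive_transitionModel (h : spectrum ℝ (D.symmTransitionModel κ γ) ⊆ Set.Icc ξ ξ') :
    Coercive (D.transitionModel κ γ) ξ := by
  have hH : (D.symmTransitionModel κ γ).IsHermitian := by
    rw [Matrix.IsHermitian, Matrix.conjTranspose_eq_transpose_of_trivial, symmTransitionModel,
      Matrix.transpose_smul, Matrix.transpose_add, Matrix.transpose_transpose, add_comm]
  intro v
  have h1 := coercive_of_spectrum_subset hH h v
  rw [symmTransitionModel, Matrix.smul_mulVec, Matrix.add_mulVec, dotProduct_smul, dotProduct_add,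
    dotProduct_mulVec_comm (D.transitionModel κ γ)ᵀ, Matrix.transpose_transpose, smul_eq_mul] at h1
  linarith

lemma resolventInv_eq_gram (W : Matrix (Fin N) (Fin d) ℝ) :
    D.resolventInv σ κ γ lam W = (D.U κ - γ • D.V κ)ᵀ *
      (((√D.m)⁻¹ • features σ W D.stateMatrix)ᵀ * ((√D.m)⁻¹ • features σ W D.stateMatrix)) * D.U κ +
      lam • (1 : Matrix (Fin n) (Fin n) ℝ) := by
  have e : ((√D.m)⁻¹ • features σ W D.stateMatrix)ᵀ * ((√D.m)⁻¹ • features σ W D.stateMatrix) =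
      (1 / (D.m : ℝ)) • ((features σ W D.stateMatrix)ᵀ * features σ W D.stateMatrix) := by
    rw [Matrix.transpose_smul, Matrix.smul_mul, Matrix.mul_smul, smul_smul, ← mul_inv,
      Real.mul_self_sqrt (Nat.cast_nonneg _), one_div]
  rw [e, resolventInv, Matrix.mul_smul, Matrix.smul_mul]

lemma resolventInv_weights (W' : Fin N → Fin d → ℝ) :
    D.resolventInv σ κ γ lam (weights φ W') = (D.U κ - γ • D.V κ)ᵀ *
      ((sampleMatrix (featureVec σ φ D.stateMatrix) (√D.m)⁻¹ W')ᵀ *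
        sampleMatrix (featureVec σ φ D.stateMatrix) (√D.m)⁻¹ W') * D.U κ +
      lam • (1 : Matrix (Fin n) (Fin n) ℝ) :=
  D.resolventInv_eq_gram (weights φ W')

section Coercive

variable (hA : Coercive (D.transitionModel κ γ) ξ) (hξ : 0 < ξ) (hl : 0 < lam)
include hA hξ hl

lemma isUnit_resolventInv (W : Matrix (Fin N) (Fin d) ℝ) :
    IsUnit (D.resolventInv σ κ γ lam W) := by
  obtain ⟨q, hq, hAq⟩ := exists_inv_coercive hA hξ
  rw [resolventInv_eq_gram]
  exact IsUnit.of_mul_eq_one _ (push_through (A := D.transitionModel κ γ) rfl (hA.mul_inv_self hξ)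
    ((hAq.smul hl.le).mul_res (mul_pos hl hq) _) hl.ne')

/-- The randomness enters only through `res`, and affinely, so expectations pass through. -/
lemma Q_eq (W' : Fin N → Fin d → ℝ) : D.Q σ κ γ lam (weights φ W') =
    lam⁻¹ • (1 - (D.U κ - γ • D.V κ)ᵀ * (D.transitionModel κ γ)⁻¹ * D.U κ) +
      (D.U κ - γ • D.V κ)ᵀ * (D.transitionModel κ γ)⁻¹ * res (lam • (D.transitionModel κ γ)⁻¹)
        (sampleMatrix (featureVec σ φ D.stateMatrix) (√D.m)⁻¹ W') *
        ((D.transitionModel κ γ)⁻¹ * D.U κ) := by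
  obtain ⟨q, hq, hAq⟩ := exists_inv_coercive hA hξ
  rw [Q, resolventInv_weights, push_through_inv (A := D.transitionModel κ γ) rfl (hA.mul_inv_self hξ)
    ((hAq.smul hl.le).mul_res (mul_pos hl hq) _) hl.ne']
  simp only [Matrix.mul_assoc]

variable (hσ : LipschitzWith Kσ σ) (hφ : LipschitzWith Kφ φ)
include hσ hφ

lemma integrable_res_apply (i j : D.visited) :
    Integrable (fun W' => res (lam • (D.transitionModel κ γ)⁻¹)
      (sampleMatrix (featureVec σ φ D.stateMatrix) (√D.m)⁻¹ W') i j) (gaussianMatrix N d) := by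
  obtain ⟨q, hq, hAq⟩ := exists_inv_coercive hA hξ
  have hL : 0 ≤ Kσ * ‖D.stateMatrix‖ * Kφ := by positivity
  exact ((matLipschitz_sampleMatrix (vecLipschitz_featureVec hσ hφ le_rfl) hL
    (by positivity)).res (hAq.smul hl.le) (mul_pos hl hq)).integrable_apply (by positivity) i j

lemma integrable_Q_apply (i j : Fin n) :
    Integrable (fun W' => D.Q σ κ γ lam (weights φ W') i j) (gaussianMatrix N d) := by
  simp only [D.Q_eq hA hξ hl]
  exact integrable_add_mul_mul (D.integrable_res_apply hA hξ hl hσ hφ) _ _ _ i j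

lemma expectedQ_eq : D.expectedQ σ φ κ γ lam N =
    lam⁻¹ • (1 - (D.U κ - γ • D.V κ)ᵀ * (D.transitionModel κ γ)⁻¹ * D.U κ) +
      (D.U κ - γ • D.V κ)ᵀ * (D.transitionModel κ γ)⁻¹ *
        expMat (gaussianMatrix N d) (fun W' => res (lam • (D.transitionModel κ γ)⁻¹)
          (sampleMatrix (featureVec σ φ D.stateMatrix) (√D.m)⁻¹ W')) *
        ((D.transitionModel κ γ)⁻¹ * D.U κ) := by
  rw [← expMat_add_mul_mul (D.integrable_res_apply hA hξ hl hσ hφ)]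
  simp only [← D.Q_eq hA hξ hl]
  rfl

omit hA hξ hl in
lemma exists_gram_Phi : ∃ B : Matrix D.visited D.visited ℝ, D.Phi σ φ = Bᵀ * B := by
  -- An auxiliary model with one sample and size parameter m + 1: positivity of Φ needs no
  -- asymptotic regime, and m + 1 ≥ 1 also covers an empty data set.
  have h0 : (0 : ℝ) < D.m + 1 := by positivity
  have hd : (d : ℝ) ≤ d * (D.m + 1) :=
    le_mul_of_one_le_right (Nat.cast_nonneg _) (by simp)
  have h1 : ((D.m : ℝ) + 1)⁻¹ * (D.m + 1) = (1 : ℕ) := by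
    rw [inv_mul_cancel₀ h0.ne', Nat.cast_one]
  exact (featureModel hσ hφ (le_refl ‖D.stateMatrix‖) (by simp)
    (by rw [card_visited]; simp) hd (inv_pos.2 h0) h1.le h1.ge).exists_gram

variable {δ : ℝ} (hδ : 0 ≤ δ)
include hδ

omit hA hξ hl hσ hφ hδ in
lemma QbarInv_eq : D.QbarInv σ φ κ γ lam N δ = (D.U κ - γ • D.V κ)ᵀ *
    (((N : ℝ) / D.m * (1 + δ)⁻¹) • D.Phi σ φ) * D.U κ + lam • (1 : Matrix (Fin n) (Fin n) ℝ) := by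
  rw [QbarInv, B, Matrix.mul_smul, Matrix.smul_mul, one_div]

lemma regularized_Phi_mul_inv :
    (lam • (D.transitionModel κ γ)⁻¹ + ((N : ℝ) / D.m * (1 + δ)⁻¹) • D.Phi σ φ) *
      (lam • (D.transitionModel κ γ)⁻¹ + ((N : ℝ) / D.m * (1 + δ)⁻¹) • D.Phi σ φ)⁻¹ = 1 := by
  obtain ⟨B, hB⟩ := D.exists_gram_Phi hσ hφ
  obtain ⟨q, hq, hM⟩ := coercive_add_gram hA hξ hB
    (by positivity : 0 ≤ (N : ℝ) / D.m * (1 + δ)⁻¹) hl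
  exact hM.mul_inv_self hq

lemma isUnit_QbarInv : IsUnit (D.QbarInv σ φ κ γ lam N δ) := by
  rw [QbarInv_eq]
  exact IsUnit.of_mul_eq_one _ (push_through (A := D.transitionModel κ γ) rfl (hA.mul_inv_self hξ)
    (D.regularized_Phi_mul_inv hA hξ hl hσ hφ hδ) hl.ne')

lemma Qbar_eq : D.Qbar σ φ κ γ lam N δ =
    lam⁻¹ • (1 - (D.U κ - γ • D.V κ)ᵀ * (D.transitionModel κ γ)⁻¹ * D.U κ) +
      (D.U κ - γ • D.V κ)ᵀ * (D.transitionModel κ γ)⁻¹ *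
        (lam • (D.transitionModel κ γ)⁻¹ + ((N : ℝ) / D.m * (1 + δ)⁻¹) • D.Phi σ φ)⁻¹ *
        ((D.transitionModel κ γ)⁻¹ * D.U κ) := by
  rw [Qbar, QbarInv_eq, push_through_inv (A := D.transitionModel κ γ) rfl (hA.mul_inv_self hξ)
    (D.regularized_Phi_mul_inv hA hξ hl hσ hφ hδ) hl.ne']
  simp only [Matrix.mul_assoc]

/-- The fixed-point equation in the variable `1 + δ`. -/
lemma solvesFixedPoint_iff : D.SolvesFixedPoint σ φ κ γ lam N δ ↔
    1 - (1 + δ)⁻¹ = (D.m : ℝ)⁻¹ *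
      traceFun (D.transitionModel κ γ) (D.Phi σ φ) ((N : ℝ) / D.m) (lam * (1 + δ)) := by
  obtain ⟨B, hB⟩ := D.exists_gram_Phi hσ hφ
  have ht : 0 < 1 + δ := by linarith
  have e : (D.B σ φ κ γ * D.Qbar σ φ κ γ lam N δ).trace = (1 + δ) *
      traceFun (D.transitionModel κ γ) (D.Phi σ φ) ((N : ℝ) / D.m) (lam * (1 + δ)) := by
    rw [← trace_rescaled hA hξ hB (by positivity) hl ht, Qbar, QbarInv_eq, TrainingData.B,
      push_through_trace (A := D.transitionModel κ γ) rfl (hA.mul_inv_self hξ) (hA.inv_mul_self hξ)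
        (D.regularized_Phi_mul_inv hA hξ hl hσ hφ hδ) hl.ne']
  rw [SolvesFixedPoint, e]
  set G := traceFun (D.transitionModel κ γ) (D.Phi σ φ) ((N : ℝ) / D.m) (lam * (1 + δ))
  have h1 : 1 - (1 + δ)⁻¹ = δ * (1 + δ)⁻¹ := by field_simp; ring
  rw [h1, mul_inv_eq_iff_eq_mul₀ ht.ne', one_div]
  constructor <;> intro h <;> linarith

end Coercive

end TrainingData

/-! ### The fixed-point equation of a data set -/

namespace TrainingData

variable {d n : ℕ} (D : TrainingData d n) {σ φ : ℝ → ℝ} {Kσ Kφ : ℝ≥0} {κ γ lam ξ ξ' : ℝ} {N : ℕ}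

/-- The right-hand side of the fixed-point equation. -/
def fixedPointFun (σ φ : ℝ → ℝ) (κ γ : ℝ) (N : ℕ) (s : ℝ) : ℝ :=
  (D.m : ℝ)⁻¹ * traceFun (D.transitionModel κ γ) (D.Phi σ φ) ((N : ℝ) / D.m) s

lemma m_pos_of_Phi_ne_zero (h : D.Phi σ φ ≠ 0) : (0 : ℝ) < D.m := by
  rw [Nat.cast_pos, Nat.pos_iff_ne_zero]
  intro h0
  refine h (Matrix.ext fun i => ?_)
  have : D.visited = ∅ := Finset.card_eq_zero.1 h0
  exact absurd i.2 (by simp [this])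

section FixedPointFun

variable (hA : Coercive (D.transitionModel κ γ) ξ) (hξ : 0 < ξ) (hσ : LipschitzWith Kσ σ)
  (hφ : LipschitzWith Kφ φ)
include hA hξ hσ hφ

lemma fixedPointFun_antitoneOn : AntitoneOn (D.fixedPointFun σ φ κ γ N) (Set.Ioi 0) := by
  obtain ⟨B, hB⟩ := D.exists_gram_Phi hσ hφ
  exact fun s hs s' hs' h => mul_le_mul_of_nonneg_left
    (traceFun_antitoneOn hA hξ hB (by positivity) hs hs' h) (by positivity)

lemma fixedPointFun_strictAntiOn (hΦ : D.Phi σ φ ≠ 0) :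
    StrictAntiOn (D.fixedPointFun σ φ κ γ N) (Set.Ioi 0) := by
  obtain ⟨B, hB⟩ := D.exists_gram_Phi hσ hφ
  exact fun s hs s' hs' h => mul_lt_mul_of_pos_left
    (traceFun_strictAntiOn hA hξ hB (by positivity) hΦ hs hs' h)
    (inv_pos.2 (D.m_pos_of_Phi_ne_zero hΦ))

lemma fixedPointFun_nonneg {s : ℝ} (hs : 0 < s) : 0 ≤ D.fixedPointFun σ φ κ γ N s := by
  obtain ⟨B, hB⟩ := D.exists_gram_Phi hσ hφ
  exact mul_nonneg (by positivity) (traceFun_nonneg hA hξ hB (by positivity) hs)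

lemma fixedPointFun_pos (hΦ : D.Phi σ φ ≠ 0) {s : ℝ} (hs : 0 < s) :
    0 < D.fixedPointFun σ φ κ γ N s := by
  obtain ⟨B, hB⟩ := D.exists_gram_Phi hσ hφ
  exact mul_pos (inv_pos.2 (D.m_pos_of_Phi_ne_zero hΦ))
    (traceFun_pos hA hξ hB (by positivity) hΦ hs)

lemma fixedPointFun_tendsto : Tendsto (D.fixedPointFun σ φ κ γ N) atTop (𝓝 0) := by
  obtain ⟨B, hB⟩ := D.exists_gram_Phi hσ hφ
  have h := (traceFun_tendsto hA hξ hB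
    (by positivity : 0 ≤ (N : ℝ) / D.m)).const_mul (D.m : ℝ)⁻¹
  rwa [mul_zero] at h

lemma fixedPointFun_continuousOn :
    ContinuousOn (D.fixedPointFun σ φ κ γ N) (Set.Ioi 0) := by
  obtain ⟨B, hB⟩ := D.exists_gram_Phi hσ hφ
  exact continuousOn_const.mul (traceFun_continuousOn hA hξ hB (by positivity))

lemma fixedPointFun_le_div (hN : 0 < N) {s : ℝ} (hs : 0 < s) :
    D.fixedPointFun σ φ κ γ N s ≤ D.m / N := by
  obtain ⟨B, hB⟩ := D.exists_gram_Phi hσ hφ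
  rcases Nat.eq_zero_or_pos D.m with h0 | h0
  · simp [fixedPointFun, h0]
  · have h1 := mul_traceFun_le hA hξ hB (by positivity : 0 ≤ (N : ℝ) / D.m) hs
    rw [card_visited] at h1
    rw [fixedPointFun, le_div_iff₀ (by positivity)]
    refine le_trans (le_of_eq ?_) h1
    ring

lemma exists_correction (N : ℕ) (hl : 0 < lam) :
    ∃ δ, 0 ≤ δ ∧ 1 - (1 + δ)⁻¹ = D.fixedPointFun σ φ κ γ N (lam * (1 + δ)) := by
  obtain ⟨t, ht, h⟩ := exists_fixed_point (D.fixedPointFun_continuousOn hA hξ hσ hφ (N := N))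
    (fun s hs => D.fixedPointFun_nonneg hA hξ hσ hφ hs) (D.fixedPointFun_tendsto hA hξ hσ hφ) hl
  exact ⟨t - 1, by linarith, by rwa [add_sub_cancel]⟩

end FixedPointFun

/-! ### Quantitative operator norm estimate -/

section OperatorNorm

variable {K KS c C : ℝ} (hK : 0 < K) (hU : ‖D.U κ‖ ≤ K) (hV : ‖D.V κ‖ ≤ K) (hγ0 : 0 ≤ γ)
  (hγ1 : γ < 1)
include hK hU hV hγ0 hγ1

lemma norm_U_sub_V_le : ‖(D.U κ - γ • D.V κ)ᵀ‖ ≤ 2 * K := by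
  rw [norm_transpose]
  refine (norm_sub_le _ _).trans ?_
  rw [norm_smul, Real.norm_of_nonneg hγ0]
  have := mul_le_mul hγ1.le hV (norm_nonneg _) zero_le_one
  linarith

lemma norm_transitionModel_le : ‖D.transitionModel κ γ‖ ≤ K * (2 * K) :=
  (Matrix.l2_opNorm_mul _ _).trans
    (mul_le_mul hU (D.norm_U_sub_V_le hK hU hV hγ0 hγ1) (norm_nonneg _) hK.le)

/-- The expected resolvent is close to the deterministic resolvent. -/
theorem norm_expectedQ_sub_Qbar_le (hσ : LipschitzWith Kσ σ) (hφ : LipschitzWith Kφ φ)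
    (hA : Coercive (D.transitionModel κ γ) ξ) (hξ : 0 < ξ) (hl : 0 < lam) (hm : 1 ≤ D.m)
    (hS : ‖D.stateMatrix‖ ≤ KS) (hd : d ≤ C * D.m) (hc : 0 < c) (hN : c * D.m ≤ N)
    (hN' : N ≤ C * D.m) {δ : ℝ} (hδ : 0 ≤ δ)
    (hfix : 1 - (1 + δ)⁻¹ = D.fixedPointFun σ φ κ γ N (lam * (1 + δ))) :
    ‖D.expectedQ σ φ κ γ lam N - D.Qbar σ φ κ γ lam N δ‖ ≤
      2 * K * ξ⁻¹ * (BoundParams.mk (Kσ * KS * Kφ) (momentBound σ φ Kσ Kφ KS C) c C).boundTotal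
        (lam * (ξ * ((K * (2 * K)) ^ 2)⁻¹)) * (ξ⁻¹ * K) * (√D.m)⁻¹ := by
  have hAK := D.norm_transitionModel_le hK hU hV hγ0 hγ1
  have hP := (hA.inv hξ (by positivity) hAK).smul hl.le
  have hAi := hA.norm_inv_le hξ
  have h1 := (featureModel hσ hφ hS (by exact_mod_cast hm) (by rw [card_visited]) hd hc hN
    hN').norm_expMat_res_sub_equivalent_le hA hξ hl (by positivity) hP
      (by linarith : 1 ≤ 1 + δ) hfix
  -- The affine parts agree and cancel, leaving the difference of the resolvents between bounded
  -- factors.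
  rw [D.expectedQ_eq hA hξ hl hσ hφ, D.Qbar_eq hA hξ hl hσ hφ hδ, add_sub_add_left_eq_sub,
    ← Matrix.sub_mul, ← Matrix.mul_sub]
  refine (norm_mul₃_le _ _ _ ((Matrix.l2_opNorm_mul _ _).trans (mul_le_mul
    (D.norm_U_sub_V_le hK hU hV hγ0 hγ1) hAi (norm_nonneg _) (by positivity))) h1
    ((Matrix.l2_opNorm_mul _ _).trans (mul_le_mul hAi hU (norm_nonneg _)
      (inv_pos.2 hξ).le))).trans (le_of_eq ?_)
  have e : ∀ u v x y : ℝ, u * (v * x) * y = u * v * y * x := fun u v x y => by ring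
  exact e _ _ _ _

end OperatorNorm

end TrainingData

end RFLSTD

end

/-! ### Assembly of the theorem -/

theorem theorem1 (σ φ : ℝ → ℝ) (Kσ Kφ : ℝ≥0) (hσ : LipschitzWith Kσ σ) (hφ : LipschitzWith Kφ φ)
    (γ : ℝ) (hγ0 : 0 ≤ γ) (hγ1 : γ < 1)
    (N d n : ℕ → ℕ) (D : ∀ k, RFLSTD.TrainingData (d k) (n k)) (κ : ℕ → ℝ)
    (hreg : RFLSTD.DoubleAsymptotic N d n D)
    (hκ : RFLSTD.BoundedNormalization D κ)
    (hspec : RFLSTD.BoundedSpectrum D κ γ) :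
    -- the random resolvent exists and has an expectation
    (∀ k M (lam : ℝ), 0 < lam →
      (∀ W : Matrix (Fin M) (Fin (d k)) ℝ, IsUnit ((D k).resolventInv σ (κ k) γ lam W)) ∧
      ∀ i j, Integrable (fun W' => (D k).Q σ (κ k) γ lam (RFLSTD.weights φ W') i j)
        (RFLSTD.gaussianMatrix M (d k))) ∧
    -- the correction factor, as a function of the data set, the number of features and `lam`
    ∃ δ : ℕ → ℕ → ℝ → ℝ,
      (∀ k M (lam : ℝ), 0 < lam →
        0 ≤ δ k M lam ∧
        (D k).SolvesFixedPoint σ φ (κ k) γ lam M (δ k M lam) ∧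
        (∀ δ' : ℝ, 0 ≤ δ' → (D k).SolvesFixedPoint σ φ (κ k) γ lam M δ' → δ' = δ k M lam) ∧
        ((D k).Phi σ φ ≠ 0 → 0 < δ k M lam) ∧
        IsUnit ((D k).QbarInv σ φ (κ k) γ lam M (δ k M lam))) ∧
      -- the asymptotic equivalence in operator norm
      (∀ lam : ℝ, 0 < lam →
        Tendsto (fun k => ‖(D k).expectedQ σ φ (κ k) γ lam (N k) -
          (D k).Qbar σ φ (κ k) γ lam (N k) (δ k (N k) lam)‖) atTop (𝓝 0)) ∧
      -- the correction factor diminishes as `lam` or the number of features grows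
      (∀ k M, ((D k).Phi σ φ ≠ 0 → StrictAntiOn (δ k M) (Set.Ioi 0)) ∧
        Tendsto (δ k M) atTop (𝓝 0)) ∧
      (∀ k (lam : ℝ), 0 < lam → Tendsto (fun M => δ k M lam) atTop (𝓝 0)) := by
  obtain ⟨ξ, ξ', hξ, hspec⟩ := hspec
  have hA : ∀ k, RFLSTD.Coercive ((D k).transitionModel (κ k) γ) ξ := fun k =>
    (D k).coercive_transitionModel (hspec k)
  refine ⟨fun k M lam hl => ⟨(D k).isUnit_resolventInv (hA k) hξ hl,
    (D k).integrable_Q_apply (hA k) hξ hl hσ hφ⟩, ?_⟩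
  -- The implication lets δ be chosen as a total function of `lam`; its values at `lam ≤ 0` carry no
  -- information.
  have hex : ∀ k M (lam : ℝ), ∃ δ, 0 < lam → 0 ≤ δ ∧
      1 - (1 + δ)⁻¹ = (D k).fixedPointFun σ φ (κ k) γ M (lam * (1 + δ)) := fun k M lam => by
    by_cases hl : 0 < lam
    · obtain ⟨δ, h⟩ := (D k).exists_correction (hA k) hξ hσ hφ M hl
      exact ⟨δ, fun _ => h⟩
    · exact ⟨0, fun h => absurd h hl⟩
  choose δ hδ using hex
  refine ⟨δ, fun k M lam hl => ?_, fun lam hl => ?_, fun k M => ⟨fun hΦ => ?_, ?_⟩,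
    fun k lam hl => ?_⟩
  · obtain ⟨h0, hfix⟩ := hδ k M lam hl
    refine ⟨h0, ((D k).solvesFixedPoint_iff (hA k) hξ hl hσ hφ h0).2 hfix, fun δ' h0' h' => ?_,
      fun hΦ => ?_, (D k).isUnit_QbarInv (hA k) hξ hl hσ hφ h0⟩
    · have h1 := ((D k).solvesFixedPoint_iff (hA k) hξ hl hσ hφ h0').1 h'
      have h2 := RFLSTD.fixed_point_unique ((D k).fixedPointFun_antitoneOn (hA k) hξ hσ hφ) hl
        (by linarith : 0 < 1 + δ') (by linarith : 0 < 1 + δ k M lam) h1 hfix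
      linarith
    · refine lt_of_le_of_ne h0 fun h => ?_
      have h1 := (D k).fixedPointFun_pos (hA k) hξ hσ hφ hΦ (N := M) (s := lam * (1 + δ k M lam))
        (mul_pos hl (by linarith))
      rw [← hfix, ← h] at h1
      norm_num at h1
  · obtain ⟨K, hK⟩ := hκ
    obtain ⟨c, C, hc, hr⟩ := hreg.ratios
    obtain ⟨KS, hS⟩ := hreg.states_bounded
    have hm := hreg.m_tendsto
    -- A strictly positive bound replaces K, which may vanish.
    have hK0 : 0 < |K| + 1 := by positivity
    have hlim : Tendsto (fun k => (√((D k).m : ℝ))⁻¹) atTop (𝓝 0) :=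
      tendsto_inv_atTop_zero.comp (Real.tendsto_sqrt_atTop.comp
        (tendsto_natCast_atTop_atTop.comp hm))
    have hlim2 := hlim.const_mul (2 * (|K| + 1) * ξ⁻¹ * (RFLSTD.BoundParams.mk (Kσ * KS * Kφ)
      (RFLSTD.momentBound σ φ Kσ Kφ KS C) c C).boundTotal
        (lam * (ξ * (((|K| + 1) * (2 * (|K| + 1))) ^ 2)⁻¹)) * (ξ⁻¹ * (|K| + 1)))
    rw [mul_zero] at hlim2
    refine squeeze_zero' (Eventually.of_forall fun k => norm_nonneg _) ?_ hlim2
    filter_upwards [hr, hS, hm.eventually_ge_atTop 1] with k hrk hSk hmk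
    have hm0 : (0 : ℝ) < (D k).m := by exact_mod_cast hmk
    obtain ⟨h0, hfix⟩ := hδ k (N k) lam hl
    have hKle : K ≤ |K| + 1 := (le_abs_self K).trans (by linarith)
    exact (D k).norm_expectedQ_sub_Qbar_le hK0 ((hK k).2.1.trans hKle) ((hK k).2.2.trans hKle)
      hγ0 hγ1 hσ hφ (hA k) hξ hl hmk hSk ((div_le_iff₀ hm0).1 hrk.2.2) hc
      ((le_div_iff₀ hm0).1 hrk.1.1) ((div_le_iff₀ hm0).1 hrk.1.2) h0 hfix
  · intro lam hl lam' hl' hll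
    obtain ⟨h0, hfix⟩ := hδ k M lam hl
    obtain ⟨h0', hfix'⟩ := hδ k M lam' hl'
    have h1 := RFLSTD.fixed_point_strictAnti
      ((D k).fixedPointFun_strictAntiOn (hA k) hξ hσ hφ hΦ) hl hll
      (by linarith : 0 < 1 + δ k M lam) (by linarith : 0 < 1 + δ k M lam') hfix hfix'
    linarith
  · have h1 : Tendsto (fun lam => 1 + δ k M lam - 1) atTop (𝓝 0) := by
      refine RFLSTD.tendsto_sub_one_of_fixed_point
        (v := fun lam => (D k).fixedPointFun σ φ (κ k) γ M (lam * (1 + δ k M lam))) ?_ ?_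
      · filter_upwards [eventually_gt_atTop 0] with lam hl
        obtain ⟨h0, hfix⟩ := hδ k M lam hl
        exact ⟨by linarith, hfix⟩
      -- Since 1 + δ ≥ 1 and g is antitone, g(λ(1+δ)) ≤ g(λ) → 0.
      · refine squeeze_zero' ?_ ?_ ((D k).fixedPointFun_tendsto (hA k) hξ hσ hφ (N := M))
        · filter_upwards [eventually_gt_atTop 0] with lam hl
          exact (D k).fixedPointFun_nonneg (hA k) hξ hσ hφ
            (mul_pos hl (by linarith [(hδ k M lam hl).1]))
        · filter_upwards [eventually_gt_atTop 0] with lam hl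
          have h0 := (hδ k M lam hl).1
          exact (D k).fixedPointFun_antitoneOn (hA k) hξ hσ hφ hl
            (mul_pos hl (by linarith) : 0 < lam * (1 + δ k M lam))
            (le_mul_of_one_le_right hl.le (by linarith))
    simpa using h1
  · have h1 : Tendsto (fun M => 1 + δ k M lam - 1) atTop (𝓝 0) := by
      refine RFLSTD.tendsto_sub_one_of_fixed_point
        (v := fun M => (D k).fixedPointFun σ φ (κ k) γ M (lam * (1 + δ k M lam))) ?_ ?_
      · refine Eventually.of_forall fun M => ?_
        obtain ⟨h0, hfix⟩ := hδ k M lam hl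
        exact ⟨by linarith, hfix⟩
      -- Here g itself changes with M; the bound m/M holds at every positive argument, so no control
      -- of δ beyond δ ≥ 0 is needed.
      · refine squeeze_zero' (Eventually.of_forall fun M => ?_) ?_
          (tendsto_natCast_atTop_atTop.const_div_atTop ((D k).m : ℝ))
        · exact (D k).fixedPointFun_nonneg (hA k) hξ hσ hφ
            (mul_pos hl (by linarith [(hδ k M lam hl).1]))
        · filter_upwards [eventually_gt_atTop 0] with M hM
          exact (D k).fixedPointFun_le_div (hA k) hξ hσ hφ hM
            (mul_pos hl (by linarith [(hδ k M lam hl).1]))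
    simpa using h1
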